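/- Let $d\ge 2$, $k>0$, and let $\Omega\subset\mathbb{R}^d$ be a bounded non-empty open set with Lipschitz boundary (not necessarily connected), with surface measure $dS$ and outward unit normal $n$ on $\partial\Omega$. Let $$K(x,t)=(4\pi kt)^{-d/2}\exp\!\big(-|x|^2/(4kt)\big)\ \text{ for } t>0,\qquad K(x,t)=0\ \text{ for } t\le 0.$$ Let $v\in C^2\big((\mathbb{R}^d\setminus\Omega)\times[0,\infty)\big)$ be real-valued and satisfy $\partial_t v=k\Delta v+h$ in $(\mathbb{R}^d\setminus\overline\Omega)\times(0,\infty)$, where the support of $h(\cdot,t)$ is contained in $\overline\Omega$ for every $t>0$, and $v(x,0)=0$ for $x\in\mathbb{R}^d\setminus\Omega$. Suppose that there are $r_0>0$, $C>0$, $a\ge 0$, $0\le b<2$ and $m\in\mathbb{Z}$ such that $$\Big|\frac{\partial v}{\partial n}(r\xi,t)+\frac{2r}{4kt}\,v(r\xi,t)\Big|\le C\,r^m e^{a r^b}\qquad\text{for all } r>r_0,\ t>0,\ |\xi|=1,$$ where $\partial v/\partial n$ is here the derivative in the radial direction $\xi$. Then for every $t>0$ and every $x\notin\partial\Omega$ the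 function $$(s,y)\mapsto \frac{\partial v}{\partial n}(y,s)\,K(x-y,t-s)-v(y,s)\,\frac{\partial}{\partial n(y)}\big[K(x-y,t-s)\big]$$ is integrable on $(0,t)\times\partial\Omega$, and $$-k\int_0^t ds\int_{\partial\Omega}dS(y)\,\Big[\frac{\partial v}{\partial n}(y,s)\,K(x-y,t-s)-v(y,s)\,\frac{\partial}{\partial n(y)}\big[K(x-y,t-s)\big]\Big]=\begin{cases}0,& x\in\Omega,\\ v(x,t),& x\notin\overline\Omega.\end{cases}$$ Here $\partial/\partial n(y)$ is the derivative in $y$ in the direction $n(y)$, and $\partial v/\partial n$ on $\partial\Omega$ is computed from outside $\Omega$. -/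

import Mathlib

open Set Filter Topology MeasureTheory InnerProductSpace
open scoped NNReal

/-- Lipschitz boundary: near each boundary point, after a rigid change of coordinates, the set is
the strict subgraph of a Lipschitz function of `d - 1` variables (here the coordinates are the
component along a unit vector `e` and the orthogonal projection onto the hyperplane `e^⊥`). -/
def HasLipschitzBoundary {d : ℕ} (Ω : Set (EuclideanSpace ℝ (Fin d))) : Prop :=
  ∀ y ∈ frontier Ω, ∃ (e : EuclideanSpace ℝ (Fin d)) (γ : (ℝ ∙ e)ᗮ → ℝ) (L : ℝ≥0),
    ‖e‖ = 1 ∧ LipschitzWith L γ ∧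
      ∀ᶠ z in 𝓝 y, (z ∈ Ω ↔ inner ℝ e z < γ ((ℝ ∙ e)ᗮ.orthogonalProjectionOnto z))

/-- `ν` is the outward unit normal of `Ω` at `y`: the set `Ω` is tangent at `y` to the half-space
`{z | ⟪z - y, ν⟫ < 0}`, that is, every cone strictly inside this half-space lies in `Ω` near `y`,
and every cone strictly inside the opposite half-space avoids `Ω` near `y`. -/
def IsOutwardUnitNormalAt {d : ℕ} (Ω : Set (EuclideanSpace ℝ (Fin d)))
    (y ν : EuclideanSpace ℝ (Fin d)) : Prop :=
  ‖ν‖ = 1 ∧ ∀ ε > (0 : ℝ), ∀ᶠ z in 𝓝 y,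
    (inner ℝ (z - y) ν < -(ε * ‖z - y‖) → z ∈ Ω) ∧
    (ε * ‖z - y‖ < inner ℝ (z - y) ν → z ∉ Ω)

/-- The outward unit normal at a point is unique. -/
theorem IsOutwardUnitNormalAt.unique {d : ℕ} {Ω : Set (EuclideanSpace ℝ (Fin d))} {y ν ν' : EuclideanSpace ℝ (Fin d)}
    (h : IsOutwardUnitNormalAt Ω y ν) (h' : IsOutwardUnitNormalAt Ω y ν') : ν = ν' := by
  by_contra hne
  obtain ⟨h1, h2⟩ := h
  obtain ⟨h1', h2'⟩ := h'
  set c : ℝ := inner ℝ ν ν'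
  have hc : c < 1 := by
    exact (inner_lt_one_iff_real_of_norm_eq_one h1 h1').2 hne
  set w := ν' - ν
  have hw1 : inner ℝ w ν = c - 1 := by
    simp [w, inner_sub_left, h1, c, real_inner_comm]
  have hw2 : inner ℝ w ν' = 1 - c := by
    simp [w, inner_sub_left, h1', c]
  have hw : 0 < ‖w‖ := norm_pos_iff.2 (sub_ne_zero.2 (Ne.symm hne))
  set ε := (1 - c) / (2 * ‖w‖)
  have hε : 0 < ε := by
    have : 0 < 1 - c := by linarith
    positivity
  have key := (h2 ε hε).and (h2' ε hε)
  have ht : Tendsto (fun s : ℝ => y + s • w) (𝓝[>] 0) (𝓝 y) := by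
    have : Continuous (fun s : ℝ => y + s • w) := by fun_prop
    have := this.tendsto 0
    simp only [zero_smul, add_zero] at this
    exact this.mono_left nhdsWithin_le_nhds
  obtain ⟨s, hs, hs0⟩ := ((ht.eventually key).and self_mem_nhdsWithin).exists
  have hs0 : 0 < s := hs0
  simp only [add_sub_cancel_left, inner_smul_left, norm_smul, Real.norm_eq_abs, abs_of_pos hs0,
    hw1, hw2, RCLike.conj_to_real] at hs
  have he : ε * (s * ‖w‖) = s * ((1 - c)/2) := by
    simp only [ε]; field_simp
  rw [he] at hs
  refine hs.2.2 ?_ (hs.1.1 ?_) <;> nlinarith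

open Classical in
/-- The outward unit normal field of `Ω`. For a Lipschitz boundary it exists almost everywhere
with respect to surface measure; it is set to `0` at the points without a normal. -/
noncomputable def outwardNormal {d : ℕ} (Ω : Set (EuclideanSpace ℝ (Fin d)))
    (y : EuclideanSpace ℝ (Fin d)) : EuclideanSpace ℝ (Fin d) :=
  if h : ∃ ν, IsOutwardUnitNormalAt Ω y ν then h.choose else 0

/-- The surface measure on `∂Ω`: the `(d - 1)`-dimensional Hausdorff measure, normalized to agree
with Lebesgue measure on hyperplanes. -/
noncomputable def surfaceMeasure {d : ℕ} (Ω : Set (EuclideanSpace ℝ (Fin d))) :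
    Measure (EuclideanSpace ℝ (Fin d)) :=
  (Measure.euclideanHausdorffMeasure (d - 1)).restrict (frontier Ω)

/-- The heat kernel of `∂ₜ - k Δ`. -/
noncomputable def heatKernel {d : ℕ} (k : ℝ) (x : EuclideanSpace ℝ (Fin d)) (t : ℝ) : ℝ :=
  if 0 < t then (4 * Real.pi * k * t) ^ (-(d : ℝ) / 2) * Real.exp (-‖x‖ ^ 2 / (4 * k * t)) else 0

/-- The growth condition: for some `r₀ > 0`, integer `m`, `C > 0`, `a ≥ 0` and `0 ≤ b < 2`,
`|∂v/∂n (r ξ, t) + (2 r / (4 k t)) v (r ξ, t)| ≤ C r ^ m exp (a r ^ b)`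
for all `r > r₀`, `t > 0` and unit vectors `ξ`, where `n = ξ` is the normal of the sphere. -/
def GrowthCondition {d : ℕ} (k : ℝ) (v : EuclideanSpace ℝ (Fin d) → ℝ → ℝ) : Prop :=
  ∃ (r₀ C a b : ℝ) (m : ℤ), 0 < r₀ ∧ 0 < C ∧ 0 ≤ a ∧ 0 ≤ b ∧ b < 2 ∧
    ∀ r > r₀, ∀ t > 0, ∀ ξ : EuclideanSpace ℝ (Fin d), ‖ξ‖ = 1 →
      |fderiv ℝ (fun z => v z t) (r • ξ) ξ + (2 * r / (4 * k * t)) * v (r • ξ) t|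
        ≤ C * r ^ m * Real.exp (a * r ^ b)

/-- `∂v/∂n (y, s) K (x - y, t - s) - v (y, s) ∂/∂n(y) [K (x - y, t - s)]`, for `y ∈ ∂Ω`, where `v`
lives on the complement of `Ω`, so that its normal derivative is the one-sided one from there. -/
noncomputable def layerIntegrand {d : ℕ} (k : ℝ) (Ω : Set (EuclideanSpace ℝ (Fin d)))
    (v : EuclideanSpace ℝ (Fin d) → ℝ → ℝ) (x : EuclideanSpace ℝ (Fin d)) (t s : ℝ)
    (y : EuclideanSpace ℝ (Fin d)) : ℝ :=
  fderivWithin ℝ (fun z => v z s) Ωᶜ y (outwardNormal Ω y) * heatKernel k (x - y) (t - s)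
    - v y s * fderiv ℝ (fun z => heatKernel k (x - z) (t - s)) y (outwardNormal Ω y)

/-- The field generated by the single and double layers on `∂Ω`. The factor `k` is
the one from the identity of Green for the operator `∂ₜ - k Δ`, whose fundamental solution is `K`. -/
noncomputable def exteriorLayerField {d : ℕ} (k : ℝ) (Ω : Set (EuclideanSpace ℝ (Fin d)))
    (v : EuclideanSpace ℝ (Fin d) → ℝ → ℝ) (x : EuclideanSpace ℝ (Fin d)) (t : ℝ) : ℝ :=
  -k * ∫ s in (0 : ℝ)..t, ∫ y, layerIntegrand k Ω v x t s y ∂(surfaceMeasure Ω)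

/-!
Fix `x ∉ ∂Ω`, a time `T < t` and a cutoff `χ` equal to `1` near `closure Ω ∪ {x}`. Where `χ = 1` the
backward kernel `K (x - y, t - s)` solves the adjoint heat equation, so
`∂ₛ (v χ K) = k (χ K Δ v - v Δ (χ K)) + error`, with an error supported where `χ` is not constant.
Integrating over `[0, T] × Ωᶜ` and applying the second identity of Green to the first term yields
`∫ v(y, T) χ(y) K(x - y, t - T) dy = -k ∫₀ᵀ (layer integral) ds + error`.
As `T → t` the left side tends to `v (x, t)` outside `closure Ω` and to `0` inside `Ω`.

The error tends to `0` as the cutoff radius grows because the growth condition bounds the radial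
derivative of `exp (r² / (4kt)) v (r ξ, t)`: integrating along rays gives `|v| ≤ A exp (α |y|²)` on
each bounded time interval for every `α > 0`, which the decay of `K` absorbs.

The divergence theorem on `Ωᶜ` is reduced by a partition of unity to the region above a Lipschitz
graph, where it combines the one-dimensional fundamental theorem of calculus with the area formula
for the graph.
-/

open scoped ENNReal
open Module

theorem euclideanHausdorffMeasure_image_le_of_edist_le {X Y Z : Type*}
    [EMetricSpace Y] [MeasurableSpace Y] [BorelSpace Y]
    [EMetricSpace Z] [MeasurableSpace Z] [BorelSpace Z] {f : X → Y} {g : X → Z} {s : Set X}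
    {K : ℝ≥0} (n : ℕ) (h : ∀ x ∈ s, ∀ y ∈ s, edist (f x) (f y) ≤ K * edist (g x) (g y)) :
    μHE[n] (f '' s) ≤ (K : ℝ≥0∞) ^ n * μHE[n] (g '' s) := by
  rcases s.eq_empty_or_nonempty with rfl | ⟨x₀, _⟩
  · simp
  have : Nonempty X := ⟨x₀⟩
  set G : Z → Y := fun z => f (Function.invFunOn g s z)
  have hG : ∀ x ∈ s, G (g x) = f x := fun x hx => by
    have hle := h _ (Function.invFunOn_mem (f := g) ⟨x, hx, rfl⟩) x hx
    rw [Function.invFunOn_eq (f := g) ⟨x, hx, rfl⟩] at hle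
    simpa [edist_eq_zero] using hle
  have hGK : LipschitzOnWith K G (g '' s) := by
    rintro _ ⟨x, hx, rfl⟩ _ ⟨y, hy, rfl⟩
    rw [hG x hx, hG y hy]
    exact h x hx y hy
  have himage : f '' s = G '' (g '' s) := by
    rw [image_image]
    exact image_congr fun x hx => (hG x hx).symm
  have hle := hGK.hausdorffMeasure_image_le (d := (n : ℝ)) (by positivity)
  rw [himage, Measure.euclideanHausdorffMeasure_def, Measure.euclideanHausdorffMeasure_def]
  simp only [Measure.smul_apply, ENNReal.smul_def, smul_eq_mul]
  rw [mul_left_comm]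
  gcongr
  simpa using hle

theorem lineDeriv_eq_zero_of_notMem_tsupport {E : Type*} [NormedAddCommGroup E] [NormedSpace ℝ E]
    {g : E → ℝ} {z : E} (hz : z ∉ tsupport g) (a : E) : lineDeriv ℝ g z a = 0 := by
  rw [(notMem_tsupport_iff_eventuallyEq.1 hz).lineDeriv_eq]
  simp [lineDeriv]

theorem integrable_lineDeriv_of_lipschitzWith {E : Type*} [NormedAddCommGroup E] [NormedSpace ℝ E]
    [MeasurableSpace E] [BorelSpace E] {μ : Measure E} [IsFiniteMeasureOnCompacts μ]
    {g : E → ℝ} {K : ℝ≥0} (hg : LipschitzWith K g) (hs : HasCompactSupport g) (a : E) :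
    Integrable (fun z => lineDeriv ℝ g z a) μ := by
  refine (integrableOn_iff_integrable_of_support_subset fun z hz => ?_).1
    (IntegrableOn.of_bound hs.measure_lt_top
      (aestronglyMeasurable_lineDeriv hg.continuous _) (K * ‖a‖)
      (.of_forall fun z => norm_lineDeriv_le_of_lipschitz ℝ hg))
  by_contra hz'
  exact hz (lineDeriv_eq_zero_of_notMem_tsupport hz' a)

theorem le_of_forall_one_lt_le_pow_mul {a b : ℝ≥0∞} (n : ℕ)
    (h : ∀ l : ℝ≥0, 1 < l → a ≤ (l : ℝ≥0∞) ^ n * b) : a ≤ b := by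
  have hlim : Tendsto (fun l : ℝ≥0 => (l : ℝ≥0∞) ^ n * b) (𝓝[>] 1) (𝓝 (1 ^ n * b)) := by
    refine ENNReal.Tendsto.mul_const ?_ (by simp)
    refine ((ENNReal.continuous_pow n).tendsto 1).comp ?_
    exact (ENNReal.continuous_coe.tendsto 1).mono_left nhdsWithin_le_nhds
  rw [one_pow, one_mul] at hlim
  exact ge_of_tendsto hlim (eventually_mem_nhdsWithin.mono h)

theorem sum_sq_apply_orthonormalBasis {ι U : Type*} [Fintype ι] [NormedAddCommGroup U]
    [InnerProductSpace ℝ U] [CompleteSpace U] (b : OrthonormalBasis ι ℝ U) (A : U →L[ℝ] ℝ) :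
    ∑ i, A (b i) ^ 2 = ‖A‖ ^ 2 := by
  rw [← (toDual ℝ U).symm.norm_map A, ← b.sum_sq_norm_inner_right]
  refine Finset.sum_congr rfl fun i _ => ?_
  rw [real_inner_comm, toDual_symm_apply, Real.norm_eq_abs, sq_abs]

/-- An orthogonal splitting `E = U ⊕ ℝ e` of an inner product space along a unit vector `e`. The
hyperplane is an abstract space `U`, so that hyperplanes of `ℝ ^ d` and products `U × ℝ` are
treated alike. -/
structure HyperplaneSplitting (U E : Type*) [NormedAddCommGroup U] [InnerProductSpace ℝ U]
    [NormedAddCommGroup E] [InnerProductSpace ℝ E] where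
  /-- the unit vector -/
  e : E
  /-- the inclusion of the hyperplane -/
  ι : U →ₗᵢ[ℝ] E
  /-- the orthogonal projection to the hyperplane -/
  π : E →L[ℝ] U
  norm_e : ‖e‖ = 1
  inner_ι_e : ∀ u, inner ℝ (ι u) e = 0
  decomp : ∀ z, ι (π z) + inner ℝ e z • e = z

/-- The splitting of a space into the line through a unit vector and its orthogonal complement. -/
noncomputable def HyperplaneSplitting.ofUnit {E : Type*} [NormedAddCommGroup E]
    [InnerProductSpace ℝ E] (e : E) (he : ‖e‖ = 1) :
    HyperplaneSplitting (ℝ ∙ e)ᗮ E where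
  e := e
  ι := (ℝ ∙ e)ᗮ.subtypeₗᵢ
  π := (ℝ ∙ e)ᗮ.orthogonalProjectionOnto
  norm_e := he
  inner_ι_e u := Submodule.mem_orthogonal_singleton_iff_inner_left.1 u.2
  decomp z := by
    have h := (ℝ ∙ e).starProjection_add_starProjection_orthogonal z
    rw [Submodule.starProjection_unit_singleton ℝ he] at h
    rw [add_comm]
    exact h

namespace HyperplaneSplitting

section Coordinates

variable {U E : Type*} [NormedAddCommGroup U] [InnerProductSpace ℝ U]
  [NormedAddCommGroup E] [InnerProductSpace ℝ E] (S : HyperplaneSplitting U E)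

theorem inner_e_ι (u : U) : inner ℝ S.e (S.ι u) = 0 := by
  rw [real_inner_comm]; exact S.inner_ι_e u

theorem inner_e_e : inner ℝ S.e S.e = 1 := by
  rw [real_inner_self_eq_norm_sq, S.norm_e, one_pow]

theorem inner_e_ι_add_smul_e (u : U) (s : ℝ) : inner ℝ S.e (S.ι u + s • S.e) = s := by
  rw [inner_add_right, S.inner_e_ι, inner_smul_right, S.inner_e_e]; ring

theorem π_ι_add_smul_e (u : U) (s : ℝ) : S.π (S.ι u + s • S.e) = u := by
  have h := S.decomp (S.ι u + s • S.e)
  rw [S.inner_e_ι_add_smul_e] at h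
  exact S.ι.injective (add_right_cancel h)

theorem π_e : S.π S.e = 0 := by
  simpa using S.π_ι_add_smul_e 0 1

theorem norm_sq_ι_add_smul_e (u : U) (s : ℝ) : ‖S.ι u + s • S.e‖ ^ 2 = ‖u‖ ^ 2 + s ^ 2 := by
  rw [norm_add_sq_real, inner_smul_right, S.inner_ι_e, norm_smul, S.norm_e]
  simp

theorem norm_sq_eq (z : E) : ‖z‖ ^ 2 = ‖S.π z‖ ^ 2 + inner ℝ S.e z ^ 2 := by
  rw [← S.norm_sq_ι_add_smul_e, S.decomp]

theorem norm_π_le (z : E) : ‖S.π z‖ ≤ ‖z‖ := by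
  refine le_of_sq_le_sq ?_ (norm_nonneg _)
  rw [S.norm_sq_eq z]; nlinarith [sq_nonneg (inner ℝ S.e z)]

theorem abs_inner_e_le (z : E) : |inner ℝ S.e z| ≤ ‖z‖ := by
  simpa [S.norm_e] using abs_real_inner_le_norm S.e z

theorem inner_ι_eq (u : U) (z : E) : inner ℝ (S.ι u) z = inner ℝ u (S.π z) := by
  conv_lhs => rw [← S.decomp z]
  rw [inner_add_right, inner_smul_right, S.inner_ι_e, S.ι.inner_map_map]; ring

/-- The splitting as a linear isometry. -/
noncomputable def isometryEquiv : WithLp 2 (U × ℝ) ≃ₗᵢ[ℝ] E where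
  toFun p := S.ι p.fst + p.snd • S.e
  invFun z := WithLp.toLp 2 (S.π z, inner ℝ S.e z)
  map_add' p q := by
    simp only [WithLp.add_fst, WithLp.add_snd, map_add, add_smul]; abel
  map_smul' c p := by
    simp only [WithLp.smul_fst, WithLp.smul_snd, map_smul, smul_eq_mul, mul_smul,
      RingHom.id_apply, smul_add]
  left_inv p := by
    simp only [S.π_ι_add_smul_e, S.inner_e_ι_add_smul_e]
    rfl
  right_inv z := S.decomp z
  norm_map' p := by
    refine (sq_eq_sq₀ (norm_nonneg _) (norm_nonneg _)).1 ?_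
    rw [WithLp.prod_norm_sq_eq_of_L2, Real.norm_eq_abs, sq_abs]
    exact S.norm_sq_ι_add_smul_e _ _

theorem finrank_eq [FiniteDimensional ℝ U] (S : HyperplaneSplitting U E) :
    finrank ℝ E = finrank ℝ U + 1 := by
  rw [← S.isometryEquiv.toLinearEquiv.finrank_eq,
    (WithLp.linearEquiv 2 ℝ (U × ℝ)).finrank_eq, Module.finrank_prod, finrank_self]

variable [MeasurableSpace U] [BorelSpace U] [MeasurableSpace E] [BorelSpace E]

theorem measurableEmbedding_ι_add_smul_e :
    MeasurableEmbedding (fun p : U × ℝ => S.ι p.1 + p.2 • S.e) :=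
  S.isometryEquiv.toHomeomorph.measurableEmbedding.comp
    (MeasurableEquiv.toLp 2 (U × ℝ)).measurableEmbedding

theorem measurePreserving_ι_add_smul_e [FiniteDimensional ℝ U] [FiniteDimensional ℝ E] :
    MeasurePreserving (fun p : U × ℝ => S.ι p.1 + p.2 • S.e) (volume.prod volume) volume :=
  S.isometryEquiv.measurePreserving.comp (WithLp.volume_preserving_toLp U ℝ)

end Coordinates

section Graph

variable {U E : Type*} [NormedAddCommGroup U] [InnerProductSpace ℝ U]
  [NormedAddCommGroup E] [InnerProductSpace ℝ E] (S : HyperplaneSplitting U E) {γ : U → ℝ}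
  {C : ℝ≥0}

/-- The graph of `γ`, parametrized by the hyperplane. -/
def graph (γ : U → ℝ) (u : U) : E := S.ι u + γ u • S.e

/-- The vertical height of a point over the graph of `γ`. -/
noncomputable def height (γ : U → ℝ) (z : E) : ℝ := inner ℝ S.e z - γ (S.π z)

theorem height_ι_add_smul_e (γ : U → ℝ) (u : U) (s : ℝ) :
    S.height γ (S.ι u + s • S.e) = s - γ u := by
  rw [height, S.inner_e_ι_add_smul_e, S.π_ι_add_smul_e]

theorem height_eq_zero_iff (γ : U → ℝ) (z : E) : S.height γ z = 0 ↔ z ∈ range (S.graph γ) := by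
  constructor
  · intro h
    refine ⟨S.π z, ?_⟩
    rw [graph, ← sub_eq_zero.1 h, S.decomp]
  · rintro ⟨u, rfl⟩
    rw [graph, S.height_ι_add_smul_e, sub_self]

theorem lipschitzWith_height (hγ : LipschitzWith C γ) : LipschitzWith (1 + C) (S.height γ) := by
  refine LipschitzWith.of_dist_le_mul fun x y => ?_
  have hγxy : |γ (S.π x) - γ (S.π y)| ≤ C * ‖x - y‖ := by
    refine (hγ.dist_le_mul _ _).trans ?_
    rw [dist_eq_norm, ← map_sub]
    gcongr
    exact S.norm_π_le _
  calc dist (S.height γ x) (S.height γ y)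
      = |inner ℝ S.e (x - y) - (γ (S.π x) - γ (S.π y))| := by
        rw [Real.dist_eq, height, height, inner_sub_right]; congr 1; ring
    _ ≤ |inner ℝ S.e (x - y)| + |γ (S.π x) - γ (S.π y)| := abs_sub _ _
    _ ≤ ‖x - y‖ + C * ‖x - y‖ := add_le_add (S.abs_inner_e_le _) hγxy
    _ = ↑(1 + C) * dist x y := by rw [dist_eq_norm]; push_cast; ring

theorem norm_le_norm_graph (γ : U → ℝ) (u : U) : ‖u‖ ≤ ‖S.graph γ u‖ := by
  refine le_of_sq_le_sq ?_ (norm_nonneg _)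
  rw [graph, S.norm_sq_ι_add_smul_e]
  nlinarith [sq_nonneg (γ u)]

theorem graph_sub_graph (γ : U → ℝ) (x y : U) :
    S.graph γ x - S.graph γ y = S.ι (x - y) + (γ x - γ y) • S.e := by
  simp only [graph, map_sub]; module

theorem antilipschitzWith_graph (γ : U → ℝ) : AntilipschitzWith 1 (S.graph γ) := by
  refine AntilipschitzWith.of_le_mul_dist fun x y => ?_
  rw [dist_eq_norm, dist_eq_norm, NNReal.coe_one, one_mul, S.graph_sub_graph]
  exact S.norm_le_norm_graph (fun _ => γ x - γ y) (x - y)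

theorem lipschitzWith_graph (hγ : LipschitzWith C γ) : LipschitzWith (1 + C) (S.graph γ) := by
  refine S.ι.lipschitz.add (LipschitzWith.of_dist_le_mul fun x y => ?_)
  rw [dist_eq_norm, ← sub_smul, norm_smul, S.norm_e, mul_one, ← dist_eq_norm]
  exact hγ.dist_le_mul x y

theorem measurableEmbedding_graph [FiniteDimensional ℝ U] [MeasurableSpace U] [BorelSpace U]
    [MeasurableSpace E] [BorelSpace E] (hγ : LipschitzWith C γ) :
    MeasurableEmbedding (S.graph γ) :=
  have := FiniteDimensional.complete ℝ U
  ((S.antilipschitzWith_graph γ).isClosedEmbedding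
    (S.lipschitzWith_graph hγ).uniformContinuous).measurableEmbedding

end Graph

end HyperplaneSplitting

section GraphDensity

variable {U : Type*} [NormedAddCommGroup U] [InnerProductSpace ℝ U]

/-- The area `√(1 + ‖A‖ ^ 2)` of the graph of a linear form `A` over a unit of volume. -/
noncomputable def graphDensity (A : U →L[ℝ] ℝ) : ℝ := √(1 + ‖A‖ ^ 2)

theorem one_le_graphDensity (A : U →L[ℝ] ℝ) : 1 ≤ graphDensity A := by
  rw [graphDensity, Real.one_le_sqrt]; nlinarith [sq_nonneg ‖A‖]

theorem graphDensity_pos (A : U →L[ℝ] ℝ) : 0 < graphDensity A :=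
  zero_lt_one.trans_le (one_le_graphDensity A)

theorem graphDensity_le_add (A B : U →L[ℝ] ℝ) :
    graphDensity A ≤ graphDensity B + ‖A - B‖ := by
  have hA : ‖A‖ ≤ ‖B‖ + ‖A - B‖ := by simpa using norm_add_le B (A - B)
  have hB : ‖B‖ ≤ graphDensity B := Real.le_sqrt_of_sq_le (by linarith)
  have hB_sq : graphDensity B ^ 2 = 1 + ‖B‖ ^ 2 := Real.sq_sqrt (by positivity)
  have hA_sq : ‖A‖ ^ 2 ≤ (‖B‖ + ‖A - B‖) ^ 2 := by gcongr
  refine Real.sqrt_le_iff.2 ⟨by linarith [graphDensity_pos B, norm_nonneg (A - B)], ?_⟩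
  nlinarith [norm_nonneg (A - B), mul_le_mul_of_nonneg_right hB (norm_nonneg (A - B))]

theorem continuous_graphDensity : Continuous (graphDensity : (U →L[ℝ] ℝ) → ℝ) := by
  unfold graphDensity; fun_prop

/-- The area of the graph of `γ`, as a measure on its parameter space. -/
noncomputable def graphArea [MeasurableSpace U] [BorelSpace U] [FiniteDimensional ℝ U]
    (γ : U → ℝ) : Measure U :=
  volume.withDensity fun u => ENNReal.ofReal (graphDensity (fderiv ℝ γ u))

end GraphDensity

theorem one_add_le_of_mul_one_sub_eq_one {l δ : ℝ} (hl : 0 ≤ l) (hlδ : l * (1 - δ) = 1) :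
    1 + δ ≤ l := by
  have hδ : 0 < 1 - δ := pos_of_mul_pos_right (by rw [hlδ]; exact one_pos) hl
  refine le_of_mul_le_mul_right ?_ hδ
  nlinarith [sq_nonneg δ]

theorem norm_add_comparable_of_norm_le {V : Type*} [SeminormedAddCommGroup V] {a r : V}
    {δ l : ℝ≥0} (hlδ : (l : ℝ) * (1 - δ) = 1) (hr : ‖r‖ ≤ δ * ‖a‖) :
    ‖a + r‖ ≤ l * ‖a‖ ∧ ‖a‖ ≤ l * ‖a + r‖ := by
  constructor
  · calc ‖a + r‖ ≤ (1 + δ) * ‖a‖ := by linarith [norm_add_le a r]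
      _ ≤ l * ‖a‖ := by gcongr; exact one_add_le_of_mul_one_sub_eq_one l.2 hlδ
  · have hle : (1 - δ) * ‖a‖ ≤ ‖a + r‖ := by
      linarith [(by simpa using norm_sub_le (a + r) r : ‖a‖ ≤ ‖a + r‖ + ‖r‖)]
    calc ‖a‖ = l * ((1 - δ) * ‖a‖) := by rw [← mul_assoc, hlδ, one_mul]
      _ ≤ l * ‖a + r‖ := by gcongr

namespace HyperplaneSplitting

variable {U E : Type*} [NormedAddCommGroup U] [InnerProductSpace ℝ U]
  [NormedAddCommGroup E] [InnerProductSpace ℝ E] (S : HyperplaneSplitting U E) {γ : U → ℝ}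
  {C : ℝ≥0}

/-- The graph parametrization of a linear form, as a linear map. -/
def linearGraph (A : U →L[ℝ] ℝ) : U →ₗ[ℝ] E :=
  S.ι.toLinearMap + (A : U →ₗ[ℝ] ℝ).smulRight S.e

theorem linearGraph_apply (A : U →L[ℝ] ℝ) (u : U) : S.linearGraph A u = S.ι u + A u • S.e := rfl

theorem inner_linearGraph (A : U →L[ℝ] ℝ) (u w : U) :
    inner ℝ (S.linearGraph A u) (S.linearGraph A w) = inner ℝ u w + A u * A w := by
  simp only [linearGraph_apply, inner_add_left, inner_add_right, real_inner_smul_left,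
    real_inner_smul_right, S.inner_ι_e, S.inner_e_ι, S.inner_e_e, LinearIsometry.inner_map_map]
  ring

theorem normDet_linearGraph [FiniteDimensional ℝ U] (A : U →L[ℝ] ℝ) :
    (S.linearGraph A).normDet = graphDensity A := by
  classical
  set b := stdOrthonormalBasis ℝ U
  have hgram : Matrix.gram ℝ (fun i => S.linearGraph A (b i)) =
      1 + Matrix.replicateCol Unit (fun i => A (b i)) *
        Matrix.replicateRow Unit (fun i => A (b i)) := by
    ext i j
    rw [Matrix.gram_apply, S.inner_linearGraph, b.inner_eq_ite]
    simp [Matrix.mul_apply, Matrix.one_apply]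
  have hdet := (S.linearGraph A).normDet_sq_eq_det_gram b
  rw [hgram, Matrix.det_one_add_replicateCol_mul_replicateRow] at hdet
  rw [graphDensity, ← sum_sq_apply_orthonormalBasis b A,
    ← Real.sqrt_sq (S.linearGraph A).normDet_nonneg]
  congr 1
  simpa [dotProduct, sq] using hdet

theorem dist_graph_comparable_linearGraph {A : U →L[ℝ] ℝ} {δ l : ℝ≥0}
    (hlδ : (l : ℝ) * (1 - δ) = 1) {x y : U} (hxy : ‖γ x - γ y - A (x - y)‖ ≤ δ * ‖x - y‖) :
    dist (S.graph γ x) (S.graph γ y) ≤ l * dist (S.linearGraph A x) (S.linearGraph A y) ∧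
      dist (S.linearGraph A x) (S.linearGraph A y) ≤ l * dist (S.graph γ x) (S.graph γ y) := by
  have hsub : S.graph γ x - S.graph γ y =
      S.linearGraph A (x - y) + (γ x - γ y - A (x - y)) • S.e := by
    rw [S.graph_sub_graph, linearGraph_apply]; module
  rw [dist_eq_norm, dist_eq_norm, ← map_sub, hsub]
  refine norm_add_comparable_of_norm_le hlδ ?_
  rw [norm_smul, S.norm_e, mul_one]
  exact hxy.trans (by gcongr; exact S.norm_le_norm_graph A (x - y))

variable [FiniteDimensional ℝ U] [MeasurableSpace U] [BorelSpace U] [MeasurableSpace E]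
  [BorelSpace E]

theorem euclideanHausdorffMeasure_graph_image_comparable {A : U →L[ℝ] ℝ} {P : Set U} {δ l : ℝ≥0}
    (hlδ : (l : ℝ) * (1 - δ) = 1) (hP : ApproximatesLinearOn γ A P δ) :
    μHE[finrank ℝ U] (S.graph γ '' P) ≤
        (l : ℝ≥0∞) ^ finrank ℝ U * (ENNReal.ofReal (graphDensity A) * volume P) ∧
      ENNReal.ofReal (graphDensity A) * volume P ≤
        (l : ℝ≥0∞) ^ finrank ℝ U * μHE[finrank ℝ U] (S.graph γ '' P) := by
  have hlinear : μHE[finrank ℝ U] (S.linearGraph A '' P) =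
      ENNReal.ofReal (graphDensity A) * volume P := by
    rw [(S.linearGraph A).euclideanHausdorffMeasure_image_eq_normDet_mul_volume,
      S.normDet_linearGraph]
  have hedist : ∀ {a b c d : E}, dist a b ≤ l * dist c d → edist a b ≤ l * edist c d := by
    intro a b c d h
    rw [edist_dist, edist_dist, ← ENNReal.ofReal_coe_nnreal, ← ENNReal.ofReal_mul l.coe_nonneg]
    exact ENNReal.ofReal_le_ofReal h
  rw [← hlinear]
  exact ⟨euclideanHausdorffMeasure_image_le_of_edist_le _ fun x hx y hy =>
      hedist (S.dist_graph_comparable_linearGraph hlδ (hP x hx y hy)).1,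
    euclideanHausdorffMeasure_image_le_of_edist_le _ fun x hx y hy =>
      hedist (S.dist_graph_comparable_linearGraph hlδ (hP x hx y hy)).2⟩

end HyperplaneSplitting

theorem exists_measurable_partition_dist_lt {X Y : Type*} [MeasurableSpace X]
    [PseudoMetricSpace Y] [TopologicalSpace.SeparableSpace Y] [Nonempty Y] [MeasurableSpace Y]
    [OpensMeasurableSpace Y] {g : X → Y} (hg : Measurable g) {ε : ℝ} (hε : 0 < ε) :
    ∃ R : ℕ → Set X, Pairwise (Function.onFun Disjoint R) ∧ (∀ m, MeasurableSet (R m)) ∧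
      (⋃ m, R m) = univ ∧ ∀ m, ∀ x ∈ R m, ∀ y ∈ R m, dist (g x) (g y) < ε := by
  set Q : ℕ → Set X := fun m => g ⁻¹' Metric.ball (TopologicalSpace.denseSeq Y m) (ε / 2)
  have hQ : ⋃ m, Q m = univ := by
    refine eq_univ_of_forall fun x => mem_iUnion.2 ?_
    exact (TopologicalSpace.denseRange_denseSeq Y).exists_dist_lt (g x) (half_pos hε)
  refine ⟨disjointed Q, disjoint_disjointed Q,
    fun m => MeasurableSet.disjointed (fun n => hg measurableSet_ball) m,
    by rw [iUnion_disjointed, hQ], fun m x hx y hy => ?_⟩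
  have hxm : dist (g x) _ < ε / 2 := disjointed_subset Q m hx
  have hym : dist (g y) _ < ε / 2 := disjointed_subset Q m hy
  linarith [dist_triangle_right (g x) (g y) (TopologicalSpace.denseSeq Y m)]

theorem exists_partition_approximatesLinearOn_norm_fderiv_sub_le {E F : Type*}
    [NormedAddCommGroup E] [NormedSpace ℝ E] [FiniteDimensional ℝ E] [MeasurableSpace E]
    [BorelSpace E] [NormedAddCommGroup F] [NormedSpace ℝ F] [FiniteDimensional ℝ F]
    {f : E → F} {s : Set E} (hs : MeasurableSet s) (hd : ∀ x ∈ s, DifferentiableAt ℝ f x)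
    {δ : ℝ≥0} (hδ : 0 < δ) :
    ∃ (P : ℕ × ℕ → Set E) (A : ℕ × ℕ → E →L[ℝ] F), Pairwise (Function.onFun Disjoint P) ∧
      (∀ i, MeasurableSet (P i)) ∧ (⋃ i, P i) = s ∧
      ∀ i, ApproximatesLinearOn f (A i) (P i) δ ∧ ∀ x ∈ P i, ‖fderiv ℝ f x - A i‖ ≤ δ := by
  have : CompleteSpace F := FiniteDimensional.complete ℝ F
  have : SecondCountableTopology F := secondCountable_of_proper
  obtain ⟨R, hRd, hRm, hRU, hRdist⟩ :=
    exists_measurable_partition_dist_lt (measurable_fderiv ℝ f) (NNReal.coe_pos.2 hδ)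
  choose t A htd htm hts hta htA using fun m =>
    exists_partition_approximatesLinearOn_of_hasFDerivWithinAt f (s ∩ R m) (fderiv ℝ f)
      (fun x hx => (hd x hx.1).hasFDerivAt.hasFDerivWithinAt) (fun _ => δ) (fun _ => hδ.ne')
  refine ⟨fun i => s ∩ R i.1 ∩ t i.1 i.2, fun i => A i.1 i.2, ?_,
    fun i => (hs.inter (hRm _)).inter (htm _ _), ?_, fun i => ⟨hta _ _, fun x hx => ?_⟩⟩
  · rintro ⟨m, n⟩ ⟨m', n'⟩ hne
    by_cases hm : m = m'
    · subst hm
      have hn : n ≠ n' := fun h => hne (by rw [h])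
      exact (htd m hn).mono inter_subset_right inter_subset_right
    · exact (hRd hm).mono (inter_subset_left.trans inter_subset_right)
        (inter_subset_left.trans inter_subset_right)
  · refine Subset.antisymm
      (iUnion_subset fun i => inter_subset_left.trans inter_subset_left) fun x hx => ?_
    obtain ⟨m, hm⟩ := mem_iUnion.1 (hRU ▸ mem_univ x)
    obtain ⟨n, hn⟩ := mem_iUnion.1 (hts m ⟨hx, hm⟩)
    exact mem_iUnion.2 ⟨(m, n), ⟨hx, hm⟩, hn⟩
  · obtain ⟨y, hy, hyA⟩ := htA i.1 ⟨x, hx.1⟩ i.2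
    simp only [hyA]
    exact (dist_eq_norm (fderiv ℝ f x) _).symm.trans_le (hRdist _ x hx.1.2 y hy.2).le

section GraphArea

variable {U : Type*} [NormedAddCommGroup U] [InnerProductSpace ℝ U]

theorem ofReal_graphDensity_le_mul {A B : U →L[ℝ] ℝ} {δ l : ℝ≥0}
    (hlδ : (l : ℝ) * (1 - δ) = 1) (hAB : ‖A - B‖ ≤ δ) :
    ENNReal.ofReal (graphDensity A) ≤ l * ENNReal.ofReal (graphDensity B) := by
  rw [← ENNReal.ofReal_coe_nnreal, ← ENNReal.ofReal_mul l.coe_nonneg]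
  refine ENNReal.ofReal_le_ofReal ?_
  calc graphDensity A ≤ graphDensity B + δ * graphDensity B := by
        nlinarith [graphDensity_le_add A B, one_le_graphDensity B, δ.coe_nonneg]
    _ = (1 + δ) * graphDensity B := by ring
    _ ≤ l * graphDensity B := by
        gcongr
        · exact (graphDensity_pos B).le
        · exact one_add_le_of_mul_one_sub_eq_one l.2 hlδ

variable [MeasurableSpace U] [BorelSpace U]

theorem measurable_graphDensity_fderiv (γ : U → ℝ) :
    Measurable fun u => graphDensity (fderiv ℝ γ u) :=
  continuous_graphDensity.measurable.comp (measurable_fderiv ℝ γ)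

variable [FiniteDimensional ℝ U] {γ : U → ℝ}

theorem graphArea_apply (γ : U → ℝ) {s : Set U} (hs : MeasurableSet s) :
    graphArea γ s = ∫⁻ u in s, ENNReal.ofReal (graphDensity (fderiv ℝ γ u)) :=
  withDensity_apply _ hs

theorem graphArea_comparable {A : U →L[ℝ] ℝ} {P : Set U} (hP : MeasurableSet P) {δ l : ℝ≥0}
    (hlδ : (l : ℝ) * (1 - δ) = 1) (hA : ∀ x ∈ P, ‖fderiv ℝ γ x - A‖ ≤ δ) :
    graphArea γ P ≤ l * (ENNReal.ofReal (graphDensity A) * volume P) ∧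
      ENNReal.ofReal (graphDensity A) * volume P ≤ l * graphArea γ P := by
  rw [graphArea_apply γ hP]
  constructor
  · calc _ ≤ ∫⁻ _ in P, (l : ℝ≥0∞) * ENNReal.ofReal (graphDensity A) :=
        setLIntegral_mono' hP fun _ hx => ofReal_graphDensity_le_mul hlδ (hA _ hx)
      _ = _ := by rw [setLIntegral_const, mul_assoc]
  · calc _ = ∫⁻ _ in P, ENNReal.ofReal (graphDensity A) := by rw [setLIntegral_const]
      _ ≤ ∫⁻ x in P, (l : ℝ≥0∞) * ENNReal.ofReal (graphDensity (fderiv ℝ γ x)) :=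
        setLIntegral_mono' hP fun _ hx =>
          ofReal_graphDensity_le_mul hlδ (by rw [norm_sub_rev]; exact hA _ hx)
      _ = _ := lintegral_const_mul _ (measurable_graphDensity_fderiv γ).ennreal_ofReal

end GraphArea

namespace HyperplaneSplitting

variable {U E : Type*} [NormedAddCommGroup U] [InnerProductSpace ℝ U]
  [NormedAddCommGroup E] [InnerProductSpace ℝ E] (S : HyperplaneSplitting U E) {γ : U → ℝ}
  {C : ℝ≥0} [FiniteDimensional ℝ U] [MeasurableSpace U] [BorelSpace U] [MeasurableSpace E]
  [BorelSpace E]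

theorem comap_graph_euclideanHausdorffMeasure_comparable (hγ : LipschitzWith C γ) {l : ℝ≥0}
    (hl : 1 < l) {s : Set U} (hs : MeasurableSet s) (hd : ∀ x ∈ s, DifferentiableAt ℝ γ x) :
    Measure.comap (S.graph γ) μHE[finrank ℝ U] s ≤
        (l : ℝ≥0∞) ^ (finrank ℝ U + 1) * graphArea γ s ∧
      graphArea γ s ≤
        (l : ℝ≥0∞) ^ (finrank ℝ U + 1) * Measure.comap (S.graph γ) μHE[finrank ℝ U] s := by
  have : 0 < (l : ℝ) := by exact_mod_cast zero_lt_one.trans hl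
  obtain ⟨δ, hδ, hlδ⟩ : ∃ δ : ℝ≥0, 0 < δ ∧ (l : ℝ) * (1 - δ) = 1 := by
    refine ⟨(l - 1) / l, by have := tsub_pos_of_lt hl; positivity, ?_⟩
    push_cast [NNReal.coe_sub hl.le]
    field_simp
    ring
  obtain ⟨P, A, hPd, hPm, hPU, hPA⟩ :=
    exists_partition_approximatesLinearOn_norm_fderiv_sub_le hs hd hδ
  rw [← hPU, measure_iUnion hPd hPm, measure_iUnion hPd hPm, ← ENNReal.tsum_mul_left,
    ← ENNReal.tsum_mul_left, pow_succ]
  have hHausdorff := fun i => S.euclideanHausdorffMeasure_graph_image_comparable hlδ (hPA i).1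
  have harea := fun i => graphArea_comparable (hPm i) hlδ (hPA i).2
  constructor <;> refine ENNReal.tsum_le_tsum fun i => ?_ <;>
    rw [(S.measurableEmbedding_graph hγ).comap_apply]
  · calc _ ≤ (l : ℝ≥0∞) ^ finrank ℝ U * (ENNReal.ofReal (graphDensity (A i)) * volume (P i)) :=
        (hHausdorff i).1
      _ ≤ (l : ℝ≥0∞) ^ finrank ℝ U * (l * graphArea γ (P i)) := mul_le_mul_right (harea i).2 _
      _ = _ := by rw [mul_assoc]
  · calc _ ≤ l * (ENNReal.ofReal (graphDensity (A i)) * volume (P i)) := (harea i).1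
      _ ≤ l * ((l : ℝ≥0∞) ^ finrank ℝ U * μHE[finrank ℝ U] (S.graph γ '' P i)) :=
        mul_le_mul_right (hHausdorff i).2 _
      _ = _ := by ring

theorem comap_graph_euclideanHausdorffMeasure_absolutelyContinuous (hγ : LipschitzWith C γ) :
    Measure.comap (S.graph γ) μHE[finrank ℝ U] ≪ volume := fun s hs => by
  have hle := euclideanHausdorffMeasure_image_le_of_edist_le (f := S.graph γ) (g := id)
    (s := s) (finrank ℝ U) fun x _ y _ => S.lipschitzWith_graph hγ x y
  rw [image_id, InnerProductSpace.euclideanHausdorffMeasure_eq_volume, hs, mul_zero] at hle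
  rw [(S.measurableEmbedding_graph hγ).comap_apply]
  exact le_antisymm hle zero_le

theorem comap_graph_euclideanHausdorffMeasure (hγ : LipschitzWith C γ) :
    Measure.comap (S.graph γ) μHE[finrank ℝ U] = graphArea γ := by
  ext s hs
  have hrestrict : ∀ {μ : Measure U}, μ ≪ volume →
      μ (s ∩ {x | DifferentiableAt ℝ γ x}) = μ s := fun h =>
    measure_inter_conull (h hγ.ae_differentiableAt)
  rw [← hrestrict (S.comap_graph_euclideanHausdorffMeasure_absolutelyContinuous hγ),
    ← hrestrict (μ := graphArea γ) (withDensity_absolutelyContinuous _ _)]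
  have hcomp := fun (l : ℝ≥0) (hl : 1 < l) =>
    S.comap_graph_euclideanHausdorffMeasure_comparable hγ hl
      (hs.inter (measurableSet_of_differentiableAt ℝ γ)) fun x hx => hx.2
  exact le_antisymm (le_of_forall_one_lt_le_pow_mul _ fun l hl => (hcomp l hl).1)
    (le_of_forall_one_lt_le_pow_mul _ fun l hl => (hcomp l hl).2)

theorem euclideanHausdorffMeasure_restrict_range_graph (hγ : LipschitzWith C γ) :
    (μHE[finrank ℝ U] : Measure E).restrict (range (S.graph γ)) =
      (graphArea γ).map (S.graph γ) := by
  rw [← S.comap_graph_euclideanHausdorffMeasure hγ, (S.measurableEmbedding_graph hγ).map_comap]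

end HyperplaneSplitting

theorem integrable_indicator_const_of_isCompact {X : Type*} [TopologicalSpace X] [T2Space X]
    [MeasurableSpace X] [BorelSpace X] {μ : Measure X} [IsFiniteMeasureOnCompacts μ] {s : Set X}
    (hs : IsCompact s) (c : ℝ) : Integrable (s.indicator fun _ => c) μ :=
  (integrable_indicator_iff hs.measurableSet).2 (integrableOn_const hs.measure_lt_top.ne)

namespace HyperplaneSplitting

section Clamp

variable {U E : Type*} [NormedAddCommGroup U] [InnerProductSpace ℝ U]
  [NormedAddCommGroup E] [InnerProductSpace ℝ E] (S : HyperplaneSplitting U E) {γ : U → ℝ}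
  {C : ℝ≥0} {ε : ℝ}

/-- The derivative of the height over the graph of `γ` in the direction `a`, at the points above
`u`. -/
noncomputable def slope (γ : U → ℝ) (a : E) (u : U) : ℝ := inner ℝ S.e a - fderiv ℝ γ u (S.π a)

theorem hasFDerivAt_height {z : E} (h : DifferentiableAt ℝ γ (S.π z)) :
    HasFDerivAt (S.height γ) (innerSL ℝ S.e - (fderiv ℝ γ (S.π z)).comp S.π) z :=
  (innerSL ℝ S.e).hasFDerivAt.sub (h.hasFDerivAt.comp z S.π.hasFDerivAt)

theorem abs_slope_le (hγ : LipschitzWith C γ) (a : E) (u : U) :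
    |S.slope γ a u| ≤ (1 + C) * ‖a‖ := by
  have hfderiv : |fderiv ℝ γ u (S.π a)| ≤ C * ‖a‖ := by
    refine ((fderiv ℝ γ u).le_opNorm _).trans ?_
    gcongr
    · exact norm_fderiv_le_of_lipschitz ℝ hγ
    · exact S.norm_π_le a
  rw [slope]
  linarith [abs_sub (inner ℝ S.e a) (fderiv ℝ γ u (S.π a)), S.abs_inner_e_le a]

/-- The height over the graph of `γ`, scaled by `ε` and clamped to `[0, 1]`: a Lipschitz
approximation of the indicator function of the region above the graph. -/
noncomputable def clampHeight (γ : U → ℝ) (ε : ℝ) (z : E) : ℝ := max 0 (min 1 (S.height γ z / ε))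

theorem abs_clampHeight_le (γ : U → ℝ) (ε : ℝ) (z : E) : |S.clampHeight γ ε z| ≤ 1 := by
  rw [abs_of_nonneg (le_max_left _ _)]
  exact max_le zero_le_one (min_le_left _ _)

theorem clampHeight_eq_zero (hε : 0 < ε) {z : E} (hz : S.height γ z ≤ 0) :
    S.clampHeight γ ε z = 0 :=
  max_eq_left ((min_le_right _ _).trans (div_nonpos_of_nonpos_of_nonneg hz hε.le))

theorem clampHeight_eq_div (hε : 0 < ε) {z : E} (hz : S.height γ z ∈ Icc 0 ε) :
    S.clampHeight γ ε z = S.height γ z / ε := by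
  rw [clampHeight, min_eq_right ((div_le_one hε).2 hz.2), max_eq_right (div_nonneg hz.1 hε.le)]

theorem clampHeight_eq_one (hε : 0 < ε) {z : E} (hz : ε ≤ S.height γ z) :
    S.clampHeight γ ε z = 1 := by
  rw [clampHeight, min_eq_left ((one_le_div hε).2 hz), max_eq_right zero_le_one]

theorem exists_lipschitzWith_clampHeight (hγ : LipschitzWith C γ) (ε : ℝ) :
    ∃ K, LipschitzWith K (S.clampHeight γ ε) := by
  have hdiv : LipschitzWith (‖ε⁻¹‖₊ * (1 + C)) fun z => S.height γ z / ε := by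
    simpa only [Function.comp_def, smul_eq_mul, div_eq_inv_mul]
      using (lipschitzWith_smul ε⁻¹).comp (S.lipschitzWith_height hγ)
  exact ⟨_, (hdiv.const_min 1).const_max 0⟩

theorem continuous_clampHeight (hγ : LipschitzWith C γ) (ε : ℝ) :
    Continuous (S.clampHeight γ ε) :=
  have ⟨_, hK⟩ := S.exists_lipschitzWith_clampHeight hγ ε
  hK.continuous

theorem tendsto_clampHeight (γ : U → ℝ) (z : E) :
    Tendsto (fun ε => S.clampHeight γ ε z) (𝓝[>] 0)
      (𝓝 ({z | 0 < S.height γ z}.indicator 1 z)) := by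
  refine tendsto_const_nhds.congr' ?_
  by_cases hz : 0 < S.height γ z
  · filter_upwards [Ioc_mem_nhdsGT hz] with ε hε
    rw [S.clampHeight_eq_one hε.1 hε.2, indicator_of_mem (by exact hz), Pi.one_apply]
  · filter_upwards [self_mem_nhdsWithin] with ε hε
    rw [S.clampHeight_eq_zero hε (not_lt.1 hz), indicator_of_notMem (by exact hz)]

theorem lineDeriv_clampHeight (hγ : Continuous γ) {u : U} (h : DifferentiableAt ℝ γ u)
    (hε : 0 < ε) {s : ℝ} (h₀ : s ≠ γ u) (h₁ : s ≠ γ u + ε) (a : E) :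
    lineDeriv ℝ (S.clampHeight γ ε) (S.ι u + s • S.e) a =
      (Ioc (γ u) (γ u + ε)).indicator (fun _ => S.slope γ a u / ε) s := by
  set z := S.ι u + s • S.e with hz
  have hheight : S.height γ z = s - γ u := S.height_ι_add_smul_e γ u s
  have hcont : ContinuousAt (S.height γ) z :=
    Continuous.continuousAt (by unfold height; fun_prop)
  rcases h₀.lt_or_gt with hlt | hgt
  · have heq : S.clampHeight γ ε =ᶠ[𝓝 z] fun _ => 0 := by
      filter_upwards [hcont.eventually_lt_const (show S.height γ z < 0 by linarith)] with y hy
      exact S.clampHeight_eq_zero hε hy.le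
    rw [heq.lineDeriv_eq, indicator_of_notMem fun hs => hlt.not_gt hs.1]
    simp [lineDeriv]
  rcases h₁.lt_or_gt with hlt' | hgt'
  · have heq : S.clampHeight γ ε =ᶠ[𝓝 z] fun y => S.height γ y * ε⁻¹ := by
      filter_upwards [hcont.eventually_const_lt (show 0 < S.height γ z by linarith),
        hcont.eventually_lt_const (show S.height γ z < ε by linarith)] with y hy hy'
      rw [S.clampHeight_eq_div hε ⟨hy.le, hy'.le⟩, div_eq_mul_inv]
    have hderiv := (S.hasFDerivAt_height (γ := γ) (z := z)
      (by rwa [hz, S.π_ι_add_smul_e])).mul_const ε⁻¹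
    rw [heq.lineDeriv_eq, indicator_of_mem (show s ∈ Ioc _ _ from ⟨hgt, hlt'.le⟩),
      (hderiv.hasLineDerivAt a).lineDeriv, hz, S.π_ι_add_smul_e]
    simp [slope, div_eq_inv_mul]
  · have heq : S.clampHeight γ ε =ᶠ[𝓝 z] fun _ => 1 := by
      filter_upwards [hcont.eventually_const_lt (show ε < S.height γ z by linarith)] with y hy
      exact S.clampHeight_eq_one hε hy.le
    rw [heq.lineDeriv_eq, indicator_of_notMem fun hs => hgt'.not_ge hs.2]
    simp [lineDeriv]

theorem integral_lineDeriv_clampHeight_mul (hγ : Continuous γ) (g : E → ℝ)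
    (hε : 0 < ε) (a : E) {u : U} (hu : DifferentiableAt ℝ γ u) :
    ∫ s : ℝ, lineDeriv ℝ (S.clampHeight γ ε) (S.ι u + s • S.e) a * g (S.ι u + s • S.e) =
      S.slope γ a u * (ε⁻¹ * ∫ s in (γ u)..(γ u + ε), g (S.ι u + s • S.e)) := by
  have hne : ∀ c : ℝ, ∀ᵐ s : ℝ, s ≠ c := fun c => by simp [ae_iff]
  calc _ = ∫ s : ℝ, (Ioc (γ u) (γ u + ε)).indicator
        (fun s => S.slope γ a u * ε⁻¹ * g (S.ι u + s • S.e)) s := by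
        refine integral_congr_ae ?_
        filter_upwards [hne (γ u), hne (γ u + ε)] with s hs hs'
        rw [S.lineDeriv_clampHeight hγ hu hε hs hs', ← indicator_mul_const, div_eq_mul_inv]
        rfl
    _ = _ := by
        rw [integral_indicator measurableSet_Ioc, integral_const_mul,
          intervalIntegral.integral_of_le (by linarith), mul_assoc]

theorem tendsto_verticalAverage {g : E → ℝ} (hg : Continuous g) (γ : U → ℝ) (u : U) :
    Tendsto (fun ε => ε⁻¹ * ∫ s in (γ u)..(γ u + ε), g (S.ι u + s • S.e)) (𝓝[>] 0)
      (𝓝 (g (S.graph γ u))) := by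
  have hcont : Continuous fun s : ℝ => g (S.ι u + s • S.e) := by fun_prop
  have hderiv := intervalIntegral.integral_hasDerivAt_right
    (hcont.intervalIntegrable (γ u) (γ u)) (hcont.stronglyMeasurableAtFilter _ _) hcont.continuousAt
  simpa [graph] using hderiv.tendsto_slope_zero_right

theorem norm_verticalAverage_le {g : E → ℝ} {M : ℝ} (hM : ∀ z, ‖g z‖ ≤ M) (hε : 0 < ε) (γ : U → ℝ)
    (u : U) : ‖ε⁻¹ * ∫ s in (γ u)..(γ u + ε), g (S.ι u + s • S.e)‖ ≤ M := by
  have hle := intervalIntegral.norm_integral_le_of_norm_le_const (a := γ u) (b := γ u + ε)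
    (f := fun s => g (S.ι u + s • S.e)) (C := M) fun s _ => hM _
  rw [add_sub_cancel_left, abs_of_pos hε] at hle
  rwa [norm_mul, norm_inv, Real.norm_of_nonneg hε.le, inv_mul_le_iff₀ hε, mul_comm]

end Clamp

section Divergence

variable {U E : Type*} [NormedAddCommGroup U] [InnerProductSpace ℝ U]
  [NormedAddCommGroup E] [InnerProductSpace ℝ E] [FiniteDimensional ℝ E] [MeasurableSpace E]
  [BorelSpace E] (S : HyperplaneSplitting U E) {γ : U → ℝ} {C K : ℝ≥0} {g : E → ℝ}

theorem tendsto_integral_mul_clampHeight (hγ : LipschitzWith C γ) {f : E → ℝ}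
    (hf : Integrable f) :
    Tendsto (fun ε => ∫ z, f z * S.clampHeight γ ε z) (𝓝[>] 0)
      (𝓝 (∫ z in {z | 0 < S.height γ z}, f z)) := by
  have habove : MeasurableSet {z | 0 < S.height γ z} :=
    (isOpen_lt continuous_const (S.lipschitzWith_height hγ).continuous).measurableSet
  rw [← integral_indicator habove]
  refine tendsto_integral_filter_of_dominated_convergence (fun z => ‖f z‖)
    (.of_forall fun ε => hf.1.mul (S.continuous_clampHeight hγ ε).aestronglyMeasurable)
    (.of_forall fun ε => .of_forall fun z => ?_) hf.norm (.of_forall fun z => ?_)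
  · rw [norm_mul]
    exact mul_le_of_le_one_right (norm_nonneg _) (S.abs_clampHeight_le γ ε z)
  · simpa [indicator_apply] using (S.tendsto_clampHeight γ z).const_mul (f z)

theorem integrable_lineDeriv_clampHeight_mul (hγ : LipschitzWith C γ) (hg : Continuous g)
    (hs : HasCompactSupport g) (ε : ℝ) (a : E) :
    Integrable fun z => lineDeriv ℝ (S.clampHeight γ ε) z a * g z := by
  obtain ⟨L, hL⟩ := S.exists_lipschitzWith_clampHeight hγ ε
  exact (hL.locallyIntegrable_lineDeriv a).integrable_smul_right_of_hasCompactSupport hg hs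

variable [FiniteDimensional ℝ U] [MeasurableSpace U] [BorelSpace U]

theorem tendsto_integral_lineDeriv_clampHeight_mul (hγ : LipschitzWith C γ) (hg : Continuous g)
    (hs : HasCompactSupport g) (a : E) :
    Tendsto (fun ε => ∫ z, lineDeriv ℝ (S.clampHeight γ ε) z a * g z) (𝓝[>] 0)
      (𝓝 (∫ u, S.slope γ a u * g (S.graph γ u))) := by
  have hfi : ∀ ε, Integrable (fun p : U × ℝ =>
      lineDeriv ℝ (S.clampHeight γ ε) (S.ι p.1 + p.2 • S.e) a * g (S.ι p.1 + p.2 • S.e))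
      (volume.prod volume) := fun ε =>
    (S.measurePreserving_ι_add_smul_e.integrable_comp_emb
      S.measurableEmbedding_ι_add_smul_e).2 (S.integrable_lineDeriv_clampHeight_mul hγ hg hs ε a)
  have hFubini : ∀ ε, ∫ z, lineDeriv ℝ (S.clampHeight γ ε) z a * g z =
      ∫ u, ∫ s, lineDeriv ℝ (S.clampHeight γ ε) (S.ι u + s • S.e) a * g (S.ι u + s • S.e) :=
    fun ε => by rw [← integral_prod _ (hfi ε),
      ← S.measurePreserving_ι_add_smul_e.integral_comp S.measurableEmbedding_ι_add_smul_e]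
  simp only [hFubini]
  obtain ⟨M, hM⟩ := hs.exists_bound_of_continuous hg
  have hT : IsCompact (S.π '' tsupport g) := hs.isCompact.image S.π.continuous
  have hdiff : ∀ᵐ u : U, DifferentiableAt ℝ γ u := hγ.ae_differentiableAt
  refine tendsto_integral_filter_of_dominated_convergence
    ((S.π '' tsupport g).indicator fun _ => (1 + C) * ‖a‖ * M)
    (.of_forall fun ε => (hfi ε).integral_prod_left.aestronglyMeasurable)
    ?_ (integrable_indicator_const_of_isCompact hT _) ?_
  · filter_upwards [self_mem_nhdsWithin] with ε hε
    filter_upwards [hdiff] with u hu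
    rw [S.integral_lineDeriv_clampHeight_mul hγ.continuous g hε a hu]
    by_cases huT : u ∈ S.π '' tsupport g
    · rw [indicator_of_mem huT, norm_mul]
      have : 0 ≤ M := (norm_nonneg _).trans (hM 0)
      gcongr
      · exact S.abs_slope_le hγ a u
      · exact S.norm_verticalAverage_le hM hε γ u
    · have hzero : ∀ s : ℝ, g (S.ι u + s • S.e) = 0 := fun s =>
        image_eq_zero_of_notMem_tsupport fun h => huT ⟨_, h, S.π_ι_add_smul_e u s⟩
      simp [hzero, indicator_of_notMem huT]
  · filter_upwards [hdiff] with u hu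
    refine ((S.tendsto_verticalAverage hg γ u).const_mul _).congr' ?_
    filter_upwards [self_mem_nhdsWithin] with ε hε
    rw [S.integral_lineDeriv_clampHeight_mul hγ.continuous g hε a hu]

theorem integral_lineDeriv_above_graph (hγ : LipschitzWith C γ) (hg : LipschitzWith K g)
    (hs : HasCompactSupport g) (a : E) :
    ∫ z in {z | 0 < S.height γ z}, lineDeriv ℝ g z a =
      -∫ u, S.slope γ a u * g (S.graph γ u) := by
  have hparts : ∀ ε, ∫ z, lineDeriv ℝ g z a * S.clampHeight γ ε z =
      -∫ z, lineDeriv ℝ (S.clampHeight γ ε) z a * g z := by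
    intro ε
    obtain ⟨L, hL⟩ := S.exists_lipschitzWith_clampHeight hγ ε
    rw [hL.integral_lineDeriv_mul_eq hg hs a, ← integral_neg]
    simp only [lineDeriv_neg, neg_mul, neg_neg]
  have hleft := S.tendsto_integral_mul_clampHeight hγ
    (integrable_lineDeriv_of_lipschitzWith hg hs a)
  simp only [hparts] at hleft
  exact tendsto_nhds_unique hleft
    (S.tendsto_integral_lineDeriv_clampHeight_mul hγ hg.continuous hs a).neg

end Divergence

section Normal

variable {U E : Type*} [NormedAddCommGroup U] [InnerProductSpace ℝ U] [CompleteSpace U]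
  [NormedAddCommGroup E] [InnerProductSpace ℝ E] (S : HyperplaneSplitting U E)

/-- The upward unit normal of the graph of `γ` above `u`. -/
noncomputable def normal (γ : U → ℝ) (u : U) : E :=
  (graphDensity (fderiv ℝ γ u))⁻¹ • (S.e - S.ι ((toDual ℝ U).symm (fderiv ℝ γ u)))

theorem graphDensity_mul_inner_normal (γ : U → ℝ) (u : U) (a : E) :
    graphDensity (fderiv ℝ γ u) * inner ℝ (S.normal γ u) a = S.slope γ a u := by
  rw [normal, real_inner_smul_left, inner_sub_left, S.inner_ι_eq, toDual_symm_apply, slope,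
    mul_inv_cancel_left₀ (graphDensity_pos _).ne']

theorem norm_normal (γ : U → ℝ) (u : U) : ‖S.normal γ u‖ = 1 := by
  have hpos := graphDensity_pos (fderiv ℝ γ u)
  have hnorm : ‖S.e - S.ι ((toDual ℝ U).symm (fderiv ℝ γ u))‖ = graphDensity (fderiv ℝ γ u) := by
    rw [graphDensity, eq_comm, Real.sqrt_eq_iff_eq_sq (by positivity) (norm_nonneg _),
      norm_sub_rev, sub_eq_add_neg, ← neg_one_smul ℝ S.e, S.norm_sq_ι_add_smul_e,
      LinearIsometryEquiv.norm_map]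
    ring
  rw [normal, norm_smul, hnorm, norm_inv, Real.norm_of_nonneg hpos.le, inv_mul_cancel₀ hpos.ne']

theorem measurable_normal [MeasurableSpace U] [BorelSpace U] [MeasurableSpace E] [BorelSpace E]
    (γ : U → ℝ) : Measurable (S.normal γ) := by
  have hcont : Continuous fun A : U →L[ℝ] ℝ =>
      (graphDensity A)⁻¹ • (S.e - S.ι ((toDual ℝ U).symm A)) :=
    (continuous_graphDensity.inv₀ fun A => (graphDensity_pos A).ne').smul
      (continuous_const.sub (S.ι.continuous.comp (toDual ℝ U).symm.continuous))
  exact hcont.measurable.comp (measurable_fderiv ℝ γ)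

end Normal

end HyperplaneSplitting

/-- In the open set `O`, the set `Ω` is the strict subgraph of `γ`. -/
structure IsGraphChart {U E : Type*} [NormedAddCommGroup U] [InnerProductSpace ℝ U]
    [NormedAddCommGroup E] [InnerProductSpace ℝ E] (S : HyperplaneSplitting U E) (γ : U → ℝ)
    (Ω O : Set E) : Prop where
  isOpen : IsOpen O
  mem_iff : ∀ z ∈ O, (z ∈ Ω ↔ S.height γ z < 0)

theorem HyperplaneSplitting.height_add_smul_e {U E : Type*} [NormedAddCommGroup U]
    [InnerProductSpace ℝ U] [NormedAddCommGroup E] [InnerProductSpace ℝ E]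
    (S : HyperplaneSplitting U E) (γ : U → ℝ) (z : E) (s : ℝ) :
    S.height γ (z + s • S.e) = S.height γ z + s := by
  simp only [height, inner_add_right, inner_smul_right, map_add, map_smul, S.inner_e_e, S.π_e,
    smul_zero, add_zero, mul_one]
  ring

theorem tendsto_add_smul_nhdsGT_zero {E : Type*} [AddCommGroup E] [TopologicalSpace E]
    [ContinuousAdd E] [Module ℝ E] [ContinuousSMul ℝ E] (z a : E) :
    Tendsto (fun s : ℝ => z + s • a) (𝓝[>] 0) (𝓝 z) :=
  tendsto_nhdsWithin_of_tendsto_nhds (Continuous.tendsto' (by fun_prop) _ _ (by simp))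

namespace IsGraphChart

section Topology

variable {U E : Type*} [NormedAddCommGroup U] [InnerProductSpace ℝ U]
  [NormedAddCommGroup E] [InnerProductSpace ℝ E] {S : HyperplaneSplitting U E} {γ : U → ℝ}
  {Ω O : Set E}

theorem mono (h : IsGraphChart S γ Ω O) {O' : Set E} (hO' : IsOpen O') (hsub : O' ⊆ O) :
    IsGraphChart S γ Ω O' :=
  ⟨hO', fun z hz => h.mem_iff z (hsub hz)⟩

theorem notMem_iff (h : IsGraphChart S γ Ω O) {z : E} (hz : z ∈ O) :
    z ∉ Ω ↔ 0 ≤ S.height γ z := by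
  rw [h.mem_iff z hz, not_lt]

theorem mem_closure_iff (h : IsGraphChart S γ Ω O) (hγ : Continuous γ) {z : E} (hz : z ∈ O) :
    z ∈ closure Ω ↔ S.height γ z ≤ 0 := by
  have hcont : Continuous (S.height γ) := by unfold HyperplaneSplitting.height; fun_prop
  refine ⟨fun hcl => not_lt.1 fun hpos => ?_, fun hle => ?_⟩
  · have habove : ∀ᶠ y in 𝓝 z, y ∈ O ∧ 0 < S.height γ y :=
      (h.isOpen.eventually_mem hz).and (hcont.continuousAt.eventually_const_lt hpos)
    obtain ⟨y, hyΩ, hyO, hy⟩ := ((mem_closure_iff_frequently.1 hcl).and_eventually habove).exists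
    exact hy.not_gt ((h.mem_iff y hyO).1 hyΩ)
  · have hdown := tendsto_add_smul_nhdsGT_zero z (-S.e)
    refine mem_closure_of_tendsto hdown ?_
    filter_upwards [hdown.eventually (h.isOpen.mem_nhds hz), self_mem_nhdsWithin] with s hs hs0
    rw [smul_neg, ← neg_smul] at hs ⊢
    rw [h.mem_iff _ hs, S.height_add_smul_e]
    linarith [mem_Ioi.1 hs0]

theorem mem_frontier_iff (h : IsGraphChart S γ Ω O) (hγ : Continuous γ) (hΩ : IsOpen Ω) {z : E}
    (hz : z ∈ O) : z ∈ frontier Ω ↔ z ∈ range (S.graph γ) := by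
  rw [hΩ.frontier_eq, Set.mem_sdiff, h.mem_closure_iff hγ hz, h.notMem_iff hz,
    ← S.height_eq_zero_iff]
  exact le_antisymm_iff.symm

theorem inter_frontier (h : IsGraphChart S γ Ω O) (hγ : Continuous γ) (hΩ : IsOpen Ω) :
    O ∩ frontier Ω = O ∩ range (S.graph γ) :=
  Set.ext fun _ => and_congr_right fun hz => h.mem_frontier_iff hγ hΩ hz

end Topology

section Surface

variable {d : ℕ} {U : Type*} [NormedAddCommGroup U] [InnerProductSpace ℝ U]
  {S : HyperplaneSplitting U (EuclideanSpace ℝ (Fin d))} {γ : U → ℝ} {C : ℝ≥0}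
  {Ω O : Set (EuclideanSpace ℝ (Fin d))}

theorem isOutwardUnitNormalAt [CompleteSpace U] (h : IsGraphChart S γ Ω O) {u : U}
    (hu : DifferentiableAt ℝ γ u) (hO : S.graph γ u ∈ O) :
    IsOutwardUnitNormalAt Ω (S.graph γ u) (S.normal γ u) := by
  refine ⟨S.norm_normal γ u, fun ε hε => ?_⟩
  set y := S.graph γ u
  set J := graphDensity (fderiv ℝ γ u)
  have hJ : 1 ≤ J := one_le_graphDensity _
  have hπ : S.π y = u := S.π_ι_add_smul_e u _
  have hy : S.height γ y = 0 := (S.height_eq_zero_iff γ y).2 ⟨u, rfl⟩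
  have hderiv := S.hasFDerivAt_height (γ := γ) (z := y) (by rwa [hπ])
  rw [hπ] at hderiv
  filter_upwards [hderiv.isLittleO.def hε, h.isOpen.mem_nhds hO] with z hz hzO
  have hslope : (innerSL ℝ S.e - (fderiv ℝ γ u).comp S.π) (z - y) =
      J * inner ℝ (z - y) (S.normal γ u) := by
    rw [real_inner_comm, S.graphDensity_mul_inner_normal]
    rfl
  rw [hy, sub_zero, hslope, Real.norm_eq_abs, abs_le] at hz
  rw [h.notMem_iff hzO, h.mem_iff z hzO]
  have hscale : ε * ‖z - y‖ ≤ J * (ε * ‖z - y‖) := le_mul_of_one_le_left (by positivity) hJ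
  constructor <;> intro hlt <;>
    linarith [mul_lt_mul_of_pos_left hlt (zero_lt_one.trans_le hJ)]

theorem outwardNormal_eq [CompleteSpace U] (h : IsGraphChart S γ Ω O) {u : U}
    (hu : DifferentiableAt ℝ γ u) (hO : S.graph γ u ∈ O) :
    outwardNormal Ω (S.graph γ u) = S.normal γ u := by
  have hex : ∃ ν, IsOutwardUnitNormalAt Ω (S.graph γ u) ν := ⟨_, h.isOutwardUnitNormalAt hu hO⟩
  rw [outwardNormal, dif_pos hex]
  exact hex.choose_spec.unique (h.isOutwardUnitNormalAt hu hO)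

variable [FiniteDimensional ℝ U] [MeasurableSpace U] [BorelSpace U]

theorem surfaceMeasure_restrict (h : IsGraphChart S γ Ω O) (hγ : LipschitzWith C γ)
    (hΩ : IsOpen Ω) :
    (surfaceMeasure Ω).restrict O = ((graphArea γ).map (S.graph γ)).restrict O := by
  have hdim : d - 1 = finrank ℝ U := by
    rw [← finrank_euclideanSpace_fin (𝕜 := ℝ) (n := d), S.finrank_eq, Nat.add_sub_cancel]
  rw [surfaceMeasure, Measure.restrict_restrict h.isOpen.measurableSet,
    h.inter_frontier hγ.continuous hΩ, ← Measure.restrict_restrict h.isOpen.measurableSet, hdim,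
    S.euclideanHausdorffMeasure_restrict_range_graph hγ]

theorem ae_outwardNormal_eq (h : IsGraphChart S γ Ω O) (hγ : LipschitzWith C γ)
    (hΩ : IsOpen Ω) :
    ∀ᵐ y ∂(surfaceMeasure Ω).restrict O, outwardNormal Ω y = S.normal γ (S.π y) := by
  rw [h.surfaceMeasure_restrict hγ hΩ, ae_restrict_iff' h.isOpen.measurableSet,
    (S.measurableEmbedding_graph hγ).ae_map_iff]
  have hac : graphArea γ ≪ volume := withDensity_absolutelyContinuous _ _
  filter_upwards [hac.ae_le hγ.ae_differentiableAt] with u hu hO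
  rw [h.outwardNormal_eq hu hO, HyperplaneSplitting.graph, S.π_ι_add_smul_e]

theorem aestronglyMeasurable_outwardNormal (h : IsGraphChart S γ Ω O)
    (hγ : LipschitzWith C γ) (hΩ : IsOpen Ω) :
    AEStronglyMeasurable (outwardNormal Ω) ((surfaceMeasure Ω).restrict O) :=
  ((S.measurable_normal γ).comp S.π.continuous.measurable).aestronglyMeasurable.congr
    ((h.ae_outwardNormal_eq hγ hΩ).mono fun _ hy => hy.symm)

theorem surfaceMeasure_lt_top (h : IsGraphChart S γ Ω O) (hγ : LipschitzWith C γ)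
    (hΩ : IsOpen Ω) (hO : Bornology.IsBounded O) : surfaceMeasure Ω O < ∞ := by
  have hemb := S.measurableEmbedding_graph hγ
  rw [← Measure.restrict_apply_self, h.surfaceMeasure_restrict hγ hΩ, Measure.restrict_apply_self,
    hemb.map_apply, graphArea_apply γ (hemb.measurable h.isOpen.measurableSet)]
  have hbdd : Bornology.IsBounded (S.graph γ ⁻¹' O) :=
    (S.π.lipschitz.isBounded_image hO).subset fun u hu => ⟨_, hu, S.π_ι_add_smul_e u _⟩
  refine setLIntegral_lt_top_of_le_nnreal hbdd.measure_lt_top.ne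
    ⟨Real.toNNReal √(1 + (C : ℝ) ^ 2), fun u _ => ENNReal.ofReal_le_ofReal (Real.sqrt_le_sqrt ?_)⟩
  gcongr
  exact norm_fderiv_le_of_lipschitz ℝ hγ

theorem integral_mul_inner_outwardNormal (h : IsGraphChart S γ Ω O) (hγ : LipschitzWith C γ)
    (hΩ : IsOpen Ω) {g : EuclideanSpace ℝ (Fin d) → ℝ} (hg : ∀ z ∉ O, g z = 0)
    (a : EuclideanSpace ℝ (Fin d)) :
    ∫ y, g y * inner ℝ (outwardNormal Ω y) a ∂surfaceMeasure Ω =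
      ∫ u, S.slope γ a u * g (S.graph γ u) := by
  have hzero : ∀ z ∉ O, g z * inner ℝ (outwardNormal Ω z) a = 0 := fun z hz => by
    rw [hg z hz, zero_mul]
  rw [← setIntegral_eq_integral_of_forall_compl_eq_zero hzero, h.surfaceMeasure_restrict hγ hΩ,
    setIntegral_eq_integral_of_forall_compl_eq_zero hzero,
    (S.measurableEmbedding_graph hγ).integral_map, graphArea,
    integral_withDensity_eq_integral_toReal_smul
      (measurable_graphDensity_fderiv γ).ennreal_ofReal (.of_forall fun _ => ENNReal.ofReal_lt_top)]
  refine integral_congr_ae ?_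
  filter_upwards [hγ.ae_differentiableAt] with u hu
  by_cases hO : S.graph γ u ∈ O
  · rw [h.outwardNormal_eq hu hO, ENNReal.toReal_ofReal (graphDensity_pos _).le, smul_eq_mul,
      ← S.graphDensity_mul_inner_normal]
    ring
  · simp [hg _ hO]

theorem integral_lineDeriv (h : IsGraphChart S γ Ω O) (hγ : LipschitzWith C γ)
    (hΩ : IsOpen Ω) {g : EuclideanSpace ℝ (Fin d) → ℝ} {K : ℝ≥0} (hg : LipschitzWith K g)
    (hs : HasCompactSupport g) (hsO : tsupport g ⊆ O) (a : EuclideanSpace ℝ (Fin d)) :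
    ∫ z in (closure Ω)ᶜ, lineDeriv ℝ g z a =
      -∫ y, g y * inner ℝ (outwardNormal Ω y) a ∂surfaceMeasure Ω := by
  have habove : MeasurableSet {z | 0 < S.height γ z} :=
    (isOpen_lt continuous_const (S.lipschitzWith_height hγ).continuous).measurableSet
  rw [h.integral_mul_inner_outwardNormal hγ hΩ fun z hz => image_eq_zero_of_notMem_tsupport
    fun hz' => hz (hsO hz'), ← S.integral_lineDeriv_above_graph hγ hg hs,
    ← integral_indicator isClosed_closure.measurableSet.compl, ← integral_indicator habove]
  congr 1
  ext z
  by_cases hz : z ∈ tsupport g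
  · simp only [indicator, mem_compl_iff, mem_ofPred_eq, h.mem_closure_iff hγ.continuous (hsO hz),
      not_le]
  · simp [indicator, lineDeriv_eq_zero_of_notMem_tsupport hz]

end Surface

end IsGraphChart

section Surface

variable {d : ℕ} {Ω : Set (EuclideanSpace ℝ (Fin d))}

theorem HasLipschitzBoundary.exists_isGraphChart (h : HasLipschitzBoundary Ω)
    {y : EuclideanSpace ℝ (Fin d)} (hy : y ∈ frontier Ω) :
    ∃ (e : EuclideanSpace ℝ (Fin d)) (he : ‖e‖ = 1) (γ : (ℝ ∙ e)ᗮ → ℝ) (C : ℝ≥0) (r : ℝ), 0 < r ∧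
      LipschitzWith C γ ∧
        IsGraphChart (HyperplaneSplitting.ofUnit e he) γ Ω (Metric.ball y r) := by
  obtain ⟨e, γ, C, he, hγ, hev⟩ := h y hy
  obtain ⟨r, hr, hball⟩ := Metric.eventually_nhds_iff_ball.1 hev
  refine ⟨e, he, γ, C, r, hr, hγ, Metric.isOpen_ball, fun z hz => ?_⟩
  rw [hball z hz]
  exact sub_neg.symm

theorem norm_outwardNormal_le (Ω : Set (EuclideanSpace ℝ (Fin d)))
    (y : EuclideanSpace ℝ (Fin d)) : ‖outwardNormal Ω y‖ ≤ 1 := by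
  unfold outwardNormal
  split_ifs with h
  · exact h.choose_spec.1.le
  · simp

theorem isCompact_frontier_of_isBounded {X : Type*} [PseudoMetricSpace X] [ProperSpace X]
    {s : Set X} (hs : Bornology.IsBounded s) : IsCompact (frontier s) :=
  Metric.isCompact_of_isClosed_isBounded isClosed_frontier
    (hs.closure.subset frontier_subset_closure)

theorem ae_surfaceMeasure_mem_frontier (Ω : Set (EuclideanSpace ℝ (Fin d))) :
    ∀ᵐ y ∂surfaceMeasure Ω, y ∈ frontier Ω :=
  ae_restrict_mem isClosed_frontier.measurableSet

theorem isFiniteMeasure_surfaceMeasure (hΩ : IsOpen Ω) (hb : Bornology.IsBounded Ω)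
    (hl : HasLipschitzBoundary Ω) : IsFiniteMeasure (surfaceMeasure Ω) := by
  have hlt : surfaceMeasure Ω (frontier Ω) < ∞ := by
    refine (isCompact_frontier_of_isBounded hb).measure_lt_top_of_nhdsWithin fun y hy => ?_
    obtain ⟨e, he, γ, C, r, hr, hγ, hc⟩ := hl.exists_isGraphChart hy
    exact ⟨_, mem_nhdsWithin_of_mem_nhds (Metric.ball_mem_nhds y hr),
      hc.surfaceMeasure_lt_top hγ hΩ Metric.isBounded_ball⟩
  rw [surfaceMeasure, Measure.restrict_apply_self, ← Measure.restrict_apply_univ] at hlt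
  exact ⟨hlt⟩

theorem aestronglyMeasurable_outwardNormal (hΩ : IsOpen Ω) (hb : Bornology.IsBounded Ω)
    (hl : HasLipschitzBoundary Ω) :
    AEStronglyMeasurable (outwardNormal Ω) (surfaceMeasure Ω) := by
  have hfrontier :
      AEStronglyMeasurable (outwardNormal Ω) ((surfaceMeasure Ω).restrict (frontier Ω)) := by
    refine (isCompact_frontier_of_isBounded hb).induction_on
      (p := fun s => AEStronglyMeasurable (outwardNormal Ω) ((surfaceMeasure Ω).restrict s))
      (by simp) (fun s t hst ht => ht.mono_set hst)
      (fun s t hs ht => aestronglyMeasurable_union_iff.2 ⟨hs, ht⟩) fun y hy => ?_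
    obtain ⟨e, he, γ, C, r, hr, hγ, hc⟩ := hl.exists_isGraphChart hy
    exact ⟨_, mem_nhdsWithin_of_mem_nhds (Metric.ball_mem_nhds y hr),
      hc.aestronglyMeasurable_outwardNormal hγ hΩ⟩
  rwa [Measure.restrict_eq_self_of_ae_mem (ae_surfaceMeasure_mem_frontier Ω)] at hfrontier

theorem integrable_mul_inner_outwardNormal (hΩ : IsOpen Ω)
    (hb : Bornology.IsBounded Ω) (hl : HasLipschitzBoundary Ω)
    {f : EuclideanSpace ℝ (Fin d) → ℝ} (hf : ContinuousOn f (frontier Ω))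
    (a : EuclideanSpace ℝ (Fin d)) :
    Integrable (fun y => f y * inner ℝ (outwardNormal Ω y) a) (surfaceMeasure Ω) := by
  have := isFiniteMeasure_surfaceMeasure hΩ hb hl
  obtain ⟨M, hM⟩ := (isCompact_frontier_of_isBounded hb).exists_bound_of_continuousOn hf
  refine Integrable.of_bound (C := M * ‖a‖)
    ((hf.aestronglyMeasurable isClosed_frontier.measurableSet).mul
      ((aestronglyMeasurable_outwardNormal hΩ hb hl).inner aestronglyMeasurable_const)) ?_
  filter_upwards [ae_surfaceMeasure_mem_frontier Ω] with y hy
  have hinner : ‖inner ℝ (outwardNormal Ω y) a‖ ≤ ‖a‖ :=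
    (norm_inner_le_norm _ _).trans (mul_le_of_le_one_left (norm_nonneg _)
      (norm_outwardNormal_le Ω y))
  rw [norm_mul]
  exact mul_le_mul (hM y hy) hinner (norm_nonneg _) ((norm_nonneg _).trans (hM y hy))

end Surface

theorem integrableOn_of_continuousOn_of_eq_zero_off_compact {X : Type*} [TopologicalSpace X]
    [T2Space X] [MeasurableSpace X] [BorelSpace X] {μ : Measure X} [IsFiniteMeasureOnCompacts μ]
    {A K : Set X} {F : X → ℝ} (hA : IsClosed A) (hK : IsCompact K)
    (hF : ContinuousOn F A) (hzero : ∀ z ∈ A, z ∉ K → F z = 0) :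
    IntegrableOn F A μ :=
  ((hF.mono inter_subset_left).integrableOn_compact (hK.inter_left hA)).of_forall_sdiff_eq_zero
    hA.measurableSet fun z hz => hzero z hz.1 fun hzK => hz.2 ⟨hz.1, hzK⟩

theorem exists_lipschitzWith_mul_of_hasCompactSupport {X : Type*} [PseudoMetricSpace X]
    {f g : X → ℝ} {K L : ℝ≥0} (hf : LipschitzWith K f) (hg : LipschitzWith L g)
    (hs : HasCompactSupport f) : ∃ M, LipschitzWith M fun x => f x * g x := by
  obtain ⟨A, hA⟩ := hs.exists_bound_of_continuous hf.continuous
  obtain ⟨B, hB⟩ := hs.isCompact.exists_bound_of_continuousOn hg.continuous.continuousOn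
  have hmem : ∀ x y, x ∈ tsupport f →
      |f x * g x - f y * g y| ≤ (K * |B| + |A| * L) * dist x y := fun x y hx => by
    have hfxy : |f x - f y| ≤ K * dist x y := hf.dist_le_mul x y
    have hgxy : |g x - g y| ≤ L * dist x y := hg.dist_le_mul x y
    have hgx : |g x| ≤ |B| := (hB x hx).trans (le_abs_self B)
    have hfy : |f y| ≤ |A| := (hA y).trans (le_abs_self A)
    calc |f x * g x - f y * g y| = |(f x - f y) * g x + f y * (g x - g y)| := by congr 1; ring
      _ ≤ |f x - f y| * |g x| + |f y| * |g x - g y| := by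
        rw [← abs_mul, ← abs_mul]
        exact abs_add_le _ _
      _ ≤ K * dist x y * |B| + |A| * (L * dist x y) := by gcongr
      _ = (K * |B| + |A| * L) * dist x y := by ring
  refine ⟨Real.toNNReal (K * |B| + |A| * L), LipschitzWith.of_dist_le_mul fun x y => ?_⟩
  rw [Real.coe_toNNReal _ (by positivity), Real.dist_eq]
  by_cases hx : x ∈ tsupport f
  · exact hmem x y hx
  by_cases hy : y ∈ tsupport f
  · rw [abs_sub_comm, dist_comm]
    exact hmem y x hy
  · rw [image_eq_zero_of_notMem_tsupport hx, image_eq_zero_of_notMem_tsupport hy, zero_mul,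
      zero_mul, sub_zero, abs_zero]
    positivity

theorem compl_closure_subset_compl {X : Type*} [TopologicalSpace X] (Ω : Set X) :
    (closure Ω)ᶜ ⊆ Ωᶜ :=
  compl_subset_compl.2 subset_closure

theorem frontier_subset_compl {X : Type*} [TopologicalSpace X] {Ω : Set X} (hΩ : IsOpen Ω) :
    frontier Ω ⊆ Ωᶜ :=
  hΩ.frontier_eq.trans_subset fun _ hy => hy.2

theorem compl_mem_nhds_of_notMem_closure {X : Type*} [TopologicalSpace X] {Ω : Set X} {z : X}
    (hz : z ∉ closure Ω) : Ωᶜ ∈ 𝓝 z :=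
  mem_of_superset (isClosed_closure.isOpen_compl.mem_nhds hz) (compl_closure_subset_compl Ω)

namespace HyperplaneSplitting

variable {U E : Type*} [NormedAddCommGroup U] [InnerProductSpace ℝ U]
  [NormedAddCommGroup E] [InnerProductSpace ℝ E] (S : HyperplaneSplitting U E) {γ : U → ℝ}
  {C : ℝ≥0}

theorem height_add_inner_sub_le (hγ : LipschitzWith C γ) (y z : E) :
    S.height γ y + (inner ℝ S.e (z - y) - C * ‖S.π (z - y)‖) ≤ S.height γ z := by
  have hγzy : |γ (S.π z) - γ (S.π y)| ≤ C * ‖S.π (z - y)‖ := by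
    simpa only [Real.dist_eq, dist_eq_norm (S.π z), ← map_sub] using hγ.dist_le_mul (S.π z) (S.π y)
  rw [height, height, inner_sub_right]
  linarith [(abs_le.1 hγzy).2]

theorem combo_height_le_height_combo_add (hγ : LipschitzWith C γ) (z w : E) {a b : ℝ}
    (ha : 0 ≤ a) (hb : 0 ≤ b) (hab : a + b = 1) :
    a * S.height γ z + b * S.height γ w ≤
      S.height γ (a • z + b • w) + C * ‖S.π (z - w)‖ := by
  obtain rfl : a = 1 - b := by linarith
  have hz := S.height_add_inner_sub_le hγ z ((1 - b) • z + b • w)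
  have hw := S.height_add_inner_sub_le hγ w ((1 - b) • z + b • w)
  rw [show (1 - b) • z + b • w - z = (-b) • (z - w) by module, map_smul, norm_smul, norm_neg,
    Real.norm_of_nonneg hb, inner_smul_right] at hz
  rw [show (1 - b) • z + b • w - w = (1 - b) • (z - w) by module, map_smul, norm_smul,
    Real.norm_of_nonneg ha, inner_smul_right] at hw
  have hweight : 2 * ((1 - b) * b) * (C * ‖S.π (z - w)‖) ≤ C * ‖S.π (z - w)‖ :=
    mul_le_of_le_one_left (by positivity) (by nlinarith [sq_nonneg (2 * b - 1)])
  linarith [mul_le_mul_of_nonneg_left hz ha, mul_le_mul_of_nonneg_left hw hb]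

/-- The open cone of the directions that point strictly above every `C`-Lipschitz graph. -/
def upwardCone (C : ℝ≥0) : Set E :=
  {v | C * ‖S.π v‖ < inner ℝ S.e v}

theorem isOpen_upwardCone (C : ℝ≥0) : IsOpen (S.upwardCone C) :=
  isOpen_lt (by fun_prop) (by fun_prop)

theorem convex_upwardCone (C : ℝ≥0) : Convex ℝ (S.upwardCone C) := by
  have hnorm : ConvexOn ℝ univ fun v => C * ‖S.π v‖ :=
    ((convexOn_univ_norm (E := U)).comp_linearMap S.π.toLinearMap).smul C.coe_nonneg
  have hinner : ConcaveOn ℝ univ fun v => inner ℝ S.e v :=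
    (innerSL ℝ S.e).toLinearMap.concaveOn convex_univ
  simpa only [upwardCone, mem_univ, true_and, Pi.sub_apply, sub_neg] using
    (hnorm.sub hinner).convex_lt 0

theorem smul_e_mem_upwardCone (C : ℝ≥0) {s : ℝ} (hs : 0 < s) : s • S.e ∈ S.upwardCone C := by
  change C * ‖S.π (s • S.e)‖ < inner ℝ S.e (s • S.e)
  simpa only [map_smul, S.π_e, smul_zero, norm_zero, mul_zero, inner_smul_right, S.inner_e_e,
    mul_one] using hs

theorem uniqueDiffWithinAt_add_upwardCone (C : ℝ≥0) (y : E) :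
    UniqueDiffWithinAt ℝ {z | z - y ∈ S.upwardCone C} y := by
  have hopen : IsOpen {z | z - y ∈ S.upwardCone C} :=
    (S.isOpen_upwardCone C).preimage (continuous_id.sub continuous_const)
  have hmem : ∀ s : ℝ, 0 < s → y + s • S.e ∈ {z | z - y ∈ S.upwardCone C} := fun s hs => by
    rw [mem_ofPred_eq, add_sub_cancel_left]
    exact S.smul_e_mem_upwardCone C hs
  refine uniqueDiffWithinAt_convex ?_ ?_ ?_
  · simpa only [sub_eq_add_neg, preimage] using (S.convex_upwardCone C).translate_preimage_left (-y)
  · exact hopen.interior_eq.symm ▸ ⟨_, hmem 1 one_pos⟩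
  · exact mem_closure_of_tendsto (tendsto_add_smul_nhdsGT_zero y S.e)
      (eventually_mem_nhdsWithin.mono hmem)

end HyperplaneSplitting

namespace IsGraphChart

variable {U E : Type*} [NormedAddCommGroup U] [InnerProductSpace ℝ U]
  [NormedAddCommGroup E] [InnerProductSpace ℝ E] {S : HyperplaneSplitting U E} {γ : U → ℝ}
  {C : ℝ≥0} {Ω O : Set E}

theorem uniqueDiffWithinAt_compl (h : IsGraphChart S γ Ω O) (hγ : LipschitzWith C γ) {y : E}
    (hy : y ∈ O) (hyΩ : y ∉ Ω) : UniqueDiffWithinAt ℝ Ωᶜ y := by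
  refine ((S.uniqueDiffWithinAt_add_upwardCone C y).inter (h.isOpen.mem_nhds hy)).mono ?_
  rintro z ⟨hz, hzO⟩
  have hcone : C * ‖S.π (z - y)‖ < inner ℝ S.e (z - y) := hz
  refine (h.notMem_iff hzO).2 ?_
  linarith [S.height_add_inner_sub_le hγ y z, (h.notMem_iff hy).1 hyΩ]

variable {f : E → ℝ} {B : ℝ≥0}

theorem norm_image_sub_le_of_segment (h : IsGraphChart S γ Ω O) (hf : DifferentiableOn ℝ f Ωᶜ)
    (hB : ∀ z ∈ O, z ∉ Ω → ‖fderivWithin ℝ f Ωᶜ z‖ ≤ B) {z w : E}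
    (hO : segment ℝ z w ⊆ O) (hheight : ∀ p ∈ segment ℝ z w, 0 ≤ S.height γ p) :
    ‖f w - f z‖ ≤ B * ‖w - z‖ := by
  have hsub : segment ℝ z w ⊆ Ωᶜ := fun p hp => (h.notMem_iff (hO hp)).2 (hheight p hp)
  exact (convex_segment z w).norm_image_sub_le_of_norm_hasFDerivWithin_le
    (fun p hp => (hf p (hsub hp)).hasFDerivWithinAt.mono hsub)
    (fun p hp => hB p (hO hp) (hsub hp)) (left_mem_segment ℝ z w) (right_mem_segment ℝ z w)

theorem norm_image_add_smul_e_sub_le (h : IsGraphChart S γ Ω O) (hO : Convex ℝ O)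
    (hf : DifferentiableOn ℝ f Ωᶜ) (hB : ∀ z ∈ O, z ∉ Ω → ‖fderivWithin ℝ f Ωᶜ z‖ ≤ B) {z : E}
    (hz : z ∈ O) (hzΩ : z ∉ Ω) {s : ℝ} (hs : 0 ≤ s) (hzs : z + s • S.e ∈ O) :
    ‖f (z + s • S.e) - f z‖ ≤ B * s := by
  have hheight : ∀ p ∈ segment ℝ z (z + s • S.e), 0 ≤ S.height γ p := by
    rw [segment_eq_image']
    rintro _ ⟨θ, hθ, rfl⟩
    have hθs : 0 ≤ θ * s := mul_nonneg hθ.1 hs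
    simp only [add_sub_cancel_left, smul_smul, S.height_add_smul_e]
    linarith [(h.notMem_iff hz).1 hzΩ]
  simpa only [add_sub_cancel_left, norm_smul, S.norm_e, mul_one, Real.norm_of_nonneg hs] using
    h.norm_image_sub_le_of_segment hf hB (hO.segment_subset hz hzs) hheight

/-- Two points above a `C`-Lipschitz graph need not be joined by a segment above it, but they are
once both have been lifted by `C` times their horizontal distance. -/
theorem norm_image_sub_le (h : IsGraphChart S γ Ω O) (hγ : LipschitzWith C γ) (hO : Convex ℝ O)
    (hf : DifferentiableOn ℝ f Ωᶜ) (hB : ∀ z ∈ O, z ∉ Ω → ‖fderivWithin ℝ f Ωᶜ z‖ ≤ B) {z w : E}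
    (hz : z ∈ O) (hzΩ : z ∉ Ω) (hw : w ∈ O) (hwΩ : w ∉ Ω)
    (hzO : z + (C * ‖S.π (z - w)‖) • S.e ∈ O) (hwO : w + (C * ‖S.π (z - w)‖) • S.e ∈ O) :
    ‖f z - f w‖ ≤ B * (1 + 2 * C) * ‖z - w‖ := by
  set s : ℝ := C * ‖S.π (z - w)‖
  have hs : 0 ≤ s := by positivity
  have hvert_z := h.norm_image_add_smul_e_sub_le hO hf hB hz hzΩ hs hzO
  have hvert_w := h.norm_image_add_smul_e_sub_le hO hf hB hw hwΩ hs hwO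
  have hhor : ‖f (w + s • S.e) - f (z + s • S.e)‖ ≤ B * ‖z - w‖ := by
    have hheight : ∀ p ∈ segment ℝ (z + s • S.e) (w + s • S.e), 0 ≤ S.height γ p := by
      rintro _ ⟨a, b, ha, hb, hab, rfl⟩
      obtain rfl : a = 1 - b := by linarith
      rw [show (1 - b) • (z + s • S.e) + b • (w + s • S.e) = (1 - b) • z + b • w + s • S.e by
        module, S.height_add_smul_e]
      linarith [S.combo_height_le_height_combo_add hγ z w ha hb hab,
        mul_nonneg ha ((h.notMem_iff hz).1 hzΩ),
        mul_nonneg hb ((h.notMem_iff hw).1 hwΩ)]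
    simpa only [add_sub_add_right_eq_sub, norm_sub_rev w z] using
      h.norm_image_sub_le_of_segment hf hB (hO.segment_subset hzO hwO) hheight
  have hsle : s ≤ C * ‖z - w‖ := mul_le_mul_of_nonneg_left (S.norm_π_le _) C.coe_nonneg
  calc ‖f z - f w‖ = ‖(f (w + s • S.e) - f w) - (f (w + s • S.e) - f (z + s • S.e))
        - (f (z + s • S.e) - f z)‖ := by congr 1; ring
    _ ≤ B * s + B * ‖z - w‖ + B * s :=
      (norm_sub_le _ _).trans (add_le_add ((norm_sub_le _ _).trans (add_le_add hvert_w hhor))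
        hvert_z)
    _ ≤ B * (C * ‖z - w‖) + B * ‖z - w‖ + B * (C * ‖z - w‖) := by gcongr
    _ = B * (1 + 2 * C) * ‖z - w‖ := by ring

theorem lipschitzOnWith_compl_inter_ball {y : E} {r : ℝ}
    (h : IsGraphChart S γ Ω (Metric.ball y r)) (hγ : LipschitzWith C γ)
    (hf : DifferentiableOn ℝ f Ωᶜ)
    (hB : ∀ z ∈ Metric.ball y r, z ∉ Ω → ‖fderivWithin ℝ f Ωᶜ z‖ ≤ B) :
    LipschitzOnWith (B * (1 + 2 * C)) f (Ωᶜ ∩ Metric.ball y (r / (1 + 2 * C))) := by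
  refine LipschitzOnWith.of_dist_le_mul ?_
  rintro z ⟨hzΩ, hz⟩ w ⟨hwΩ, hw⟩
  rw [Metric.mem_ball, lt_div_iff₀ (by positivity)] at hz hw
  have hnorm : ∀ x, dist x y ≤ dist x y * (1 + 2 * C) := fun x =>
    le_mul_of_one_le_right dist_nonneg (by linarith [C.coe_nonneg])
  have hdist : C * ‖S.π (z - w)‖ ≤ C * (dist z y + dist w y) := by
    gcongr
    exact (S.norm_π_le _).trans ((dist_eq_norm z w).symm.trans_le (dist_triangle_right z w y))
  have hlift : ∀ x, dist x y + C * (dist z y + dist w y) < r →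
      x + (C * ‖S.π (z - w)‖) • S.e ∈ Metric.ball y r := fun x hx => by
    have hself : dist (x + (C * ‖S.π (z - w)‖) • S.e) x = C * ‖S.π (z - w)‖ := by
      rw [dist_self_add_left, norm_smul, S.norm_e, mul_one, Real.norm_of_nonneg (by positivity)]
    rw [Metric.mem_ball]
    linarith [dist_triangle (x + (C * ‖S.π (z - w)‖) • S.e) x y]
  have hC := C.coe_nonneg
  rw [dist_eq_norm, dist_eq_norm]
  push_cast
  rcases le_total (dist z y) (dist w y) with hzw | hzw <;>
    have hCzw := mul_le_mul_of_nonneg_left hzw hC <;>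
    exact h.norm_image_sub_le hγ (convex_ball y r) hf hB ((hnorm z).trans_lt hz) hzΩ
      ((hnorm w).trans_lt hw) hwΩ (hlift z (by linarith)) (hlift w (by linarith))

theorem exists_lipschitzWith_eqOn {y : E} {r : ℝ} (h : IsGraphChart S γ Ω (Metric.ball y r))
    (hr : 0 < r) (hγ : LipschitzWith C γ) (hu : UniqueDiffOn ℝ Ωᶜ) (hf : ContDiffOn ℝ 1 f Ωᶜ)
    (hy : y ∉ Ω) :
    ∃ (r' : ℝ) (K : ℝ≥0) (g : E → ℝ), 0 < r' ∧ r' ≤ r ∧ LipschitzWith K g ∧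
      EqOn f g (Ωᶜ ∩ Metric.ball y r') := by
  have hcont : ContinuousOn (fderivWithin ℝ f Ωᶜ) Ωᶜ := hf.continuousOn_fderivWithin hu le_rfl
  have hbound : ∀ᶠ z in 𝓝[Ωᶜ] y, ‖fderivWithin ℝ f Ωᶜ z‖ < ‖fderivWithin ℝ f Ωᶜ y‖₊ + 1 :=
    (hcont y hy).norm.eventually_lt_const (lt_add_one _)
  rw [eventually_nhdsWithin_iff] at hbound
  obtain ⟨δ, hδ, hball⟩ := Metric.eventually_nhds_iff_ball.1 hbound
  have hmin : IsGraphChart S γ Ω (Metric.ball y (min r δ)) :=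
    h.mono Metric.isOpen_ball (Metric.ball_subset_ball (min_le_left r δ))
  obtain ⟨g, hg, hfg⟩ := (hmin.lipschitzOnWith_compl_inter_ball hγ
    (B := ‖fderivWithin ℝ f Ωᶜ y‖₊ + 1) (hf.differentiableOn one_ne_zero) fun z hz hzΩ =>
      (hball z (Metric.ball_subset_ball (min_le_right r δ) hz) hzΩ).le).extend_real
  have hle : min r δ / (1 + 2 * C) ≤ r :=
    (div_le_self (lt_min hr hδ).le (by linarith [C.coe_nonneg])).trans (min_le_left r δ)
  exact ⟨_, _, g, div_pos (lt_min hr hδ) (by positivity), hle, hg, hfg⟩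

end IsGraphChart

section Divergence

variable {d : ℕ} {Ω : Set (EuclideanSpace ℝ (Fin d))}

theorem HasLipschitzBoundary.uniqueDiffOn_compl (hl : HasLipschitzBoundary Ω) :
    UniqueDiffOn ℝ Ωᶜ := by
  intro y hy
  by_cases hcl : y ∈ closure Ω
  · obtain ⟨e, he, γ, C, r, hr, hγ, hc⟩ :=
      hl.exists_isGraphChart (y := y) ⟨hcl, fun hmem => hy (interior_subset hmem)⟩
    exact hc.uniqueDiffWithinAt_compl hγ (Metric.mem_ball_self hr) hy
  · exact uniqueDiffWithinAt_of_mem_nhds (compl_mem_nhds_of_notMem_closure hcl)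

/-- The divergence theorem in the exterior of `Ω` for the vector field `p • a`. As the normal
points out of `Ω`, the surface integral carries a minus sign. -/
def HasExteriorFlux (Ω : Set (EuclideanSpace ℝ (Fin d))) (a : EuclideanSpace ℝ (Fin d))
    (p : EuclideanSpace ℝ (Fin d) → ℝ) : Prop :=
  ∫ z in (closure Ω)ᶜ, fderiv ℝ p z a =
    -∫ y, p y * inner ℝ (outwardNormal Ω y) a ∂surfaceMeasure Ω

variable {p : EuclideanSpace ℝ (Fin d) → ℝ}

theorem integrableOn_fderiv_exterior (hΩ : IsOpen Ω) (hl : HasLipschitzBoundary Ω)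
    (hp : ContDiffOn ℝ 1 p Ωᶜ) (hs : HasCompactSupport p) (a : EuclideanSpace ℝ (Fin d)) :
    IntegrableOn (fun z => fderiv ℝ p z a) (closure Ω)ᶜ := by
  have hcont : ContinuousOn (fun z => fderivWithin ℝ p Ωᶜ z a) Ωᶜ :=
    (hp.continuousOn_fderivWithin hl.uniqueDiffOn_compl le_rfl).clm_apply continuousOn_const
  have hfi : IntegrableOn (fun z => fderivWithin ℝ p Ωᶜ z a) (Ωᶜ ∩ tsupport p) :=
    (hcont.mono inter_subset_left).integrableOn_compact (hs.isCompact.inter_left hΩ.isClosed_compl)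
  have hext : MeasurableSet (closure Ω)ᶜ := isClosed_closure.measurableSet.compl
  refine IntegrableOn.of_forall_sdiff_eq_zero (s := (closure Ω)ᶜ ∩ tsupport p) ?_ hext
    fun z hz => ?_
  · refine (hfi.mono_set (inter_subset_inter_left _ (compl_closure_subset_compl Ω))).congr_fun
      (fun z hz => ?_) (hext.inter (isClosed_tsupport p).measurableSet)
    simp only [fderivWithin_of_mem_nhds (compl_mem_nhds_of_notMem_closure hz.1)]
  · rw [fderiv_of_notMem_tsupport ℝ fun hzp => hz.2 ⟨hz.1, hzp⟩, zero_apply]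

theorem integral_mul_inner_outwardNormal_eq_zero (hp : ∀ y ∈ frontier Ω, p y = 0)
    (a : EuclideanSpace ℝ (Fin d)) :
    ∫ y, p y * inner ℝ (outwardNormal Ω y) a ∂surfaceMeasure Ω = 0 := by
  refine integral_eq_zero_of_ae ?_
  filter_upwards [ae_surfaceMeasure_mem_frontier Ω] with y hy
  rw [hp y hy, zero_mul, Pi.zero_apply]

theorem integral_fderiv_eq_zero_of_hasCompactSupport (hp : ContDiff ℝ 1 p)
    (hs : HasCompactSupport p) (a : EuclideanSpace ℝ (Fin d)) : ∫ z, fderiv ℝ p z a = 0 := by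
  have hcont : Continuous fun z => fderiv ℝ p z a :=
    (hp.continuous_fderiv one_ne_zero).clm_apply continuous_const
  simpa using integral_mul_fderiv_eq_neg_fderiv_mul_of_integrable (𝕜 := ℝ) (μ := volume)
    (f := fun _ => 1) (g := p) (v := a) (by simp)
    (by simpa using hcont.integrable_of_hasCompactSupport (hs.fderiv_apply ℝ a))
    (by simpa using hp.continuous.integrable_of_hasCompactSupport hs)
    (fun z _ => differentiableAt_const 1) (fun z _ => hp.differentiable one_ne_zero z)

theorem hasExteriorFlux_of_tsupport_subset_exterior (hp : ContDiffOn ℝ 1 p Ωᶜ)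
    (hs : HasCompactSupport p) (hsub : tsupport p ⊆ (closure Ω)ᶜ)
    (a : EuclideanSpace ℝ (Fin d)) : HasExteriorFlux Ω a p := by
  have hp' : ContDiff ℝ 1 p := contDiff_iff_contDiffAt.2 fun z => by
    by_cases hz : z ∈ tsupport p
    · exact hp.contDiffAt (compl_mem_nhds_of_notMem_closure (hsub hz))
    · exact contDiffAt_const.congr_of_eventuallyEq (notMem_tsupport_iff_eventuallyEq.1 hz)
  rw [HasExteriorFlux, integral_mul_inner_outwardNormal_eq_zero fun y hy =>
      image_eq_zero_of_notMem_tsupport fun hyp => hsub hyp (frontier_subset_closure hy),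
    setIntegral_eq_integral_of_forall_compl_eq_zero fun z hz => ?_,
    integral_fderiv_eq_zero_of_hasCompactSupport hp' hs, neg_zero]
  rw [fderiv_of_notMem_tsupport ℝ fun hzp => hz (hsub hzp), zero_apply]

theorem hasExteriorFlux_of_tsupport_subset (hΩ : IsOpen Ω) (hsub : tsupport p ⊆ Ω)
    (a : EuclideanSpace ℝ (Fin d)) : HasExteriorFlux Ω a p := by
  rw [HasExteriorFlux, integral_mul_inner_outwardNormal_eq_zero fun y hy =>
      image_eq_zero_of_notMem_tsupport fun hyp => frontier_subset_compl hΩ hy (hsub hyp),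
    neg_zero]
  refine setIntegral_eq_zero_of_forall_eq_zero fun z hz => ?_
  rw [fderiv_of_notMem_tsupport ℝ fun hzp => hz (subset_closure (hsub hzp)), zero_apply]

theorem IsGraphChart.hasExteriorFlux {U : Type*} [NormedAddCommGroup U] [InnerProductSpace ℝ U]
    [FiniteDimensional ℝ U] [MeasurableSpace U] [BorelSpace U]
    {S : HyperplaneSplitting U (EuclideanSpace ℝ (Fin d))} {γ : U → ℝ} {C K : ℝ≥0}
    {O : Set (EuclideanSpace ℝ (Fin d))} (h : IsGraphChart S γ Ω O) (hγ : LipschitzWith C γ)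
    (hΩ : IsOpen Ω) (hp : DifferentiableOn ℝ p Ωᶜ) {g : EuclideanSpace ℝ (Fin d) → ℝ}
    (hg : LipschitzWith K g) (hs : HasCompactSupport g) (hsub : tsupport g ⊆ O)
    (hpg : EqOn p g Ωᶜ) (a : EuclideanSpace ℝ (Fin d)) : HasExteriorFlux Ω a p := by
  rw [HasExteriorFlux]
  calc ∫ z in (closure Ω)ᶜ, fderiv ℝ p z a = ∫ z in (closure Ω)ᶜ, lineDeriv ℝ g z a := by
        refine setIntegral_congr_fun isClosed_closure.measurableSet.compl fun z hz => ?_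
        have hΩz := compl_mem_nhds_of_notMem_closure hz
        rw [← (hpg.eventuallyEq_of_mem hΩz).lineDeriv_eq,
          (hp.differentiableAt hΩz).lineDeriv_eq_fderiv]
    _ = -∫ y, g y * inner ℝ (outwardNormal Ω y) a ∂surfaceMeasure Ω :=
        h.integral_lineDeriv hγ hΩ hg hs hsub a
    _ = -∫ y, p y * inner ℝ (outwardNormal Ω y) a ∂surfaceMeasure Ω := by
        congr 1
        refine integral_congr_ae ?_
        filter_upwards [ae_surfaceMeasure_mem_frontier Ω] with y hy
        rw [hpg (frontier_subset_compl hΩ hy)]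

theorem exists_hasExteriorFlux_nhds_of_mem_frontier (hΩ : IsOpen Ω) (hl : HasLipschitzBoundary Ω)
    (hp : ContDiffOn ℝ 1 p Ωᶜ) (a : EuclideanSpace ℝ (Fin d)) {y : EuclideanSpace ℝ (Fin d)}
    (hy : y ∈ frontier Ω) :
    ∃ W, IsOpen W ∧ y ∈ W ∧ ∀ χ : EuclideanSpace ℝ (Fin d) → ℝ, ContDiff ℝ 1 χ →
      tsupport χ ⊆ W → HasExteriorFlux Ω a fun z => χ z * p z := by
  obtain ⟨e, he, γ, C, r, hr, hγ, hc⟩ := hl.exists_isGraphChart hy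
  obtain ⟨r', K, g, hr', hle, hg, hpg⟩ :=
    hc.exists_lipschitzWith_eqOn hr hγ hl.uniqueDiffOn_compl hp (frontier_subset_compl hΩ hy)
  refine ⟨Metric.ball y r', Metric.isOpen_ball, Metric.mem_ball_self hr', fun χ hχ hsub => ?_⟩
  have hχs : HasCompactSupport χ := Metric.isCompact_of_isClosed_isBounded (isClosed_tsupport χ)
    (Metric.isBounded_ball.subset hsub)
  obtain ⟨L, hL⟩ := hχ.lipschitzWith_of_hasCompactSupport hχs one_ne_zero
  obtain ⟨M, hM⟩ := exists_lipschitzWith_mul_of_hasCompactSupport hL hg hχs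
  refine (hc.mono Metric.isOpen_ball (Metric.ball_subset_ball hle)).hasExteriorFlux hγ hΩ
    ((hχ.differentiable one_ne_zero).differentiableOn.mul (hp.differentiableOn one_ne_zero)) hM
    hχs.mul_right (tsupport_mul_subset_left.trans hsub) (fun z hz => ?_) a
  by_cases hzball : z ∈ Metric.ball y r'
  · exact congrArg (χ z * ·) (hpg ⟨hz, hzball⟩)
  · have hχz : χ z = 0 := image_eq_zero_of_notMem_tsupport fun hzχ => hzball (hsub hzχ)
    simp only [Pi.mul_apply, hχz, zero_mul]

theorem exists_hasExteriorFlux_nhds (hΩ : IsOpen Ω) (hl : HasLipschitzBoundary Ω)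
    (hp : ContDiffOn ℝ 1 p Ωᶜ) (hs : HasCompactSupport p) (a y : EuclideanSpace ℝ (Fin d)) :
    ∃ W, IsOpen W ∧ y ∈ W ∧ ∀ χ : EuclideanSpace ℝ (Fin d) → ℝ, ContDiff ℝ 1 χ →
      tsupport χ ⊆ W → HasExteriorFlux Ω a fun z => χ z * p z := by
  by_cases hyΩ : y ∈ Ω
  · exact ⟨Ω, hΩ, hyΩ, fun χ _ hsub => hasExteriorFlux_of_tsupport_subset hΩ
      (tsupport_mul_subset_left.trans hsub) a⟩
  by_cases hcl : y ∈ closure Ω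
  · exact exists_hasExteriorFlux_nhds_of_mem_frontier hΩ hl hp a
      ⟨hcl, fun hmem => hyΩ (interior_subset hmem)⟩
  · exact ⟨(closure Ω)ᶜ, isClosed_closure.isOpen_compl, hcl, fun χ hχ hsub =>
      hasExteriorFlux_of_tsupport_subset_exterior (hχ.contDiffOn.mul hp) hs.mul_left
        (tsupport_mul_subset_left.trans hsub) a⟩

theorem hasExteriorFlux_sum (hΩ : IsOpen Ω) (hb : Bornology.IsBounded Ω)
    (hl : HasLipschitzBoundary Ω) (a : EuclideanSpace ℝ (Fin d)) {ι : Type*} {s : Finset ι}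
    {q : ι → EuclideanSpace ℝ (Fin d) → ℝ} (hq : ∀ i ∈ s, ContDiffOn ℝ 1 (q i) Ωᶜ)
    (hs : ∀ i ∈ s, HasCompactSupport (q i)) (hflux : ∀ i ∈ s, HasExteriorFlux Ω a (q i)) :
    HasExteriorFlux Ω a fun z => ∑ i ∈ s, q i z := by
  have hfderiv : ∀ z ∈ (closure Ω)ᶜ,
      fderiv ℝ (fun z => ∑ i ∈ s, q i z) z a = ∑ i ∈ s, fderiv ℝ (q i) z a := fun z hz => by
    rw [fderiv_fun_sum fun i hi => ((hq i hi).contDiffAt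
      (compl_mem_nhds_of_notMem_closure hz)).differentiableAt one_ne_zero, sum_apply]
  simp only [HasExteriorFlux, Finset.sum_mul]
  rw [setIntegral_congr_fun isClosed_closure.measurableSet.compl hfderiv,
    integral_finsetSum _ fun i hi => integrableOn_fderiv_exterior hΩ hl (hq i hi) (hs i hi) a,
    integral_finsetSum _ fun i hi => integrable_mul_inner_outwardNormal hΩ hb hl
      ((hq i hi).continuousOn.mono (frontier_subset_compl hΩ)) a, ← Finset.sum_neg_distrib]
  exact Finset.sum_congr rfl hflux

theorem hasExteriorFlux_of_contDiffOn (hΩ : IsOpen Ω) (hb : Bornology.IsBounded Ω)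
    (hl : HasLipschitzBoundary Ω) (hp : ContDiffOn ℝ 1 p Ωᶜ) (hs : HasCompactSupport p)
    (a : EuclideanSpace ℝ (Fin d)) : HasExteriorFlux Ω a p := by
  choose W hWo hyW hW using exists_hasExteriorFlux_nhds hΩ hl hp hs a
  obtain ⟨t, -, ht⟩ := hs.isCompact.elim_nhds_subcover W fun y _ => (hWo y).mem_nhds (hyW y)
  obtain ⟨ρ, hρ⟩ := SmoothPartitionOfUnity.exists_isSubordinate (modelWithCornersSelf ℝ
    (EuclideanSpace ℝ (Fin d))) (isClosed_tsupport p) (fun i : t => W i) (fun i => hWo i)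
    (by rwa [iUnion_subtype])
  have hρ_smooth : ∀ i, ContDiff ℝ 1 (ρ i) := fun i =>
    (ρ i).contMDiff.contDiff.of_le (by exact_mod_cast le_top)
  have hsum : p = fun z => ∑ i, ρ i z * p z := funext fun z => by
    by_cases hz : z ∈ tsupport p
    · rw [← Finset.sum_mul, ← finsum_eq_sum_of_fintype, ρ.sum_eq_one hz, one_mul]
    · simp [image_eq_zero_of_notMem_tsupport hz]
  rw [hsum]
  exact hasExteriorFlux_sum hΩ hb hl a (fun i _ => (hρ_smooth i).contDiffOn.mul hp)
    (fun i _ => hs.mul_left) fun i _ => hW i (ρ i) (hρ_smooth i) (hρ i)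

end Divergence

open scoped Laplacian

section Green

variable {E : Type*} [NormedAddCommGroup E]

theorem differentiableAt_fderiv_apply [NormedSpace ℝ E] {u : E → ℝ} {z : E}
    (hu : ContDiffAt ℝ 2 u z) (c : E) : DifferentiableAt ℝ (fun y => fderiv ℝ u y c) z :=
  ((hu.fderiv_right (m := 1) (by norm_num)).differentiableAt one_ne_zero).clm_apply
    (differentiableAt_const c)

variable [InnerProductSpace ℝ E] {ι : Type*} [Fintype ι]

theorem laplacian_eq_sum_fderiv_fderiv_apply [FiniteDimensional ℝ E]
    (b : OrthonormalBasis ι ℝ E) {u : E → ℝ} {z : E} (hu : ContDiffAt ℝ 2 u z) :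
    Δ u z = ∑ i, fderiv ℝ (fun y => fderiv ℝ u y (b i)) z (b i) := by
  have hdu : DifferentiableAt ℝ (fderiv ℝ u) z :=
    (hu.fderiv_right (m := 1) (by norm_num)).differentiableAt one_ne_zero
  simp [laplacian_eq_iteratedFDeriv_orthonormalBasis u b, iteratedFDeriv_two_apply,
    fderiv_clm_apply hdu (differentiableAt_const _)]

theorem sum_apply_orthonormalBasis_mul_inner (b : OrthonormalBasis ι ℝ E) (A : E →L[ℝ] ℝ) (x : E) :
    ∑ i, A (b i) * inner ℝ x (b i) = A x := by
  conv_rhs => rw [← b.sum_repr' x, map_sum]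
  exact Finset.sum_congr rfl fun i _ => by rw [map_smul, smul_eq_mul, mul_comm, real_inner_comm]

theorem laplacian_mul [FiniteDimensional ℝ E] (b : OrthonormalBasis ι ℝ E) {p q : E → ℝ}
    (hp : ContDiff ℝ 2 p) (hq : ContDiff ℝ 2 q) (z : E) :
    Δ (fun y => p y * q y) z =
      p z * Δ q z + 2 * ∑ i, fderiv ℝ p z (b i) * fderiv ℝ q z (b i) +
        q z * Δ p z := by
  have hpd := hp.differentiable two_ne_zero
  have hqd := hq.differentiable two_ne_zero
  rw [laplacian_eq_sum_fderiv_fderiv_apply b (hp.mul hq).contDiffAt,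
    laplacian_eq_sum_fderiv_fderiv_apply b hp.contDiffAt,
    laplacian_eq_sum_fderiv_fderiv_apply b hq.contDiffAt, Finset.mul_sum, Finset.mul_sum,
    Finset.mul_sum, ← Finset.sum_add_distrib, ← Finset.sum_add_distrib]
  refine Finset.sum_congr rfl fun i _ => ?_
  have hpq : (fun y => fderiv ℝ (fun y => p y * q y) y (b i)) =
      fun y => p y * fderiv ℝ q y (b i) + q y * fderiv ℝ p y (b i) := by
    ext y
    simp [fderiv_fun_mul (hpd y) (hqd y)]
  have hdp := differentiableAt_fderiv_apply (hp.contDiffAt (x := z)) (b i)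
  have hdq := differentiableAt_fderiv_apply (hq.contDiffAt (x := z)) (b i)
  rw [hpq, fderiv_fun_add ((hpd z).fun_mul hdq) ((hqd z).fun_mul hdp),
    fderiv_fun_mul (hpd z) hdq, fderiv_fun_mul (hqd z) hdp]
  simp only [add_apply, smul_apply, smul_eq_mul]
  ring

theorem continuous_laplacian [FiniteDimensional ℝ E] {p : E → ℝ} (hp : ContDiff ℝ 2 p) :
    Continuous (Δ p) := by
  have := hp.continuous_iteratedFDeriv (m := 2) le_rfl
  rw [laplacian_eq_iteratedFDeriv_stdOrthonormalBasis]
  fun_prop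

theorem laplacian_comp_smul [FiniteDimensional ℝ E] {p : E → ℝ} (hp : ContDiff ℝ 2 p) (c : ℝ)
    (z : E) : Δ (fun y => p (c • y)) z = c ^ 2 * Δ p (c • z) := by
  simp [laplacian_eq_iteratedFDeriv_stdOrthonormalBasis, iteratedFDeriv_comp_const_smul c hp,
    Finset.mul_sum]

theorem laplacian_eq_zero_of_eventuallyEq_const [FiniteDimensional ℝ E] {p : E → ℝ} {c : ℝ} {z : E}
    (h : p =ᶠ[𝓝 z] fun _ => c) : Δ p z = 0 := by
  rw [(laplacian_congr_nhds h).eq_of_nhds]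
  simp [laplacian_eq_iteratedFDeriv_stdOrthonormalBasis, iteratedFDeriv_const_of_ne two_ne_zero]

theorem laplacian_eq_zero_of_notMem_tsupport [FiniteDimensional ℝ E] {p : E → ℝ} {z : E}
    (hz : z ∉ tsupport p) : Δ p z = 0 :=
  laplacian_eq_zero_of_eventuallyEq_const (notMem_tsupport_iff_eventuallyEq.1 hz)

variable {d : ℕ} {Ω : Set (EuclideanSpace ℝ (Fin d))} {u w : EuclideanSpace ℝ (Fin d) → ℝ}

/-- The component along `c` of the vector field `w ∇u - u ∇w` of Green's second identity; the
gradient of `u` is taken from outside `Ω`. -/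
noncomputable def greenField (Ω : Set (EuclideanSpace ℝ (Fin d)))
    (u w : EuclideanSpace ℝ (Fin d) → ℝ) (c z : EuclideanSpace ℝ (Fin d)) : ℝ :=
  w z * fderivWithin ℝ u Ωᶜ z c - u z * fderiv ℝ w z c

theorem contDiffOn_greenField (hud : UniqueDiffOn ℝ Ωᶜ) (hu : ContDiffOn ℝ 2 u Ωᶜ)
    (hw : ContDiff ℝ 2 w) (c : EuclideanSpace ℝ (Fin d)) :
    ContDiffOn ℝ 1 (greenField Ω u w c) Ωᶜ := by
  have hdu : ContDiffOn ℝ 1 (fun z => fderivWithin ℝ u Ωᶜ z c) Ωᶜ :=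
    (hu.fderivWithin hud (m := 1) (by norm_num)).clm_apply contDiffOn_const
  have hdw : ContDiff ℝ 1 (fun z => fderiv ℝ w z c) :=
    (hw.fderiv_right (m := 1) (by norm_num)).clm_apply contDiff_const
  exact ((hw.of_le (by norm_num)).contDiffOn.mul hdu).sub
    ((hu.of_le (by norm_num)).mul hdw.contDiffOn)

theorem hasCompactSupport_greenField (hws : HasCompactSupport w)
    (c : EuclideanSpace ℝ (Fin d)) : HasCompactSupport (greenField Ω u w c) :=
  hws.mul_right.sub ((hws.fderiv_apply ℝ c).mul_left)

theorem fderiv_greenField_apply (hu : ContDiffOn ℝ 2 u Ωᶜ) (hw : ContDiff ℝ 2 w)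
    {z : EuclideanSpace ℝ (Fin d)} (hz : z ∈ (closure Ω)ᶜ) (c : EuclideanSpace ℝ (Fin d)) :
    fderiv ℝ (greenField Ω u w c) z c = w z * fderiv ℝ (fun y => fderiv ℝ u y c) z c -
      u z * fderiv ℝ (fun y => fderiv ℝ w y c) z c := by
  have huz : ContDiffAt ℝ 2 u z := hu.contDiffAt (compl_mem_nhds_of_notMem_closure hz)
  have hee : greenField Ω u w c =ᶠ[𝓝 z] fun y => w y * fderiv ℝ u y c - u y * fderiv ℝ w y c := by
    filter_upwards [isClosed_closure.isOpen_compl.mem_nhds hz] with y hy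
    simp only [greenField, fderivWithin_of_mem_nhds (compl_mem_nhds_of_notMem_closure hy)]
  have hwd := hw.differentiable two_ne_zero z
  have hud := huz.differentiableAt two_ne_zero
  have hddw := differentiableAt_fderiv_apply hw.contDiffAt (z := z) c
  have hddu := differentiableAt_fderiv_apply huz c
  rw [hee.fderiv_eq, fderiv_fun_sub (hwd.fun_mul hddu) (hud.fun_mul hddw),
    fderiv_fun_mul hwd hddu, fderiv_fun_mul hud hddw]
  simp only [sub_apply, add_apply, smul_apply, smul_eq_mul]
  ring

theorem sum_fderiv_greenField (hu : ContDiffOn ℝ 2 u Ωᶜ) (hw : ContDiff ℝ 2 w)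
    (b : OrthonormalBasis ι ℝ (EuclideanSpace ℝ (Fin d)))
    {z : EuclideanSpace ℝ (Fin d)} (hz : z ∈ (closure Ω)ᶜ) :
    ∑ i, fderiv ℝ (greenField Ω u w (b i)) z (b i) =
      w z * Δ u z - u z * Δ w z := by
  rw [laplacian_eq_sum_fderiv_fderiv_apply b
      (hu.contDiffAt (compl_mem_nhds_of_notMem_closure hz)),
    laplacian_eq_sum_fderiv_fderiv_apply b hw.contDiffAt, Finset.mul_sum, Finset.mul_sum,
    ← Finset.sum_sub_distrib]
  exact Finset.sum_congr rfl fun i _ => fderiv_greenField_apply hu hw hz (b i)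

theorem sum_greenField_mul_inner (b : OrthonormalBasis ι ℝ (EuclideanSpace ℝ (Fin d)))
    (y n : EuclideanSpace ℝ (Fin d)) :
    ∑ i, greenField Ω u w (b i) y * inner ℝ n (b i) =
      fderivWithin ℝ u Ωᶜ y n * w y - u y * fderiv ℝ w y n := by
  rw [← sum_apply_orthonormalBasis_mul_inner b (fderivWithin ℝ u Ωᶜ y) n,
    ← sum_apply_orthonormalBasis_mul_inner b (fderiv ℝ w y) n, Finset.sum_mul, Finset.mul_sum,
    ← Finset.sum_sub_distrib]
  exact Finset.sum_congr rfl fun i _ => by rw [greenField]; ring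

theorem green_second_identity_exterior (hΩ : IsOpen Ω) (hb : Bornology.IsBounded Ω)
    (hl : HasLipschitzBoundary Ω) (hu : ContDiffOn ℝ 2 u Ωᶜ) (hw : ContDiff ℝ 2 w)
    (hws : HasCompactSupport w) :
    ∫ z in (closure Ω)ᶜ, (w z * Δ u z - u z * Δ w z) =
      -∫ y, (fderivWithin ℝ u Ωᶜ y (outwardNormal Ω y) * w y
        - u y * fderiv ℝ w y (outwardNormal Ω y)) ∂surfaceMeasure Ω := by
  let b := EuclideanSpace.basisFun (Fin d) ℝ
  have hfc i := contDiffOn_greenField hl.uniqueDiffOn_compl hu hw (b i)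
  have hfs i : HasCompactSupport (greenField Ω u w (b i)) := hasCompactSupport_greenField hws (b i)
  calc ∫ z in (closure Ω)ᶜ, (w z * Δ u z - u z * Δ w z)
      = ∑ i, ∫ z in (closure Ω)ᶜ, fderiv ℝ (greenField Ω u w (b i)) z (b i) := by
        rw [← integral_finsetSum _ fun i _ =>
          integrableOn_fderiv_exterior hΩ hl (hfc i) (hfs i) (b i)]
        exact setIntegral_congr_fun isClosed_closure.measurableSet.compl fun z hz =>
          (sum_fderiv_greenField hu hw b hz).symm
    _ = -∑ i, ∫ y, greenField Ω u w (b i) y * inner ℝ (outwardNormal Ω y) (b i)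
          ∂surfaceMeasure Ω := by
        rw [← Finset.sum_neg_distrib]
        exact Finset.sum_congr rfl fun i _ =>
          hasExteriorFlux_of_contDiffOn hΩ hb hl (hfc i) (hfs i) (b i)
    _ = _ := by
        rw [← integral_finsetSum _ fun i _ => integrable_mul_inner_outwardNormal hΩ hb hl
          ((hfc i).continuousOn.mono (frontier_subset_compl hΩ)) (b i)]
        simp only [sum_greenField_mul_inner]

end Green

section HeatKernel

variable {d : ℕ} {k : ℝ}

theorem heatKernel_of_pos (k : ℝ) (z : EuclideanSpace ℝ (Fin d)) {τ : ℝ} (hτ : 0 < τ) :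
    heatKernel k z τ =
      (4 * Real.pi * k * τ) ^ (-(d : ℝ) / 2) * Real.exp (-‖z‖ ^ 2 / (4 * k * τ)) := by
  rw [heatKernel, if_pos hτ]

theorem heatKernel_zero_right (k : ℝ) (z : EuclideanSpace ℝ (Fin d)) : heatKernel k z 0 = 0 := by
  rw [heatKernel, if_neg (lt_irrefl 0)]

theorem heatKernel_one (k : ℝ) (z : EuclideanSpace ℝ (Fin d)) :
    heatKernel k z 1 =
      (4 * Real.pi * k) ^ (-(d : ℝ) / 2) * Real.exp (-(1 / (4 * k)) * ‖z‖ ^ 2) := by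
  rw [heatKernel_of_pos k z one_pos, mul_one, mul_one]
  congr 2
  ring

theorem heatKernel_neg (k : ℝ) (z : EuclideanSpace ℝ (Fin d)) (τ : ℝ) :
    heatKernel k (-z) τ = heatKernel k z τ := by
  simp only [heatKernel, norm_neg]

theorem heatKernel_nonneg (hk : 0 < k) (z : EuclideanSpace ℝ (Fin d)) (τ : ℝ) :
    0 ≤ heatKernel k z τ := by
  unfold heatKernel
  split_ifs
  · positivity
  · exact le_rfl

theorem measurable_heatKernel (k : ℝ) :
    Measurable fun p : EuclideanSpace ℝ (Fin d) × ℝ => heatKernel k p.1 p.2 := by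
  unfold heatKernel
  refine Measurable.ite (measurableSet_lt measurable_const measurable_snd) ?_ measurable_const
  exact ((measurable_const.mul measurable_snd).pow_const _).mul
    (((measurable_fst.norm.pow_const 2).neg.div (measurable_const.mul measurable_snd)).exp)

theorem contDiff_heatKernel (k : ℝ) (x : EuclideanSpace ℝ (Fin d)) (τ : ℝ) {n : WithTop ℕ∞} :
    ContDiff ℝ n fun y => heatKernel k (x - y) τ := by
  unfold heatKernel
  split_ifs
  · have hsq : ContDiff ℝ n fun y : EuclideanSpace ℝ (Fin d) => ‖x - y‖ ^ 2 :=
      (contDiff_const.sub contDiff_id).norm_sq ℝ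
    exact contDiff_const.mul ((hsq.neg.div_const _).exp)
  · exact contDiff_const

theorem continuousOn_heatKernel_sub (hk : 0 < k) (x : EuclideanSpace ℝ (Fin d)) (t : ℝ) :
    ContinuousOn (fun p : EuclideanSpace ℝ (Fin d) × ℝ => heatKernel k (x - p.1) (t - p.2))
      {p | p.2 < t} := by
  have hpos : ∀ p ∈ {p : EuclideanSpace ℝ (Fin d) × ℝ | p.2 < t}, 0 < t - p.2 :=
    fun p hp => sub_pos.2 hp
  have hcont : ContinuousOn (fun p : EuclideanSpace ℝ (Fin d) × ℝ =>
      (4 * Real.pi * k * (t - p.2)) ^ (-(d : ℝ) / 2) *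
        Real.exp (-‖x - p.1‖ ^ 2 / (4 * k * (t - p.2)))) {p | p.2 < t} := by
    refine ContinuousOn.mul (ContinuousOn.rpow_const (by fun_prop) fun p hp => Or.inl ?_)
      (Real.continuous_exp.comp_continuousOn (ContinuousOn.div (by fun_prop) (by fun_prop)
        fun p hp => ?_))
    all_goals
      have := hpos p hp
      positivity
  exact hcont.congr fun p hp => heatKernel_of_pos k _ (hpos p hp)

theorem fderiv_heatKernel_apply (hk : 0 < k) (x y c : EuclideanSpace ℝ (Fin d)) {τ : ℝ}
    (hτ : 0 < τ) :
    fderiv ℝ (fun y => heatKernel k (x - y) τ) y c =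
      heatKernel k (x - y) τ / (2 * k * τ) * inner ℝ (x - y) c := by
  have hsq : HasFDerivAt (fun y : EuclideanSpace ℝ (Fin d) => ‖x - y‖ ^ 2)
      (2 • (innerSL ℝ (x - y)).comp (-ContinuousLinearMap.id ℝ _)) y :=
    ((hasFDerivAt_id y).const_sub x).norm_sq
  have hexp := (hsq.fun_neg.mul_const (4 * k * τ)⁻¹).exp.const_mul
    ((4 * Real.pi * k * τ) ^ (-(d : ℝ) / 2))
  simp only [← div_eq_mul_inv] at hexp
  simp only [heatKernel_of_pos k _ hτ]
  rw [hexp.fderiv]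
  simp only [smul_apply, neg_apply, ContinuousLinearMap.comp_apply, innerSL_apply_apply,
    ContinuousLinearMap.id_apply, inner_neg_right, smul_eq_mul, nsmul_eq_mul, Nat.cast_ofNat]
  field_simp
  ring

/-- The value of `ΔK`, the Laplacian of the heat kernel, at `(z, τ)`. -/
noncomputable def heatKernelLaplacian (k : ℝ) (z : EuclideanSpace ℝ (Fin d)) (τ : ℝ) : ℝ :=
  (-d / (2 * k * τ) + ‖z‖ ^ 2 / (2 * k * τ) ^ 2) * heatKernel k z τ

theorem fderiv_fderiv_heatKernel_apply (hk : 0 < k) (x y c : EuclideanSpace ℝ (Fin d)) {τ : ℝ}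
    (hτ : 0 < τ) :
    fderiv ℝ (fun y => fderiv ℝ (fun y => heatKernel k (x - y) τ) y c) y c =
      (-‖c‖ ^ 2 / (2 * k * τ) + inner ℝ (x - y) c ^ 2 / (2 * k * τ) ^ 2) *
        heatKernel k (x - y) τ := by
  have hinner : HasFDerivAt (fun y => inner ℝ (x - y) c) (-(innerSL ℝ c)) y := by
    refine (((hasFDerivAt_id y).const_sub x).inner ℝ (hasFDerivAt_const c y)).congr_fderiv ?_
    ext
    simp [real_inner_comm]
  have hK : DifferentiableAt ℝ (fun y => heatKernel k (x - y) τ / (2 * k * τ)) y := by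
    simpa only [div_eq_mul_inv] using
      ((contDiff_heatKernel k x τ).differentiable one_ne_zero y).mul_const _
  have hK' : fderiv ℝ (fun y => heatKernel k (x - y) τ / (2 * k * τ)) y c =
      heatKernel k (x - y) τ / (2 * k * τ) * inner ℝ (x - y) c / (2 * k * τ) := by
    simp only [div_eq_mul_inv _ (2 * k * τ)]
    rw [fderiv_mul_const ((contDiff_heatKernel k x τ).differentiable one_ne_zero y)]
    simp [fderiv_heatKernel_apply hk x y c hτ]
    ring
  simp only [fderiv_heatKernel_apply hk x _ c hτ]
  rw [fderiv_fun_mul hK hinner.differentiableAt, hinner.fderiv]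
  simp only [add_apply, smul_apply, smul_eq_mul, neg_apply, innerSL_apply_apply, hK',
    real_inner_self_eq_norm_sq]
  field_simp

theorem laplacian_heatKernel (hk : 0 < k) (x y : EuclideanSpace ℝ (Fin d)) {τ : ℝ} (hτ : 0 < τ) :
    Δ (fun y : EuclideanSpace ℝ (Fin d) => heatKernel k (x - y) τ) y =
      heatKernelLaplacian k (x - y) τ := by
  let b := EuclideanSpace.basisFun (Fin d) ℝ
  rw [laplacian_eq_sum_fderiv_fderiv_apply b (contDiff_heatKernel k x τ).contDiffAt]
  simp only [fderiv_fderiv_heatKernel_apply hk x y _ hτ, b.norm_eq_one]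
  rw [heatKernelLaplacian, ← Finset.sum_mul, Finset.sum_add_distrib, ← Finset.sum_div _ _ (_ ^ 2),
    ← b.sum_sq_norm_inner_left (x - y)]
  simp [div_eq_mul_inv]

theorem hasDerivAt_heatKernel_sub (hk : 0 < k) (z : EuclideanSpace ℝ (Fin d)) {t s : ℝ}
    (hs : s < t) :
    HasDerivAt (fun s => heatKernel k z (t - s)) (-(k * heatKernelLaplacian k z (t - s))) s := by
  have hτ : 0 < t - s := sub_pos.2 hs
  have hee : (fun s => heatKernel k z (t - s)) =ᶠ[𝓝 s] fun s =>
      (4 * Real.pi * k * (t - s)) ^ (-(d : ℝ) / 2) * Real.exp (-‖z‖ ^ 2 / (4 * k * (t - s))) := by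
    filter_upwards [Iio_mem_nhds hs] with r hr
    exact heatKernel_of_pos k z (sub_pos.2 hr)
  have hsub : HasDerivAt (fun s => t - s) (-1) s := (hasDerivAt_id s).const_sub t
  have hpow : HasDerivAt (fun s => (4 * Real.pi * k * (t - s)) ^ (-(d : ℝ) / 2)) _ s :=
    (hsub.const_mul (4 * Real.pi * k)).rpow_const (Or.inl (by positivity))
  have hexp : HasDerivAt (fun s => Real.exp (-‖z‖ ^ 2 / (4 * k * (t - s)))) _ s :=
    ((hasDerivAt_const s (-‖z‖ ^ 2)).fun_div (hsub.const_mul (4 * k)) (by positivity)).exp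
  refine HasDerivAt.congr_of_eventuallyEq ((hpow.fun_mul hexp).congr_deriv ?_) hee
  rw [heatKernelLaplacian, heatKernel_of_pos k z hτ, Real.rpow_sub_one (by positivity)]
  field_simp
  ring

theorem rpow_mul_exp_neg_mul_le {p a u : ℝ} (hp : 0 < p) (ha : 0 < a) (hu : 0 ≤ u) :
    u ^ p * Real.exp (-(a * u)) ≤ (p / a) ^ p := by
  have hle : u ≤ p / a * Real.exp (a / p * u) :=
    calc u = p / a * (a / p * u) := by field_simp
      _ ≤ p / a * Real.exp (a / p * u) := by
        gcongr
        linarith [Real.add_one_le_exp (a / p * u)]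
  calc u ^ p * Real.exp (-(a * u))
      ≤ (p / a * Real.exp (a / p * u)) ^ p * Real.exp (-(a * u)) := by gcongr
    _ = (p / a) ^ p := by
        rw [Real.mul_rpow (by positivity) (Real.exp_pos _).le, ← Real.exp_mul, mul_assoc,
          ← Real.exp_add, show a / p * u * p + -(a * u) = 0 by field_simp; ring, Real.exp_zero,
          mul_one]

theorem exp_neg_div_le_mul_exp {δ T τ r : ℝ} (hk : 0 < k) (hδ : 0 ≤ δ) (hτ : 0 < τ) (hτT : τ ≤ T)
    (hr : δ ≤ r) :
    Real.exp (-r ^ 2 / (4 * k * τ)) ≤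
      Real.exp (-(δ ^ 2 / (8 * k) * τ⁻¹)) * Real.exp (-(r ^ 2 / (8 * k * T))) := by
  have hnear : δ ^ 2 / (8 * k) * τ⁻¹ ≤ r ^ 2 / (8 * k) * τ⁻¹ := by gcongr
  have hlate : r ^ 2 / (8 * k * T) ≤ r ^ 2 / (8 * k * τ) := by gcongr
  have hsplit : -r ^ 2 / (4 * k * τ) = -(r ^ 2 / (8 * k) * τ⁻¹) - r ^ 2 / (8 * k * τ) := by
    field_simp
    ring
  rw [← Real.exp_add, Real.exp_le_exp, hsplit]
  linarith

theorem exists_heatKernel_div_le (hk : 0 < k) {δ : ℝ} (hδ : 0 < δ) :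
    ∃ C, 0 < C ∧ ∀ T τ, 0 < τ → τ ≤ T → ∀ z : EuclideanSpace ℝ (Fin d), δ ≤ ‖z‖ →
      heatKernel k z τ / τ ≤ C * Real.exp (-(‖z‖ ^ 2 / (8 * k * T))) := by
  let p : ℝ := d / 2 + 1
  let a := δ ^ 2 / (8 * k)
  have hp : 0 < p := by positivity
  have ha : 0 < a := by positivity
  refine ⟨(4 * Real.pi * k) ^ (-(d : ℝ) / 2) * (p / a) ^ p, by positivity,
    fun T τ hτ hτT z hz => ?_⟩
  have hpow : τ⁻¹ ^ p = τ ^ (-(d : ℝ) / 2) / τ := by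
    rw [Real.inv_rpow hτ.le, Real.rpow_add hτ, Real.rpow_one, mul_inv, ← Real.rpow_neg hτ.le,
      neg_div, div_eq_mul_inv _ τ]
  calc heatKernel k z τ / τ
      = (4 * Real.pi * k) ^ (-(d : ℝ) / 2) *
          (τ⁻¹ ^ p * Real.exp (-‖z‖ ^ 2 / (4 * k * τ))) := by
        rw [heatKernel_of_pos k z hτ, Real.mul_rpow (by positivity) hτ.le, hpow]
        ring
    _ ≤ (4 * Real.pi * k) ^ (-(d : ℝ) / 2) *
          (τ⁻¹ ^ p * (Real.exp (-(a * τ⁻¹)) * Real.exp (-(‖z‖ ^ 2 / (8 * k * T))))) := by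
        gcongr
        exact exp_neg_div_le_mul_exp hk hδ.le hτ hτT hz
    _ ≤ (4 * Real.pi * k) ^ (-(d : ℝ) / 2) * (p / a) ^ p *
          Real.exp (-(‖z‖ ^ 2 / (8 * k * T))) := by
        rw [← mul_assoc (τ⁻¹ ^ p), mul_assoc _ ((p / a) ^ p)]
        gcongr
        exact rpow_mul_exp_neg_mul_le hp ha (inv_pos.2 hτ).le

theorem integrable_exp_neg_mul_sq_norm {V : Type*} [NormedAddCommGroup V] [InnerProductSpace ℝ V]
    [FiniteDimensional ℝ V] [MeasurableSpace V] [BorelSpace V] {b : ℝ} (hb : 0 < b) :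
    Integrable fun v : V => Real.exp (-b * ‖v‖ ^ 2) := by
  refine Integrable.of_integral_ne_zero ?_
  rw [GaussianFourier.integral_rexp_neg_mul_sq_norm hb]
  positivity

theorem integral_heatKernel_one (hk : 0 < k) :
    ∫ z : EuclideanSpace ℝ (Fin d), heatKernel k z 1 = 1 := by
  have hpi : Real.pi / (1 / (4 * k)) = 4 * Real.pi * k := by field_simp
  simp_rw [heatKernel_one]
  rw [integral_const_mul, GaussianFourier.integral_rexp_neg_mul_sq_norm (by positivity),
    finrank_euclideanSpace_fin, hpi, ← Real.rpow_add (by positivity)]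
  simp [neg_div]

theorem sqrt_pow_mul_heatKernel_smul (hk : 0 < k) (z : EuclideanSpace ℝ (Fin d)) {ε : ℝ}
    (hε : 0 < ε) : √ε ^ d * heatKernel k (√ε • z) ε = heatKernel k z 1 := by
  have hexponent : -(ε * ‖z‖ ^ 2) / (4 * k * ε) = -(1 / (4 * k)) * ‖z‖ ^ 2 := by field_simp
  have hpow : √ε ^ d * ε ^ (-(d : ℝ) / 2) = 1 := by
    rw [← Real.rpow_natCast, Real.sqrt_eq_rpow, ← Real.rpow_mul hε.le, ← Real.rpow_add hε]
    ring_nf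
    exact Real.rpow_zero ε
  rw [heatKernel_of_pos k _ hε, heatKernel_one, norm_smul, mul_pow,
    Real.norm_of_nonneg (Real.sqrt_nonneg _), Real.sq_sqrt hε.le, hexponent,
    Real.mul_rpow (by positivity) hε.le]
  linear_combination ((4 * Real.pi * k) ^ (-(d : ℝ) / 2) *
    Real.exp (-(1 / (4 * k)) * ‖z‖ ^ 2)) * hpow

theorem integral_mul_heatKernel (hk : 0 < k) (F : EuclideanSpace ℝ (Fin d) → ℝ)
    (x : EuclideanSpace ℝ (Fin d)) {ε : ℝ} (hε : 0 < ε) :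
    ∫ y, F y * heatKernel k (x - y) ε = ∫ z, F (x + √ε • z) * heatKernel k z 1 := by
  have : 0 < √ε := Real.sqrt_pos.2 hε
  have hscale := Measure.integral_comp_smul (volume : Measure (EuclideanSpace ℝ (Fin d)))
    (fun y => F (x + y) * heatKernel k y ε) √ε
  rw [finrank_euclideanSpace_fin, abs_of_pos (by positivity), smul_eq_mul,
    eq_inv_mul_iff_mul_eq₀ (by positivity), ← integral_const_mul] at hscale
  rw [← integral_add_left_eq_self _ x]
  simp only [sub_add_cancel_left, heatKernel_neg]
  rw [← hscale]
  refine integral_congr_ae (.of_forall fun z => ?_)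
  simp only [← sqrt_pow_mul_heatKernel_smul hk z hε]
  ring

theorem norm_add_sq_le_two_mul {V : Type*} [SeminormedAddCommGroup V] (x y : V) :
    ‖x + y‖ ^ 2 ≤ 2 * ‖x‖ ^ 2 + 2 * ‖y‖ ^ 2 := by
  rw [← mul_add]
  exact (pow_le_pow_left₀ (norm_nonneg _) (norm_add_le x y) 2).trans add_sq_le

theorem exp_sq_norm_mul_heatKernel_one_le (hk : 0 < k) (x z : EuclideanSpace ℝ (Fin d)) {c : ℝ}
    (hc0 : 0 ≤ c) (hc1 : c ≤ 1) :
    Real.exp (1 / (16 * k) * ‖x + c • z‖ ^ 2) * heatKernel k z 1 ≤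
      (4 * Real.pi * k) ^ (-(d : ℝ) / 2) * Real.exp (1 / (8 * k) * ‖x‖ ^ 2) *
        Real.exp (-(1 / (8 * k)) * ‖z‖ ^ 2) := by
  have hcz : ‖c • z‖ ≤ ‖z‖ := by
    rw [norm_smul, Real.norm_of_nonneg hc0]
    exact mul_le_of_le_one_left (norm_nonneg z) hc1
  have hsq : ‖x + c • z‖ ^ 2 ≤ 2 * ‖x‖ ^ 2 + 2 * ‖z‖ ^ 2 :=
    (norm_add_sq_le_two_mul x (c • z)).trans (by gcongr)
  calc Real.exp (1 / (16 * k) * ‖x + c • z‖ ^ 2) * heatKernel k z 1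
      ≤ Real.exp (1 / (16 * k) * (2 * ‖x‖ ^ 2 + 2 * ‖z‖ ^ 2)) * heatKernel k z 1 := by
        have := heatKernel_nonneg hk z 1
        gcongr
    _ = (4 * Real.pi * k) ^ (-(d : ℝ) / 2) *
          (Real.exp (1 / (16 * k) * (2 * ‖x‖ ^ 2 + 2 * ‖z‖ ^ 2)) *
            Real.exp (-(1 / (4 * k)) * ‖z‖ ^ 2)) := by
        rw [heatKernel_one]
        ring
    _ = _ := by
        rw [mul_assoc (_ ^ _), ← Real.exp_add, ← Real.exp_add]
        congr 2
        field_simp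
        ring

theorem tendsto_integral_mul_heatKernel (hk : 0 < k) {F : ℕ → EuclideanSpace ℝ (Fin d) → ℝ}
    {ε : ℕ → ℝ} (hε : ∀ n, 0 < ε n) (hε1 : ∀ n, ε n ≤ 1) {A L : ℝ}
    (x : EuclideanSpace ℝ (Fin d)) (hm : ∀ n, Measurable (F n))
    (hb : ∀ n y, |F n y| ≤ A * Real.exp (1 / (16 * k) * ‖y‖ ^ 2))
    (hL : ∀ z, Tendsto (fun n => F n (x + √(ε n) • z)) atTop (𝓝 L)) :
    Tendsto (fun n => ∫ y, F n y * heatKernel k (x - y) (ε n)) atTop (𝓝 L) := by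
  simp_rw [fun n => integral_mul_heatKernel hk (F n) x (hε n)]
  have hlim : ∫ z : EuclideanSpace ℝ (Fin d), L * heatKernel k z 1 = L := by
    rw [integral_const_mul, integral_heatKernel_one hk, mul_one]
  have hA : 0 ≤ A := by simpa using (abs_nonneg _).trans (hb 0 0)
  have hKm : Measurable fun z : EuclideanSpace ℝ (Fin d) => heatKernel k z 1 :=
    (measurable_heatKernel k).comp (measurable_id.prodMk measurable_const)
  rw [← hlim]
  refine tendsto_integral_of_dominated_convergence
    (fun z => A * ((4 * Real.pi * k) ^ (-(d : ℝ) / 2) * Real.exp (1 / (8 * k) * ‖x‖ ^ 2) *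
      Real.exp (-(1 / (8 * k)) * ‖z‖ ^ 2)))
    (fun n => (((hm n).comp (by fun_prop)).mul hKm).aestronglyMeasurable)
    (((integrable_exp_neg_mul_sq_norm (by positivity)).const_mul _).const_mul A)
    (fun n => .of_forall fun z => ?_) (.of_forall fun z => (hL z).mul_const _)
  have hK := heatKernel_nonneg hk z 1
  calc ‖F n (x + √(ε n) • z) * heatKernel k z 1‖
      = |F n (x + √(ε n) • z)| * heatKernel k z 1 := by
        rw [norm_mul, Real.norm_eq_abs, Real.norm_of_nonneg hK]
    _ ≤ A * Real.exp (1 / (16 * k) * ‖x + √(ε n) • z‖ ^ 2) * heatKernel k z 1 := by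
        gcongr
        exact hb n _
    _ ≤ _ := by
        rw [mul_assoc]
        exact mul_le_mul_of_nonneg_left (exp_sq_norm_mul_heatKernel_one_le hk x z
          (Real.sqrt_nonneg _) (Real.sqrt_le_one.2 (hε1 n))) hA

end HeatKernel

section Growth

theorem exp_le_exp_mul_exp_sq {α : ℝ} (hα : 0 < α) (r : ℝ) :
    Real.exp r ≤ Real.exp (1 / (2 * α)) * Real.exp (α / 2 * r ^ 2) := by
  have hsq : 0 ≤ (α * r - 1) ^ 2 / (2 * α) := by positivity
  have hexpand : (α * r - 1) ^ 2 / (2 * α) = 1 / (2 * α) + α / 2 * r ^ 2 - r := by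
    field_simp
    ring
  rw [← Real.exp_add, Real.exp_le_exp]
  linarith

theorem zpow_le_mul_exp_sq {α r : ℝ} (hα : 0 < α) (hr : 1 ≤ r) (m : ℤ) :
    r ^ m ≤ m.natAbs.factorial * Real.exp (1 / (2 * α)) * Real.exp (α / 2 * r ^ 2) :=
  calc r ^ m ≤ r ^ m.natAbs := by
        rw [← zpow_natCast]
        exact zpow_le_zpow_right₀ hr (by omega)
    _ ≤ m.natAbs.factorial * Real.exp r := by
        rw [← div_le_iff₀' (by positivity)]
        exact Real.pow_div_factorial_le_exp r (by linarith) m.natAbs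
    _ ≤ m.natAbs.factorial * (Real.exp (1 / (2 * α)) * Real.exp (α / 2 * r ^ 2)) := by
        gcongr
        exact exp_le_exp_mul_exp_sq hα r
    _ = _ := (mul_assoc _ _ _).symm

theorem exists_mul_rpow_le_add_mul_sq {a b β : ℝ} (ha : 0 ≤ a) (hb0 : 0 ≤ b) (hb2 : b < 2)
    (hβ : 0 < β) : ∃ c, ∀ r : ℝ, 0 < r → a * r ^ b ≤ c + β * r ^ 2 := by
  have hb : 0 < 2 - b := sub_pos.2 hb2
  -- Beyond `R` the quadratic term dominates: `R` solves `a R ^ b = β R ^ 2`.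
  let R := (a / β) ^ (1 / (2 - b))
  have : 0 ≤ R := by positivity
  refine ⟨a * R ^ b, fun r hr => ?_⟩
  rcases le_total r R with hrR | hRr
  · have : 0 ≤ β * r ^ 2 := by positivity
    have : a * r ^ b ≤ a * R ^ b := by gcongr
    linarith
  · have hRpow : R ^ (2 - b) = a / β := by
      rw [← Real.rpow_mul (by positivity), one_div_mul_cancel hb.ne', Real.rpow_one]
    have hle : a ≤ β * r ^ (2 - b) := by
      rw [← div_le_iff₀' hβ, ← hRpow]
      gcongr
    calc a * r ^ b ≤ β * r ^ (2 - b) * r ^ b := by gcongr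
      _ = β * r ^ 2 := by rw [mul_assoc, ← Real.rpow_add hr, sub_add_cancel, Real.rpow_two]
      _ ≤ a * R ^ b + β * r ^ 2 := le_add_of_nonneg_left (by positivity)

theorem exp_half_mul_exp_half (x y : ℝ) :
    Real.exp (x / 2 * y) * Real.exp (x / 2 * y) = Real.exp (x * y) := by
  rw [← Real.exp_add]
  ring_nf

theorem exists_zpow_mul_exp_rpow_le {C a b α : ℝ} (hC : 0 < C) (ha : 0 ≤ a) (hb0 : 0 ≤ b)
    (hb2 : b < 2) (m : ℤ) (hα : 0 < α) :
    ∃ A, 0 < A ∧ ∀ r : ℝ, 1 ≤ r → C * r ^ m * Real.exp (a * r ^ b) ≤ A * Real.exp (α * r ^ 2) := by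
  obtain ⟨c, hc⟩ := exists_mul_rpow_le_add_mul_sq ha hb0 hb2 (half_pos hα)
  refine ⟨C * (m.natAbs.factorial * Real.exp (1 / (2 * α))) * Real.exp c, by positivity,
    fun r hr => ?_⟩
  calc C * r ^ m * Real.exp (a * r ^ b)
      ≤ C * (m.natAbs.factorial * Real.exp (1 / (2 * α)) * Real.exp (α / 2 * r ^ 2)) *
          Real.exp (c + α / 2 * r ^ 2) := by
        gcongr
        · exact zpow_le_mul_exp_sq hα hr m
        · exact hc r (by linarith)
    _ = _ := by
        rw [Real.exp_add, ← exp_half_mul_exp_half α]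
        ring

section Radial

variable {E : Type*} [NormedAddCommGroup E] [NormedSpace ℝ E] {u : E → ℝ} {ξ : E}

theorem hasDerivAt_exp_sq_div_mul_comp_smul {ρ : ℝ} (c : ℝ) (hu : DifferentiableAt ℝ u (ρ • ξ)) :
    HasDerivAt (fun ρ => Real.exp (ρ ^ 2 / c) * u (ρ • ξ))
      (Real.exp (ρ ^ 2 / c) * (fderiv ℝ u (ρ • ξ) ξ + 2 * ρ / c * u (ρ • ξ))) ρ := by
  have hray : HasDerivAt (fun ρ : ℝ => ρ • ξ) ξ ρ := by
    simpa only [id, one_smul] using (hasDerivAt_id ρ).smul_const ξ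
  have hradial : HasDerivAt (fun ρ : ℝ => u (ρ • ξ)) (fderiv ℝ u (ρ • ξ) ξ) ρ :=
    hu.hasFDerivAt.comp_hasDerivAt ρ hray
  have hexp : HasDerivAt (fun ρ : ℝ => Real.exp (ρ ^ 2 / c)) _ ρ :=
    ((hasDerivAt_pow 2 ρ).div_const c).exp
  refine (hexp.fun_mul hradial).congr_deriv ?_
  simp
  ring

theorem abs_le_of_abs_fderiv_add_le {B R c r : ℝ} (hc : 0 ≤ c) (hR : 0 ≤ R) (hRr : R ≤ r)
    (hB : 0 ≤ B) (hu : ∀ ρ ∈ Icc R r, DifferentiableAt ℝ u (ρ • ξ))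
    (hbound : ∀ ρ ∈ Icc R r, |fderiv ℝ u (ρ • ξ) ξ + 2 * ρ / c * u (ρ • ξ)| ≤ B) :
    |u (r • ξ)| ≤ |u (R • ξ)| + B * r := by
  let E := Real.exp (r ^ 2 / c)
  have hexp_le : ∀ ρ ∈ Icc R r, Real.exp (ρ ^ 2 / c) ≤ E := fun ρ hρ =>
    Real.exp_le_exp.2 (div_le_div_of_nonneg_right
      (pow_le_pow_left₀ (hR.trans hρ.1) hρ.2 2) hc)
  have hmean : ‖E * u (r • ξ) - Real.exp (R ^ 2 / c) * u (R • ξ)‖ ≤ E * B * ‖r - R‖ := by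
    refine (convex_Icc R r).norm_image_sub_le_of_norm_hasDerivWithin_le
      (fun ρ hρ => (hasDerivAt_exp_sq_div_mul_comp_smul c (hu ρ hρ)).hasDerivWithinAt)
      (fun ρ hρ => ?_) (left_mem_Icc.2 hRr) (right_mem_Icc.2 hRr)
    rw [norm_mul, Real.norm_of_nonneg (Real.exp_pos _).le]
    exact mul_le_mul (hexp_le ρ hρ) (hbound ρ hρ) (abs_nonneg _) (Real.exp_pos _).le
  refine le_of_mul_le_mul_left ?_ (Real.exp_pos (r ^ 2 / c))
  calc E * |u (r • ξ)|
      = |E * u (r • ξ)| := by rw [abs_mul, abs_of_pos (Real.exp_pos _)]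
    _ ≤ |Real.exp (R ^ 2 / c) * u (R • ξ)| +
          |E * u (r • ξ) - Real.exp (R ^ 2 / c) * u (R • ξ)| := by
        linarith [abs_sub_abs_le_abs_sub (E * u (r • ξ)) (Real.exp (R ^ 2 / c) * u (R • ξ))]
    _ ≤ E * |u (R • ξ)| + E * B * r := by
        gcongr
        · rw [abs_mul, abs_of_pos (Real.exp_pos _)]
          gcongr
          exact hexp_le R (left_mem_Icc.2 hRr)
        · refine hmean.trans (mul_le_mul_of_nonneg_left ?_ (by positivity))
          rw [Real.norm_of_nonneg (sub_nonneg.2 hRr)]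
          linarith
    _ = E * (|u (R • ξ)| + B * r) := by ring

end Radial

variable {d : ℕ} {k : ℝ} {Ω : Set (EuclideanSpace ℝ (Fin d))}
  {v : EuclideanSpace ℝ (Fin d) → ℝ → ℝ}

/-- The growth condition controls the derivative of `exp (ρ ^ 2 / (4 k s)) v (ρ ξ, s)` in `ρ`;
integrating it from `R` to `r` cancels the exponential weight up to its value at `r`. -/
theorem GrowthCondition.exists_radial_bound (hk : 0 < k) (hb : Bornology.IsBounded Ω)
    (hv : ContDiffOn ℝ 2 (fun p : EuclideanSpace ℝ (Fin d) × ℝ => v p.1 p.2) (Ωᶜ ×ˢ Ici (0 : ℝ)))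
    (hg : GrowthCondition k v) {α : ℝ} (hα : 0 < α) :
    ∃ A R, 0 < A ∧ 0 < R ∧ closure Ω ⊆ Metric.ball 0 R ∧
      ∀ s > 0, ∀ ξ, ‖ξ‖ = 1 → ∀ r ≥ R,
        |v (r • ξ) s| ≤ |v (R • ξ) s| + A * Real.exp (α * r ^ 2) := by
  obtain ⟨r₀, C, a, b, m, -, hC, ha, hb0, hb2, hgr⟩ := hg
  obtain ⟨A, hA0, hA⟩ := exists_zpow_mul_exp_rpow_le hC ha hb0 hb2 m (half_pos hα)
  obtain ⟨R, hRmax, hR⟩ := hb.closure.subset_ball_lt (max r₀ 1) 0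
  have hr₀R : r₀ < R := (le_max_left _ _).trans_lt hRmax
  have h1R : 1 < R := (le_max_right _ _).trans_lt hRmax
  have hR0 : 0 < R := one_pos.trans h1R
  refine ⟨A * Real.exp (1 / (2 * α)), R, by positivity, hR0, hR, fun s hs ξ hξ r hRr => ?_⟩
  have hdiff : ∀ ρ ∈ Icc R r, DifferentiableAt ℝ (fun z => v z s) (ρ • ξ) := fun ρ hρ => by
    have hout : ρ • ξ ∉ closure Ω := fun hmem => by
      have := mem_ball_zero_iff.1 (hR hmem)
      rw [norm_smul, hξ, mul_one, Real.norm_of_nonneg (hR0.le.trans hρ.1)] at this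
      exact this.not_ge hρ.1
    exact ((hv.contDiffAt (prod_mem_nhds (compl_mem_nhds_of_notMem_closure hout)
      (Ici_mem_nhds hs))).differentiableAt two_ne_zero).comp (ρ • ξ) (f := fun z => (z, s))
      (differentiableAt_id.prodMk (differentiableAt_const s))
  have hbound : ∀ ρ ∈ Icc R r, |fderiv ℝ (fun z => v z s) (ρ • ξ) ξ +
      2 * ρ / (4 * k * s) * v (ρ • ξ) s| ≤ A * Real.exp (α / 2 * r ^ 2) := fun ρ hρ => by
    have hρ0 : 0 ≤ ρ := hR0.le.trans hρ.1
    refine ((hgr ρ (hr₀R.trans_le hρ.1) s hs ξ hξ).trans (hA ρ (h1R.le.trans hρ.1))).trans ?_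
    have := hρ.2
    gcongr
  calc |v (r • ξ) s|
      ≤ |v (R • ξ) s| + A * Real.exp (α / 2 * r ^ 2) * r :=
        abs_le_of_abs_fderiv_add_le (by positivity) hR0.le hRr (by positivity) hdiff hbound
    _ ≤ |v (R • ξ) s| + A * Real.exp (α / 2 * r ^ 2) *
          (Real.exp (1 / (2 * α)) * Real.exp (α / 2 * r ^ 2)) := by
        gcongr
        linarith [Real.add_one_le_exp r, exp_le_exp_mul_exp_sq hα r]
    _ = _ := by
        rw [← exp_half_mul_exp_half α]
        ring

theorem GrowthCondition.exists_bound (hk : 0 < k) (hΩ : IsOpen Ω) (hb : Bornology.IsBounded Ω)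
    (hv : ContDiffOn ℝ 2 (fun p : EuclideanSpace ℝ (Fin d) × ℝ => v p.1 p.2) (Ωᶜ ×ˢ Ici (0 : ℝ)))
    (hg : GrowthCondition k v) (T : ℝ) {α : ℝ} (hα : 0 < α) :
    ∃ A, 0 < A ∧ ∀ y ∈ Ωᶜ, ∀ s, 0 < s → s ≤ T → |v y s| ≤ A * Real.exp (α * ‖y‖ ^ 2) := by
  obtain ⟨A, R, hA, hR, hΩR, hradial⟩ := hg.exists_radial_bound hk hb hv hα
  have hK : IsCompact ((Ωᶜ ∩ Metric.closedBall 0 R) ×ˢ Icc 0 T) :=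
    ((isCompact_closedBall 0 R).inter_left hΩ.isClosed_compl).prod isCompact_Icc
  obtain ⟨M, hM⟩ := hK.exists_bound_of_continuousOn (f := fun p => v p.1 p.2)
    (hv.continuousOn.mono (prod_mono inter_subset_left Icc_subset_Ici_self))
  refine ⟨|M| + A, by positivity, fun y hy s hs hsT => ?_⟩
  have hnear : ∀ z ∈ Ωᶜ, ‖z‖ ≤ R → |v z s| ≤ |M| := fun z hz hzR =>
    (hM (z, s) ⟨⟨hz, mem_closedBall_zero_iff.2 hzR⟩, hs.le, hsT⟩).trans (le_abs_self M)
  have hexp : 1 ≤ Real.exp (α * ‖y‖ ^ 2) := Real.one_le_exp (by positivity)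
  suffices |v y s| ≤ |M| + A * Real.exp (α * ‖y‖ ^ 2) by
    nlinarith [abs_nonneg M]
  rcases le_or_gt ‖y‖ R with hyR | hyR
  · exact (hnear y hy hyR).trans (le_add_of_nonneg_right (by positivity))
  have hy0 : ‖y‖ ≠ 0 := (hR.trans hyR).ne'
  let ξ := ‖y‖⁻¹ • y
  have hξ : ‖ξ‖ = 1 := by rw [norm_smul, norm_inv, norm_norm, inv_mul_cancel₀ hy0]
  have hRξ : ‖R • ξ‖ = R := by rw [norm_smul, hξ, mul_one, Real.norm_of_nonneg hR.le]
  have hRξΩ : R • ξ ∈ Ωᶜ := fun hmem =>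
    (mem_ball_zero_iff.1 (hΩR (subset_closure hmem))).ne hRξ
  have hyξ := hradial s hs ξ hξ ‖y‖ hyR.le
  rw [smul_inv_smul₀ hy0] at hyξ
  linarith [hnear _ hRξΩ hRξ.le]

end Growth

/-- A solution of the heat equation in the exterior of a bounded Lipschitz domain, of class `C²` up
to the boundary and with vanishing initial value. -/
structure IsExteriorHeatSolution {d : ℕ} (k : ℝ) (Ω : Set (EuclideanSpace ℝ (Fin d)))
    (v : EuclideanSpace ℝ (Fin d) → ℝ → ℝ) : Prop where
  pos : 0 < k
  isOpen : IsOpen Ω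
  isBounded : Bornology.IsBounded Ω
  lipschitz : HasLipschitzBoundary Ω
  contDiffOn : ContDiffOn ℝ 2 (fun p : EuclideanSpace ℝ (Fin d) × ℝ => v p.1 p.2)
    (Ωᶜ ×ˢ Ici (0 : ℝ))
  heat : ∀ x ∉ closure Ω, ∀ t > 0, deriv (fun s => v x s) t = k * Δ (fun z => v z t) x
  initial_eq_zero : ∀ x ∉ Ω, v x 0 = 0

/-- The joint space-time derivative of a field on `Ωᶜ × [0, ∞)`, one-sided at the boundary. -/
noncomputable def spaceTimeFDeriv {d : ℕ} (Ω : Set (EuclideanSpace ℝ (Fin d)))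
    (v : EuclideanSpace ℝ (Fin d) → ℝ → ℝ) (p : EuclideanSpace ℝ (Fin d) × ℝ) :
    EuclideanSpace ℝ (Fin d) × ℝ →L[ℝ] ℝ :=
  fderivWithin ℝ (fun p : EuclideanSpace ℝ (Fin d) × ℝ => v p.1 p.2) (Ωᶜ ×ˢ Ici (0 : ℝ)) p

namespace IsExteriorHeatSolution

variable {d : ℕ} {k : ℝ} {Ω : Set (EuclideanSpace ℝ (Fin d))}
  {v : EuclideanSpace ℝ (Fin d) → ℝ → ℝ} (h : IsExteriorHeatSolution k Ω v)

include h

theorem contDiffOn_slice {s : ℝ} (hs : 0 ≤ s) : ContDiffOn ℝ 2 (fun z => v z s) Ωᶜ :=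
  h.contDiffOn.comp (f := fun z => (z, s)) (contDiff_id.prodMk contDiff_const).contDiffOn
    fun _ hz => ⟨hz, hs⟩

theorem continuousOn :
    ContinuousOn (fun p : EuclideanSpace ℝ (Fin d) × ℝ => v p.1 p.2) (Ωᶜ ×ˢ Ici (0 : ℝ)) :=
  h.contDiffOn.continuousOn

theorem hasFDerivWithinAt {p : EuclideanSpace ℝ (Fin d) × ℝ} (hp : p ∈ Ωᶜ ×ˢ Ici (0 : ℝ)) :
    HasFDerivWithinAt (fun p : EuclideanSpace ℝ (Fin d) × ℝ => v p.1 p.2)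
      (spaceTimeFDeriv Ω v p) (Ωᶜ ×ˢ Ici (0 : ℝ)) p :=
  (h.contDiffOn.differentiableOn two_ne_zero p hp).hasFDerivWithinAt

theorem continuousOn_spaceTimeFDeriv_apply (c : EuclideanSpace ℝ (Fin d) × ℝ) :
    ContinuousOn (fun p => spaceTimeFDeriv Ω v p c) (Ωᶜ ×ˢ Ici (0 : ℝ)) :=
  (h.contDiffOn.continuousOn_fderivWithin
    (h.lipschitz.uniqueDiffOn_compl.prod (uniqueDiffOn_Ici 0)) one_le_two).clm_apply
    continuousOn_const

theorem fderivWithin_slice_apply {y : EuclideanSpace ℝ (Fin d)} {s : ℝ} (hy : y ∈ Ωᶜ)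
    (hs : 0 ≤ s) (c : EuclideanSpace ℝ (Fin d)) :
    fderivWithin ℝ (fun z => v z s) Ωᶜ y c = spaceTimeFDeriv Ω v (y, s) (c, 0) := by
  have hmaps : MapsTo (fun z => (z, s)) Ωᶜ (Ωᶜ ×ˢ Ici (0 : ℝ)) := fun _ hz => ⟨hz, hs⟩
  have hslice : HasFDerivWithinAt (fun z => v z s)
      ((spaceTimeFDeriv Ω v (y, s)).comp (ContinuousLinearMap.inl ℝ _ ℝ)) Ωᶜ y :=
    (h.hasFDerivWithinAt (p := (y, s)) ⟨hy, hs⟩).comp y (f := fun z => (z, s))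
      (hasFDerivAt_prodMk_left y s).hasFDerivWithinAt hmaps
  rw [hslice.fderivWithin (h.lipschitz.uniqueDiffOn_compl y hy)]
  rfl

theorem hasDerivAt_time {y : EuclideanSpace ℝ (Fin d)} {s : ℝ} (hy : y ∈ Ωᶜ) (hs : 0 < s) :
    HasDerivAt (fun s => v y s) (spaceTimeFDeriv Ω v (y, s) (0, 1)) s :=
  ((h.hasFDerivWithinAt (p := (y, s)) ⟨hy, hs.le⟩).comp_hasDerivWithinAt s
    ((hasDerivAt_const s y).prodMk (hasDerivAt_id s)).hasDerivWithinAt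
    fun _ hr => ⟨hy, hr⟩).hasDerivAt (Ici_mem_nhds hs)

theorem mul_laplacian_eq {y : EuclideanSpace ℝ (Fin d)} {s : ℝ} (hy : y ∉ closure Ω)
    (hs : 0 < s) : k * Δ (fun z => v z s) y = spaceTimeFDeriv Ω v (y, s) (0, 1) := by
  rw [← h.heat y hy s hs]
  exact (h.hasDerivAt_time (compl_closure_subset_compl Ω hy) hs).deriv

theorem layerIntegrand_eq_sum (x : EuclideanSpace ℝ (Fin d)) {y : EuclideanSpace ℝ (Fin d)}
    {s t : ℝ} (hy : y ∈ Ωᶜ) (hs : 0 ≤ s) (hst : s ≤ t)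
    (b : OrthonormalBasis (Fin d) ℝ (EuclideanSpace ℝ (Fin d))) :
    layerIntegrand k Ω v x t s y = ∑ i,
      ((t - s) * spaceTimeFDeriv Ω v (y, s) (b i, 0) - v y s * inner ℝ (x - y) (b i) / (2 * k)) *
        (heatKernel k (x - y) (t - s) / (t - s)) * inner ℝ (outwardNormal Ω y) (b i) := by
  have hk := h.pos
  rw [layerIntegrand, ← sum_apply_orthonormalBasis_mul_inner b _ (outwardNormal Ω y),
    ← sum_apply_orthonormalBasis_mul_inner b (fderiv ℝ _ y) (outwardNormal Ω y),
    Finset.sum_mul, Finset.mul_sum, ← Finset.sum_sub_distrib]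
  refine Finset.sum_congr rfl fun i _ => ?_
  rw [h.fderivWithin_slice_apply hy hs]
  rcases hst.lt_or_eq with hlt | rfl
  · have hτ : 0 < t - s := sub_pos.2 hlt
    rw [fderiv_heatKernel_apply hk x y _ hτ]
    field_simp
  · simp [heatKernel_zero_right]

end IsExteriorHeatSolution

section LayerIntegrability

variable {d : ℕ} {k t : ℝ} {Ω : Set (EuclideanSpace ℝ (Fin d))}

theorem restrict_prod_surfaceMeasure [SFinite (surfaceMeasure Ω)] (I : Set ℝ) :
    (volume.restrict I).prod (surfaceMeasure Ω) =
      ((volume : Measure ℝ).prod (surfaceMeasure Ω)).restrict (I ×ˢ frontier Ω) := by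
  have hsurf : (surfaceMeasure Ω).restrict (frontier Ω) = surfaceMeasure Ω := by
    rw [surfaceMeasure, Measure.restrict_restrict isClosed_frontier.measurableSet, inter_self]
  conv_lhs => rw [← hsurf]
  rw [Measure.prod_restrict]

theorem ae_mem_Ioc_prod_frontier (Ω : Set (EuclideanSpace ℝ (Fin d)))
    [SFinite (surfaceMeasure Ω)] (t : ℝ) :
    ∀ᵐ p ∂(volume.restrict (Ioc 0 t)).prod (surfaceMeasure Ω), p ∈ Ioc 0 t ×ˢ frontier Ω := by
  rw [restrict_prod_surfaceMeasure]
  exact ae_restrict_mem (measurableSet_Ioc.prod isClosed_frontier.measurableSet)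

theorem memLp_top_of_continuousOn_frontier [SFinite (surfaceMeasure Ω)]
    (hb : Bornology.IsBounded Ω) {f : EuclideanSpace ℝ (Fin d) × ℝ → ℝ}
    (hf : ContinuousOn f (frontier Ω ×ˢ Icc 0 t)) :
    MemLp (fun p : ℝ × EuclideanSpace ℝ (Fin d) => f (p.2, p.1)) ∞
      ((volume.restrict (Ioc 0 t)).prod (surfaceMeasure Ω)) := by
  have hmaps : MapsTo Prod.swap (Ioc 0 t ×ˢ frontier Ω) (frontier Ω ×ˢ Icc 0 t) :=
    fun p hp => ⟨hp.2, Ioc_subset_Icc_self hp.1⟩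
  have hmeas : AEStronglyMeasurable (fun p : ℝ × EuclideanSpace ℝ (Fin d) => f (p.2, p.1))
      ((volume.restrict (Ioc 0 t)).prod (surfaceMeasure Ω)) := by
    rw [restrict_prod_surfaceMeasure]
    exact (hf.comp continuous_swap.continuousOn hmaps).aestronglyMeasurable
      (measurableSet_Ioc.prod isClosed_frontier.measurableSet)
  obtain ⟨C, hC⟩ := ((isCompact_frontier_of_isBounded hb).prod
    isCompact_Icc).exists_bound_of_continuousOn hf
  refine memLp_top_of_bound hmeas C ?_
  filter_upwards [ae_mem_Ioc_prod_frontier Ω t] with p hp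
  exact hC _ (hmaps hp)

theorem memLp_top_inner_outwardNormal (hΩ : IsOpen Ω) (hb : Bornology.IsBounded Ω)
    (hl : HasLipschitzBoundary Ω) (c : EuclideanSpace ℝ (Fin d)) :
    MemLp (fun p : ℝ × EuclideanSpace ℝ (Fin d) => inner ℝ (outwardNormal Ω p.2) c) ∞
      ((volume.restrict (Ioc 0 t)).prod (surfaceMeasure Ω)) := by
  have := isFiniteMeasure_surfaceMeasure hΩ hb hl
  refine memLp_top_of_bound ((aestronglyMeasurable_outwardNormal hΩ hb hl).comp_snd.inner
    aestronglyMeasurable_const) ‖c‖ (.of_forall fun p => ?_)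
  exact (norm_inner_le_norm _ _).trans
    (mul_le_of_le_one_left (norm_nonneg c) (norm_outwardNormal_le Ω p.2))

theorem memLp_top_heatKernel_div [SFinite (surfaceMeasure Ω)] (hk : 0 < k)
    {x : EuclideanSpace ℝ (Fin d)} (hx : x ∉ frontier Ω) :
    MemLp (fun p : ℝ × EuclideanSpace ℝ (Fin d) => heatKernel k (x - p.2) (t - p.1) / (t - p.1)) ∞
      ((volume.restrict (Ioc 0 t)).prod (surfaceMeasure Ω)) := by
  obtain ⟨δ, hδ, hball⟩ := Metric.isOpen_iff.1 isClosed_frontier.isOpen_compl x hx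
  obtain ⟨C, hC, hbound⟩ := exists_heatKernel_div_le (d := d) hk hδ
  have hmeas : Measurable fun p : ℝ × EuclideanSpace ℝ (Fin d) =>
      heatKernel k (x - p.2) (t - p.1) :=
    (measurable_heatKernel k).comp
      ((measurable_const.sub measurable_snd).prodMk (measurable_const.sub measurable_fst))
  refine memLp_top_of_bound (hmeas.div (by fun_prop)).aestronglyMeasurable C ?_
  filter_upwards [ae_mem_Ioc_prod_frontier Ω t] with ⟨s, y⟩ ⟨⟨_, hst⟩, hy⟩
  rcases hst.lt_or_eq with hlt | rfl
  · have hτ : 0 < t - s := sub_pos.2 hlt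
    have hfar : δ ≤ ‖x - y‖ := by
      rw [← dist_eq_norm, dist_comm]
      exact not_lt.1 fun hlt => hball hlt hy
    rw [Real.norm_of_nonneg (div_nonneg (heatKernel_nonneg hk _ _) hτ.le)]
    refine (hbound (t - s) (t - s) hτ le_rfl (x - y) hfar).trans
      (mul_le_of_le_one_right hC.le (Real.exp_le_one_iff.2 (neg_nonpos.2 (by positivity))))
  · simpa using hC.le

theorem IsExteriorHeatSolution.integrable_layerIntegrand
    {v : EuclideanSpace ℝ (Fin d) → ℝ → ℝ} (h : IsExteriorHeatSolution k Ω v)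
    {x : EuclideanSpace ℝ (Fin d)} (hx : x ∉ frontier Ω) (t : ℝ) :
    Integrable (fun p : ℝ × EuclideanSpace ℝ (Fin d) => layerIntegrand k Ω v x t p.1 p.2)
      ((volume.restrict (Ioc 0 t)).prod (surfaceMeasure Ω)) := by
  have := isFiniteMeasure_surfaceMeasure h.isOpen h.isBounded h.lipschitz
  have hsub : frontier Ω ×ˢ Icc 0 t ⊆ Ωᶜ ×ˢ Ici (0 : ℝ) :=
    prod_mono (frontier_subset_compl h.isOpen) Icc_subset_Ici_self
  let b := EuclideanSpace.basisFun (Fin d) ℝ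
  let coeff (i : Fin d) (p : EuclideanSpace ℝ (Fin d) × ℝ) : ℝ :=
    (t - p.2) * spaceTimeFDeriv Ω v p (b i, 0) - v p.1 p.2 * inner ℝ (x - p.1) (b i) / (2 * k)
  have hcoeff : ∀ i, ContinuousOn (coeff i) (frontier Ω ×ˢ Icc 0 t) := fun i =>
    (ContinuousOn.mul (by fun_prop)
      ((h.continuousOn_spaceTimeFDeriv_apply (b i, 0)).mono hsub)).sub
        (((h.continuousOn.mono hsub).mul (by fun_prop)).div_const (2 * k))
  have hfi : Integrable (fun p : ℝ × EuclideanSpace ℝ (Fin d) => ∑ i, coeff i (p.2, p.1) *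
      (heatKernel k (x - p.2) (t - p.1) / (t - p.1)) * inner ℝ (outwardNormal Ω p.2) (b i))
      ((volume.restrict (Ioc 0 t)).prod (surfaceMeasure Ω)) :=
    integrable_finsetSum _ fun i _ => MemLp.integrable (q := ∞) le_top
      ((memLp_top_inner_outwardNormal h.isOpen h.isBounded h.lipschitz (b i)).mul'
        ((memLp_top_heatKernel_div h.pos hx).mul' (p := ∞) (q := ∞) (r := ∞)
          (memLp_top_of_continuousOn_frontier h.isBounded (hcoeff i))))
  refine hfi.congr ?_
  filter_upwards [ae_mem_Ioc_prod_frontier Ω t] with p hp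
  exact (h.layerIntegrand_eq_sum x (frontier_subset_compl h.isOpen hp.2) hp.1.1.le hp.1.2 b).symm

end LayerIntegrability

section Cutoff

variable {d : ℕ} {k : ℝ} {χ : EuclideanSpace ℝ (Fin d) → ℝ}

/-- The error `(∂ₛ + k Δ) (χ K(x - ·, t - s))` at elapsed time `τ = t - s` that a cutoff function
`χ` introduces into the adjoint heat equation for `K(x - ·, t - s)`. -/
noncomputable def cutoffError (k : ℝ) (χ : EuclideanSpace ℝ (Fin d) → ℝ)
    (x : EuclideanSpace ℝ (Fin d)) (τ : ℝ) (y : EuclideanSpace ℝ (Fin d)) : ℝ :=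
  heatKernel k (x - y) τ / τ * fderiv ℝ χ y (x - y) + k * heatKernel k (x - y) τ * Δ χ y

theorem mul_laplacian_mul_heatKernel_sub (hk : 0 < k) (hχ : ContDiff ℝ 2 χ)
    (x y : EuclideanSpace ℝ (Fin d)) {τ : ℝ} (hτ : 0 < τ) :
    k * Δ (fun z => χ z * heatKernel k (x - z) τ) y - χ y * (k * heatKernelLaplacian k (x - y) τ) =
      cutoffError k χ x τ y := by
  let b := EuclideanSpace.basisFun (Fin d) ℝ
  have hcross : ∑ i, fderiv ℝ χ y (b i) * fderiv ℝ (fun z => heatKernel k (x - z) τ) y (b i) =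
      heatKernel k (x - y) τ / (2 * k * τ) * fderiv ℝ χ y (x - y) := by
    rw [← sum_apply_orthonormalBasis_mul_inner b (fderiv ℝ χ y) (x - y), Finset.mul_sum]
    refine Finset.sum_congr rfl fun i _ => ?_
    rw [fderiv_heatKernel_apply hk x y _ hτ]
    ring
  rw [laplacian_mul b hχ (contDiff_heatKernel k x τ), hcross, laplacian_heatKernel hk x y hτ,
    cutoffError]
  field_simp
  ring

theorem continuous_cutoffError (hχ : ContDiff ℝ 2 χ) (x : EuclideanSpace ℝ (Fin d)) (τ : ℝ) :
    Continuous (cutoffError k χ x τ) := by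
  have hK : Continuous fun y => heatKernel k (x - y) τ :=
    (contDiff_heatKernel k x τ (n := 0)).continuous
  have hgrad : Continuous (fderiv ℝ χ) := hχ.continuous_fderiv two_ne_zero
  have hlap : Continuous (Δ χ) := continuous_laplacian hχ
  unfold cutoffError
  fun_prop

theorem cutoffError_eq_zero_of_notMem_tsupport (x : EuclideanSpace ℝ (Fin d)) (τ : ℝ)
    {y : EuclideanSpace ℝ (Fin d)} (hy : y ∉ tsupport χ) : cutoffError k χ x τ y = 0 := by
  simp [cutoffError, fderiv_of_notMem_tsupport ℝ hy, laplacian_eq_zero_of_notMem_tsupport hy]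

end Cutoff

/-- The derivative with respect to `s` of `v y s * (χ y * K (x - y, t - s))`, at `p = (y, s)`. -/
noncomputable def cutoffDensity {d : ℕ} (k : ℝ) (Ω : Set (EuclideanSpace ℝ (Fin d)))
    (v : EuclideanSpace ℝ (Fin d) → ℝ → ℝ) (χ : EuclideanSpace ℝ (Fin d) → ℝ)
    (x : EuclideanSpace ℝ (Fin d)) (t : ℝ) (p : EuclideanSpace ℝ (Fin d) × ℝ) : ℝ :=
  spaceTimeFDeriv Ω v p (0, 1) * (χ p.1 * heatKernel k (x - p.1) (t - p.2)) +
    v p.1 p.2 * (χ p.1 * -(k * heatKernelLaplacian k (x - p.1) (t - p.2)))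

theorem cutoffDensity_eq_zero_of_notMem_tsupport {d : ℕ} (k : ℝ)
    (Ω : Set (EuclideanSpace ℝ (Fin d))) (v : EuclideanSpace ℝ (Fin d) → ℝ → ℝ)
    {χ : EuclideanSpace ℝ (Fin d) → ℝ} (x : EuclideanSpace ℝ (Fin d)) (t : ℝ)
    {p : EuclideanSpace ℝ (Fin d) × ℝ} (hp : p.1 ∉ tsupport χ) :
    cutoffDensity k Ω v χ x t p = 0 := by
  simp [cutoffDensity, image_eq_zero_of_notMem_tsupport hp]

namespace IsExteriorHeatSolution

variable {d : ℕ} {k : ℝ} {Ω : Set (EuclideanSpace ℝ (Fin d))}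
  {v : EuclideanSpace ℝ (Fin d) → ℝ → ℝ} {χ : EuclideanSpace ℝ (Fin d) → ℝ}
  (h : IsExteriorHeatSolution k Ω v)

include h

theorem continuousOn_cutoffDensity (hχ : Continuous χ) (x : EuclideanSpace ℝ (Fin d))
    {t T : ℝ} (hT : T < t) : ContinuousOn (cutoffDensity k Ω v χ x t) (Ωᶜ ×ˢ Icc 0 T) := by
  have hk := h.pos
  have hsub : Ωᶜ ×ˢ Icc 0 T ⊆ Ωᶜ ×ˢ Ici (0 : ℝ) := prod_mono_right Icc_subset_Ici_self
  have hK : ContinuousOn (fun p : EuclideanSpace ℝ (Fin d) × ℝ =>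
      heatKernel k (x - p.1) (t - p.2)) (Ωᶜ ×ˢ Icc 0 T) :=
    (continuousOn_heatKernel_sub hk x t).mono fun p hp => hp.2.2.trans_lt hT
  have hne : ∀ p ∈ Ωᶜ ×ˢ Icc 0 T, 2 * k * (t - p.2) ≠ 0 := fun p hp => by
    have : 0 < t - p.2 := by linarith [hp.2.2]
    positivity
  have hlap : ContinuousOn (fun p : EuclideanSpace ℝ (Fin d) × ℝ =>
      heatKernelLaplacian k (x - p.1) (t - p.2)) (Ωᶜ ×ˢ Icc 0 T) :=
    (((ContinuousOn.div (by fun_prop) (by fun_prop) hne).add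
      (ContinuousOn.div (by fun_prop) (by fun_prop) fun p hp => pow_ne_zero 2 (hne p hp)))).mul hK
  have hcut : ContinuousOn (fun p : EuclideanSpace ℝ (Fin d) × ℝ => χ p.1) (Ωᶜ ×ˢ Icc 0 T) :=
    (hχ.comp continuous_fst).continuousOn
  exact (((h.continuousOn_spaceTimeFDeriv_apply (0, 1)).mono hsub).mul (hcut.mul hK)).add
    ((h.continuousOn.mono hsub).mul (hcut.mul (continuousOn_const.mul hlap).neg))

theorem integrable_cutoffDensity (hχ : Continuous χ) (hχs : HasCompactSupport χ)
    (x : EuclideanSpace ℝ (Fin d)) {t T : ℝ} (hT : T < t) :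
    Integrable (cutoffDensity k Ω v χ x t)
      ((volume.restrict (closure Ω)ᶜ).prod (volume.restrict (Ioc 0 T))) := by
  have hfi : IntegrableOn (cutoffDensity k Ω v χ x t) (Ωᶜ ×ˢ Icc 0 T)
      ((volume : Measure (EuclideanSpace ℝ (Fin d))).prod (volume : Measure ℝ)) :=
    integrableOn_of_continuousOn_of_eq_zero_off_compact
      (h.isOpen.isClosed_compl.prod isClosed_Icc) (hχs.isCompact.prod isCompact_Icc)
      (h.continuousOn_cutoffDensity hχ x hT) fun p hp hpK =>
        cutoffDensity_eq_zero_of_notMem_tsupport k Ω v x t fun hm => hpK ⟨hm, hp.2⟩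
  rw [Measure.prod_restrict]
  exact hfi.mono_set (prod_mono (compl_closure_subset_compl Ω) Ioc_subset_Icc_self)

theorem integrableOn_cutoffDensity_slice (hχ : Continuous χ) (hχs : HasCompactSupport χ)
    (x : EuclideanSpace ℝ (Fin d)) {t s : ℝ} (hs0 : 0 ≤ s) (hs : s < t) :
    IntegrableOn (fun y => cutoffDensity k Ω v χ x t (y, s)) (closure Ω)ᶜ :=
  (integrableOn_of_continuousOn_of_eq_zero_off_compact h.isOpen.isClosed_compl hχs.isCompact
    ((h.continuousOn_cutoffDensity hχ x hs).comp (f := fun y => (y, s)) (by fun_prop)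
      fun _ hy => ⟨hy, hs0, le_rfl⟩)
    fun _ _ hy => cutoffDensity_eq_zero_of_notMem_tsupport k Ω v x t hy).mono_set
    (compl_closure_subset_compl Ω)

theorem integrableOn_mul_cutoffError (hχ : ContDiff ℝ 2 χ) (hχs : HasCompactSupport χ)
    (x : EuclideanSpace ℝ (Fin d)) {s : ℝ} (hs : 0 ≤ s) (τ : ℝ) :
    IntegrableOn (fun y => v y s * cutoffError k χ x τ y) (closure Ω)ᶜ :=
  (integrableOn_of_continuousOn_of_eq_zero_off_compact h.isOpen.isClosed_compl hχs.isCompact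
    ((h.contDiffOn_slice hs).continuousOn.mul (continuous_cutoffError hχ x τ).continuousOn)
    fun y _ hy => mul_eq_zero_of_right (v y s)
      (cutoffError_eq_zero_of_notMem_tsupport x τ hy)).mono_set
    (compl_closure_subset_compl Ω)

theorem integral_cutoffDensity_time (hχ : Continuous χ) (x : EuclideanSpace ℝ (Fin d))
    {t T : ℝ} (hT0 : 0 ≤ T) (hT : T < t) {y : EuclideanSpace ℝ (Fin d)} (hy : y ∈ Ωᶜ) :
    ∫ s in (0 : ℝ)..T, cutoffDensity k Ω v χ x t (y, s) =
      v y T * (χ y * heatKernel k (x - y) (t - T)) := by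
  have hline : ContinuousOn (fun s : ℝ => (y, s)) (Icc 0 T) := by fun_prop
  have hv : ContinuousOn (fun s => v y s) (Icc 0 T) :=
    h.continuousOn.comp hline fun s hs => ⟨hy, hs.1⟩
  have hK : ContinuousOn (fun s => heatKernel k (x - y) (t - s)) (Icc 0 T) :=
    (continuousOn_heatKernel_sub h.pos x t).comp hline fun s hs => hs.2.trans_lt hT
  have hderiv : ∀ s ∈ Ioo 0 T, HasDerivAt (fun s => v y s * (χ y * heatKernel k (x - y) (t - s)))
      (cutoffDensity k Ω v χ x t (y, s)) s := fun s hs =>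
    (h.hasDerivAt_time hy hs.1).fun_mul
      ((hasDerivAt_heatKernel_sub h.pos (x - y) (hs.2.trans hT)).const_mul (χ y))
  have hfi : IntervalIntegrable (fun s => cutoffDensity k Ω v χ x t (y, s)) volume 0 T :=
    ((h.continuousOn_cutoffDensity hχ x hT).comp hline
      fun s hs => ⟨hy, hs⟩).intervalIntegrable_of_Icc hT0
  rw [intervalIntegral.integral_eq_sub_of_hasDerivAt_of_le hT0
    (hv.fun_mul (continuousOn_const.fun_mul hK)) hderiv hfi, h.initial_eq_zero y hy, zero_mul,
    sub_zero]

theorem integral_mul_cutoff_mul_heatKernel (hχ : Continuous χ) (hχs : HasCompactSupport χ)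
    (x : EuclideanSpace ℝ (Fin d)) {t T : ℝ} (hT0 : 0 ≤ T) (hT : T < t) :
    ∫ y in (closure Ω)ᶜ, v y T * (χ y * heatKernel k (x - y) (t - T)) =
      ∫ s in (0 : ℝ)..T, ∫ y in (closure Ω)ᶜ, cutoffDensity k Ω v χ x t (y, s) := by
  rw [intervalIntegral.integral_of_le hT0, ← integral_integral_swap (f := fun y s =>
    cutoffDensity k Ω v χ x t (y, s)) (h.integrable_cutoffDensity hχ hχs x hT)]
  refine setIntegral_congr_fun isClosed_closure.isOpen_compl.measurableSet fun y hy => ?_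
  rw [← intervalIntegral.integral_of_le hT0]
  exact (h.integral_cutoffDensity_time hχ x hT0 hT (compl_closure_subset_compl Ω hy)).symm

theorem cutoffDensity_sub_mul_cutoffError (hχ : ContDiff ℝ 2 χ) (x : EuclideanSpace ℝ (Fin d))
    {t s : ℝ} (hs0 : 0 < s) (hs : s < t) {y : EuclideanSpace ℝ (Fin d)} (hy : y ∉ closure Ω) :
    cutoffDensity k Ω v χ x t (y, s) - v y s * cutoffError k χ x (t - s) y =
      k * ((χ y * heatKernel k (x - y) (t - s)) * Δ (fun z => v z s) y -
        v y s * Δ (fun z => χ z * heatKernel k (x - z) (t - s)) y) := by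
  rw [cutoffDensity, ← mul_laplacian_mul_heatKernel_sub h.pos hχ x y (sub_pos.2 hs),
    ← h.mul_laplacian_eq hy hs0]
  ring

theorem integral_cutoffDensity_space (hχ : ContDiff ℝ 2 χ) (hχs : HasCompactSupport χ)
    (hχ1 : ∀ y ∈ frontier Ω, χ =ᶠ[𝓝 y] 1)
    (x : EuclideanSpace ℝ (Fin d)) {t s : ℝ} (hs0 : 0 < s) (hs : s < t) :
    ∫ y in (closure Ω)ᶜ, cutoffDensity k Ω v χ x t (y, s) =
      -k * (∫ y, layerIntegrand k Ω v x t s y ∂surfaceMeasure Ω) +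
        ∫ y in (closure Ω)ᶜ, v y s * cutoffError k χ x (t - s) y := by
  let w : EuclideanSpace ℝ (Fin d) → ℝ := fun z => χ z * heatKernel k (x - z) (t - s)
  have hw : ContDiff ℝ 2 w := hχ.mul (contDiff_heatKernel k x (t - s))
  have hws : HasCompactSupport w := hχs.mul_right
  have hsurf : ∫ y, (fderivWithin ℝ (fun z => v z s) Ωᶜ y (outwardNormal Ω y) * w y
        - v y s * fderiv ℝ w y (outwardNormal Ω y)) ∂surfaceMeasure Ω =
      ∫ y, layerIntegrand k Ω v x t s y ∂surfaceMeasure Ω := by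
    refine integral_congr_ae ?_
    filter_upwards [ae_surfaceMeasure_mem_frontier Ω] with y hy
    have hw_eq : w =ᶠ[𝓝 y] fun z => heatKernel k (x - z) (t - s) := by
      filter_upwards [hχ1 y hy] with z hz
      simp [w, hz]
    rw [layerIntegrand, hw_eq.fderiv_eq, hw_eq.eq_of_nhds]
  have hgreen : ∫ y in (closure Ω)ᶜ,
      (cutoffDensity k Ω v χ x t (y, s) - v y s * cutoffError k χ x (t - s) y) =
        k * -∫ y, layerIntegrand k Ω v x t s y ∂surfaceMeasure Ω := by
    rw [← hsurf, ← green_second_identity_exterior h.isOpen h.isBounded h.lipschitz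
      (h.contDiffOn_slice hs0.le) hw hws, ← integral_const_mul]
    exact setIntegral_congr_fun isClosed_closure.isOpen_compl.measurableSet
      fun y hy => h.cutoffDensity_sub_mul_cutoffError hχ x hs0 hs hy
  rw [integral_sub (h.integrableOn_cutoffDensity_slice hχ.continuous hχs x hs0.le hs)
    (h.integrableOn_mul_cutoffError hχ hχs x hs0.le (t - s))] at hgreen
  linarith

theorem abs_integral_mul_heatKernel_add_layer_le (hχ : ContDiff ℝ 2 χ) (hχs : HasCompactSupport χ)
    (hχ1 : ∀ y ∈ frontier Ω, χ =ᶠ[𝓝 y] 1)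
    {x : EuclideanSpace ℝ (Fin d)} (hx : x ∉ frontier Ω) {t T : ℝ} (hT0 : 0 ≤ T) (hT : T < t)
    {q : ℝ} (hq : ∀ s, 0 < s → s ≤ T →
      |∫ y in (closure Ω)ᶜ, v y s * cutoffError k χ x (t - s) y| ≤ q) :
    |(∫ y in (closure Ω)ᶜ, v y T * (χ y * heatKernel k (x - y) (t - T))) +
      k * ∫ s in (0 : ℝ)..T, ∫ y, layerIntegrand k Ω v x t s y ∂surfaceMeasure Ω| ≤ q * T := by
  have := isFiniteMeasure_surfaceMeasure h.isOpen h.isBounded h.lipschitz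
  have hdensity : IntervalIntegrable
      (fun s => ∫ y in (closure Ω)ᶜ, cutoffDensity k Ω v χ x t (y, s)) volume 0 T :=
    (intervalIntegrable_iff_integrableOn_Ioc_of_le hT0).2
      (h.integrable_cutoffDensity hχ.continuous hχs x hT).integral_prod_right
  have hlayer : IntervalIntegrable
      (fun s => ∫ y, layerIntegrand k Ω v x t s y ∂surfaceMeasure Ω) volume 0 T :=
    (intervalIntegrable_iff_integrableOn_Ioc_of_le hT0).2
      (IntegrableOn.mono_set (h.integrable_layerIntegrand hx t).integral_prod_left
        (Ioc_subset_Ioc_right hT.le))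
  rw [h.integral_mul_cutoff_mul_heatKernel hχ.continuous hχs x hT0 hT,
    ← intervalIntegral.integral_const_mul,
    ← intervalIntegral.integral_add hdensity (hlayer.const_mul k), ← Real.norm_eq_abs]
  refine (intervalIntegral.norm_integral_le_of_norm_le_const (C := q) fun s hs => ?_).trans_eq
    (by rw [sub_zero, abs_of_nonneg hT0])
  rw [uIoc_of_le hT0] at hs
  rw [h.integral_cutoffDensity_space hχ hχs hχ1 x hs.1 (hs.2.trans_lt hT), Real.norm_eq_abs,
    neg_mul, neg_add_cancel_comm]
  exact hq s hs.1 hs.2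

end IsExteriorHeatSolution

/-- A compactly supported `C²` function with values in `[-1, 1]` that equals `1` on the ball of
radius `R`, and whose gradient and Laplacian are bounded by `M`. -/
structure IsCutoff {d : ℕ} (M R : ℝ) (χ : EuclideanSpace ℝ (Fin d) → ℝ) : Prop where
  contDiff : ContDiff ℝ 2 χ
  hasCompactSupport : HasCompactSupport χ
  eq_one : ∀ y, ‖y‖ < R → χ y = 1
  abs_le_one : ∀ y, |χ y| ≤ 1
  norm_fderiv_le : ∀ y, ‖fderiv ℝ χ y‖ ≤ M
  abs_laplacian_le : ∀ y, |Δ χ y| ≤ M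

theorem exists_isCutoff (d : ℕ) :
    ∃ M, 0 ≤ M ∧ ∀ R, 1 ≤ R → ∃ χ : EuclideanSpace ℝ (Fin d) → ℝ, IsCutoff M R χ := by
  let φ : ContDiffBump (0 : EuclideanSpace ℝ (Fin d)) := ⟨1, 2, one_pos, one_lt_two⟩
  have hφ : ContDiff ℝ 2 φ := φ.contDiff
  have hφs : HasCompactSupport φ := φ.hasCompactSupport
  obtain ⟨M₁, hM₁⟩ := (hφs.fderiv ℝ).exists_bound_of_continuous (hφ.continuous_fderiv two_ne_zero)
  obtain ⟨M₂, hM₂⟩ := (HasCompactSupport.intro hφs.isCompact fun y hy =>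
    laplacian_eq_zero_of_notMem_tsupport hy).exists_bound_of_continuous (continuous_laplacian hφ)
  refine ⟨max M₁ M₂, ((norm_nonneg _).trans (hM₁ 0)).trans (le_max_left _ _), fun R hR => ?_⟩
  have hR0 : 0 < R := one_pos.trans_le hR
  have hRi : R⁻¹ ≤ 1 := inv_le_one_of_one_le₀ hR
  refine ⟨fun y => φ (R⁻¹ • y),
    { contDiff := hφ.comp (contDiff_const_smul _)
      hasCompactSupport := hφs.comp_smul (inv_ne_zero hR0.ne')
      eq_one := fun y hy => φ.one_of_mem_closedBall ?_
      abs_le_one := fun y => (abs_of_nonneg φ.nonneg).trans_le φ.le_one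
      norm_fderiv_le := fun y => ?_
      abs_laplacian_le := fun y => ?_ }⟩
  · rw [mem_closedBall_zero_iff, norm_smul, norm_inv, Real.norm_of_nonneg hR0.le]
    exact inv_mul_le_one_of_le₀ hy.le hR0.le
  · rw [fderiv_comp_smul (f := φ), norm_smul, norm_inv, Real.norm_of_nonneg hR0.le]
    exact (mul_le_of_le_one_left (norm_nonneg _) hRi).trans ((hM₁ _).trans (le_max_left _ _))
  · rw [laplacian_comp_smul hφ, abs_mul, abs_of_nonneg (by positivity)]
    exact (mul_le_of_le_one_left (abs_nonneg _) (pow_le_one₀ (by positivity) hRi)).trans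
      ((hM₂ _).trans (le_max_right _ _))

namespace IsCutoff

variable {d : ℕ} {k M R : ℝ} {χ : EuclideanSpace ℝ (Fin d) → ℝ} (hχ : IsCutoff M R χ)

include hχ

theorem eventuallyEq_one {y : EuclideanSpace ℝ (Fin d)} (hy : ‖y‖ < R) : χ =ᶠ[𝓝 y] 1 := by
  filter_upwards [(continuous_norm.tendsto y).eventually (gt_mem_nhds hy)] with z hz
  exact hχ.eq_one z hz

theorem cutoffError_eq_zero (x : EuclideanSpace ℝ (Fin d)) (τ : ℝ)
    {y : EuclideanSpace ℝ (Fin d)} (hy : ‖y‖ < R) : cutoffError k χ x τ y = 0 := by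
  have hgrad : fderiv ℝ χ y = 0 := by
    rw [(hχ.eventuallyEq_one hy).fderiv_eq, fderiv_one]
    rfl
  rw [cutoffError, hgrad, laplacian_eq_zero_of_eventuallyEq_const (hχ.eventuallyEq_one hy),
    zero_apply, mul_zero, mul_zero, add_zero]

theorem abs_cutoffError_le (hk : 0 < k) (x y : EuclideanSpace ℝ (Fin d)) {τ : ℝ} (hτ : 0 < τ) :
    |cutoffError k χ x τ y| ≤ heatKernel k (x - y) τ / τ * (M * (‖x - y‖ + k * τ)) := by
  have hK := heatKernel_nonneg hk (x - y) τ
  have hgrad : |fderiv ℝ χ y (x - y)| ≤ M * ‖x - y‖ :=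
    (fderiv ℝ χ y).le_of_opNorm_le (hχ.norm_fderiv_le y) (x - y)
  calc |cutoffError k χ x τ y|
      ≤ heatKernel k (x - y) τ / τ * |fderiv ℝ χ y (x - y)| +
          k * heatKernel k (x - y) τ * |Δ χ y| := by
        refine (abs_add_le _ _).trans_eq ?_
        rw [abs_mul, abs_mul, abs_of_nonneg (div_nonneg hK hτ.le),
          abs_of_nonneg (mul_nonneg hk.le hK)]
    _ ≤ heatKernel k (x - y) τ / τ * (M * ‖x - y‖) + k * heatKernel k (x - y) τ * M := by
        gcongr
        exact hχ.abs_laplacian_le y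
    _ = _ := by field_simp

end IsCutoff

theorem add_le_mul_exp_mul_sq {c γ r : ℝ} (hc : 0 ≤ c) (hγ : 0 < γ) (hr : 1 ≤ r) :
    r + c ≤ (1 + c) / γ * Real.exp (γ * r ^ 2) := by
  have hr2 : r ≤ r ^ 2 := le_self_pow₀ hr two_ne_zero
  calc r + c ≤ r ^ 2 + c * r ^ 2 := by
        gcongr
        exact le_mul_of_one_le_right hc (hr.trans hr2)
    _ = (1 + c) / γ * (γ * r ^ 2) := by field_simp
    _ ≤ _ := by
        gcongr
        exact (le_add_of_nonneg_right one_pos.le).trans (Real.add_one_le_exp _)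

theorem exp_mul_sq_norm_mul_le {V : Type*} [SeminormedAddCommGroup V] {γ c : ℝ} (hγ : 0 < γ)
    (hc : 0 ≤ c) {x y : V} (hxy : 1 ≤ ‖x - y‖) :
    Real.exp (γ / 2 * ‖y‖ ^ 2) * (Real.exp (-(4 * γ * ‖x - y‖ ^ 2)) * (‖x - y‖ + c)) ≤
      Real.exp (γ * ‖x‖ ^ 2) * ((1 + c) / γ) * Real.exp (-(2 * γ) * ‖x - y‖ ^ 2) := by
  have hsq : γ / 2 * ‖y‖ ^ 2 ≤ γ * ‖x‖ ^ 2 + γ * ‖x - y‖ ^ 2 := by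
    have := norm_add_sq_le_two_mul x (y - x)
    rw [add_sub_cancel, norm_sub_rev] at this
    nlinarith
  calc _ ≤ Real.exp (γ * ‖x‖ ^ 2 + γ * ‖x - y‖ ^ 2) * (Real.exp (-(4 * γ * ‖x - y‖ ^ 2)) *
        ((1 + c) / γ * Real.exp (γ * ‖x - y‖ ^ 2))) := by
        gcongr
        exact add_le_mul_exp_mul_sq hc hγ hxy
    _ = (1 + c) / γ * Real.exp (γ * ‖x‖ ^ 2 + γ * ‖x - y‖ ^ 2 + -(4 * γ * ‖x - y‖ ^ 2) +
          γ * ‖x - y‖ ^ 2) := by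
        simp only [Real.exp_add]
        ring
    _ = (1 + c) / γ * Real.exp (γ * ‖x‖ ^ 2 + -(2 * γ) * ‖x - y‖ ^ 2) := by
        congr 2
        ring
    _ = _ := by
        rw [Real.exp_add]
        ring

theorem IsExteriorHeatSolution.exists_abs_mul_cutoffError_le {d : ℕ} {k : ℝ}
    {Ω : Set (EuclideanSpace ℝ (Fin d))} {v : EuclideanSpace ℝ (Fin d) → ℝ → ℝ}
    (h : IsExteriorHeatSolution k Ω v) (hg : GrowthCondition k v) (x : EuclideanSpace ℝ (Fin d))
    {t M : ℝ} (ht : 0 < t) (hM : 0 ≤ M) :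
    ∃ D, 0 ≤ D ∧ ∀ R (χ : EuclideanSpace ℝ (Fin d) → ℝ), ‖x‖ + 1 ≤ R → IsCutoff M R χ →
      ∀ s, 0 < s → s < t → ∀ y ∈ Ωᶜ, |v y s * cutoffError k χ x (t - s) y| ≤
        {y | R ≤ ‖y‖}.indicator
          (fun y => D * Real.exp (-(1 / (16 * k * t)) * ‖x - y‖ ^ 2)) y := by
  have hk := h.pos
  obtain ⟨γ, hγ, hγt⟩ : ∃ γ, 0 < γ ∧ γ = 1 / (32 * k * t) := ⟨_, by positivity, rfl⟩
  obtain ⟨A, hA, hv⟩ := hg.exists_bound hk h.isOpen h.isBounded h.contDiffOn t (half_pos hγ)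
  obtain ⟨C, hC, hK⟩ := exists_heatKernel_div_le (d := d) hk one_pos
  refine ⟨A * C * M * (Real.exp (γ * ‖x‖ ^ 2) * ((1 + k * t) / γ)), by positivity,
    fun R χ hR hχ s hs0 hst y hy => ?_⟩
  have hτ : 0 < t - s := sub_pos.2 hst
  rcases lt_or_ge ‖y‖ R with hyR | hyR
  · rw [hχ.cutoffError_eq_zero x _ hyR, mul_zero, abs_zero]
    exact indicator_nonneg (fun _ _ => by positivity) y
  have hxy : 1 ≤ ‖x - y‖ := by linarith [norm_sub_norm_le y x, norm_sub_rev x y]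
  have herror : |cutoffError k χ x (t - s) y| ≤
      C * Real.exp (-(4 * γ * ‖x - y‖ ^ 2)) * (M * (‖x - y‖ + k * t)) := by
    have hKxy := hK t (t - s) hτ (by linarith) (x - y) hxy
    rw [show ‖x - y‖ ^ 2 / (8 * k * t) = 4 * γ * ‖x - y‖ ^ 2 by rw [hγt]; ring] at hKxy
    refine (hχ.abs_cutoffError_le hk x y hτ).trans ?_
    gcongr
    linarith
  rw [indicator_of_mem (show y ∈ {y | R ≤ ‖y‖} from hyR), abs_mul]
  calc |v y s| * |cutoffError k χ x (t - s) y| ≤ (A * Real.exp (γ / 2 * ‖y‖ ^ 2)) *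
        (C * Real.exp (-(4 * γ * ‖x - y‖ ^ 2)) * (M * (‖x - y‖ + k * t))) := by
        gcongr
        exact hv y hy s hs0 hst.le
    _ = A * C * M * (Real.exp (γ / 2 * ‖y‖ ^ 2) *
        (Real.exp (-(4 * γ * ‖x - y‖ ^ 2)) * (‖x - y‖ + k * t))) := by ring
    _ ≤ A * C * M * (Real.exp (γ * ‖x‖ ^ 2) * ((1 + k * t) / γ) *
        Real.exp (-(2 * γ) * ‖x - y‖ ^ 2)) :=
        mul_le_mul_of_nonneg_left (exp_mul_sq_norm_mul_le hγ (by positivity) hxy) (by positivity)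
    _ = _ := by
        rw [show 2 * γ = 1 / (16 * k * t) by rw [hγt]; field_simp; norm_num]
        ring

theorem tendsto_integral_indicator_le_norm {E F : Type*} [NormedAddCommGroup E]
    [MeasurableSpace E] [OpensMeasurableSpace E] [NormedAddCommGroup F] [NormedSpace ℝ F]
    {μ : Measure E} {g : E → F} (hg : Integrable g μ) {R : ℕ → ℝ} (hR : Tendsto R atTop atTop) :
    Tendsto (fun n => ∫ y, {y | R n ≤ ‖y‖}.indicator g y ∂μ) atTop (𝓝 0) := by
  have hmeas n : MeasurableSet {y : E | R n ≤ ‖y‖} :=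
    measurableSet_le measurable_const measurable_norm
  have hzero (y : E) : Tendsto (fun n => {y | R n ≤ ‖y‖}.indicator g y) atTop (𝓝 0) := by
    refine tendsto_const_nhds.congr' ?_
    filter_upwards [hR.eventually_gt_atTop ‖y‖] with n hn
    exact (indicator_of_notMem (s := {y | R n ≤ ‖y‖}) (not_le.2 hn) g).symm
  simpa only [integral_zero] using tendsto_integral_of_dominated_convergence (fun y => ‖g y‖)
    (fun n => (hg.indicator (hmeas n)).aestronglyMeasurable) hg.norm
    (fun n => .of_forall fun y => norm_indicator_le_norm_self _ _) (.of_forall hzero)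

theorem abs_setIntegral_le_integral {X : Type*} [MeasurableSpace X] {μ : Measure X} {s : Set X}
    {f g : X → ℝ} (hs : MeasurableSet s) (hg : Integrable g μ) (hg0 : ∀ x, 0 ≤ g x)
    (hfg : ∀ x ∈ s, |f x| ≤ g x) : |∫ x in s, f x ∂μ| ≤ ∫ x, g x ∂μ := by
  rw [← Real.norm_eq_abs]
  exact (norm_integral_le_of_norm_le hg.integrableOn
    ((ae_restrict_iff' hs).2 (.of_forall hfg))).trans
      (setIntegral_le_integral hg (.of_forall hg0))

theorem tendsto_intervalIntegral_right {ι : Type*} {l : Filter ι} {f : ℝ → ℝ} {a b : ℝ}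
    (hab : a ≤ b) (hf : IntegrableOn f (Ioc a b)) {T : ι → ℝ} (hT : Tendsto T l (𝓝[Icc a b] b)) :
    Tendsto (fun n => ∫ s in a..T n, f s) l (𝓝 (∫ s in a..b, f s)) := by
  have hcont := intervalIntegral.continuousOn_primitive_interval'
    ((intervalIntegrable_iff_integrableOn_Ioc_of_le hab).2 hf) left_mem_uIcc
  rw [uIcc_of_le hab] at hcont
  exact (hcont b (right_mem_Icc.2 hab)).tendsto.comp hT

namespace IsExteriorHeatSolution

variable {d : ℕ} {k : ℝ} {Ω : Set (EuclideanSpace ℝ (Fin d))}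
  {v : EuclideanSpace ℝ (Fin d) → ℝ → ℝ} (h : IsExteriorHeatSolution k Ω v)
  (hg : GrowthCondition k v) {x : EuclideanSpace ℝ (Fin d)} {t : ℝ}

include h

theorem measurable_indicator_mul {s : ℝ} (hs : 0 ≤ s) {χ : EuclideanSpace ℝ (Fin d) → ℝ}
    (hχ : Continuous χ) : Measurable ((closure Ω)ᶜ.indicator fun z => v z s * χ z) := by
  classical
  have hcont : ContinuousOn (fun z => v z s * χ z) (closure Ω)ᶜ :=
    ((h.contDiffOn_slice hs).continuousOn.mono (compl_closure_subset_compl Ω)).mul hχ.continuousOn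
  rw [← piecewise_eq_indicator]
  exact hcont.measurable_piecewise continuousOn_const isClosed_closure.isOpen_compl.measurableSet

include hg

theorem exists_cutoffs_tendsto_error (hx : x ∉ frontier Ω) (ht : 0 < t) :
    ∃ (χ : ℕ → EuclideanSpace ℝ (Fin d) → ℝ) (q : ℕ → ℝ), (∀ n, Continuous (χ n)) ∧
      (∀ n y, |χ n y| ≤ 1) ∧ (∀ n y, ‖y‖ < ‖x‖ + 1 → χ n y = 1) ∧ Tendsto q atTop (𝓝 0) ∧
      ∀ n T, 0 ≤ T → T < t →
        |(∫ y in (closure Ω)ᶜ, v y T * (χ n y * heatKernel k (x - y) (t - T))) +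
          k * ∫ s in (0 : ℝ)..T, ∫ y, layerIntegrand k Ω v x t s y ∂surfaceMeasure Ω| ≤
            q n * T := by
  have hk := h.pos
  obtain ⟨M, hM, hcut⟩ := exists_isCutoff d
  obtain ⟨D, hD0, hD⟩ := h.exists_abs_mul_cutoffError_le hg x ht hM
  obtain ⟨R₀, hR₀⟩ := h.isBounded.closure.subset_ball (0 : EuclideanSpace ℝ (Fin d))
  let R (n : ℕ) : ℝ := max R₀ (‖x‖ + 1) + n
  have hRΩ n : R₀ ≤ R n := le_add_of_le_of_nonneg (le_max_left _ _) n.cast_nonneg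
  have hRx n : ‖x‖ + 1 ≤ R n := le_add_of_le_of_nonneg (le_max_right _ _) n.cast_nonneg
  have hRtop : Tendsto R atTop atTop :=
    tendsto_atTop_add_const_left _ _ tendsto_natCast_atTop_atTop
  choose χ hχ using fun n => hcut (R n) ((le_add_of_nonneg_left (norm_nonneg x)).trans (hRx n))
  have hχ1 n : ∀ y ∈ frontier Ω, χ n =ᶠ[𝓝 y] 1 := fun y hy => (hχ n).eventuallyEq_one
    ((mem_ball_zero_iff.1 (hR₀ (frontier_subset_closure hy))).trans_le (hRΩ n))
  let g (y : EuclideanSpace ℝ (Fin d)) : ℝ := D * Real.exp (-(1 / (16 * k * t)) * ‖x - y‖ ^ 2)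
  have hgi : Integrable g :=
    ((integrable_exp_neg_mul_sq_norm (by positivity)).comp_sub_left x).const_mul D
  have hmeas n : MeasurableSet {y : EuclideanSpace ℝ (Fin d) | R n ≤ ‖y‖} :=
    measurableSet_le measurable_const measurable_norm
  refine ⟨χ, fun n => ∫ y, {y | R n ≤ ‖y‖}.indicator g y, fun n => (hχ n).contDiff.continuous,
    fun n => (hχ n).abs_le_one, fun n y hy => (hχ n).eq_one y (hy.trans_le (hRx n)),
    tendsto_integral_indicator_le_norm hgi hRtop, fun n T hT0 hT =>
      h.abs_integral_mul_heatKernel_add_layer_le (hχ n).contDiff (hχ n).hasCompactSupport (hχ1 n)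
        hx hT0 hT fun s hs0 hsT => ?_⟩
  exact abs_setIntegral_le_integral isClosed_closure.isOpen_compl.measurableSet
    (hgi.indicator (hmeas n)) (indicator_nonneg fun y _ => by positivity) fun y hy =>
      hD (R n) (χ n) (hRx n) (hχ n) s hs0 (hsT.trans_lt hT) y (compl_closure_subset_compl Ω hy)

theorem tendsto_integral_mul_cutoff_mul_heatKernel {L : ℝ}
    (hL : Tendsto (fun p : EuclideanSpace ℝ (Fin d) × ℝ =>
      (closure Ω)ᶜ.indicator (fun z => v z p.2) p.1) (𝓝 (x, t)) (𝓝 L))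
    {ε : ℕ → ℝ} (hε : ∀ n, ε n ∈ Ioo 0 (min t 1)) (hε0 : Tendsto ε atTop (𝓝 0))
    {χ : ℕ → EuclideanSpace ℝ (Fin d) → ℝ} (hχ : ∀ n, Continuous (χ n))
    (hχ_le : ∀ n y, |χ n y| ≤ 1) (hχ_one : ∀ n y, ‖y‖ < ‖x‖ + 1 → χ n y = 1) :
    Tendsto (fun n => ∫ y in (closure Ω)ᶜ, v y (t - ε n) * (χ n y * heatKernel k (x - y) (ε n)))
      atTop (𝓝 L) := by
  have hk := h.pos
  have hεt n : ε n < t := (hε n).2.trans_le (min_le_left _ _)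
  have hΩm : MeasurableSet (closure Ω)ᶜ := isClosed_closure.isOpen_compl.measurableSet
  let F (n : ℕ) : EuclideanSpace ℝ (Fin d) → ℝ :=
    (closure Ω)ᶜ.indicator fun z => v z (t - ε n) * χ n z
  have hFm n : Measurable (F n) := h.measurable_indicator_mul (sub_nonneg.2 (hεt n).le) (hχ n)
  obtain ⟨A, hA, hv⟩ := hg.exists_bound hk h.isOpen h.isBounded h.contDiffOn t
    (α := 1 / (16 * k)) (by positivity)
  have hF_le n y : |F n y| ≤ A * Real.exp (1 / (16 * k) * ‖y‖ ^ 2) := by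
    rw [← Real.norm_eq_abs, norm_indicator_eq_indicator_norm]
    refine indicator_apply_le' (fun hy => ?_) fun _ => by positivity
    rw [norm_mul]
    exact (mul_le_of_le_one_right (abs_nonneg _) (hχ_le n y)).trans
      (hv y (compl_closure_subset_compl Ω hy) _ (sub_pos.2 (hεt n)) (sub_le_self t (hε n).1.le))
  have hF_lim z : Tendsto (fun n => F n (x + √(ε n) • z)) atTop (𝓝 L) := by
    have hxz : Tendsto (fun n => x + √(ε n) • z) atTop (𝓝 x) := by
      simpa using tendsto_const_nhds.add ((Real.continuous_sqrt.tendsto' 0 0 Real.sqrt_zero).comp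
        hε0 |>.smul_const z)
    have ht : Tendsto (fun n => t - ε n) atTop (𝓝 t) := by
      simpa using tendsto_const_nhds.sub hε0
    refine (hL.comp (hxz.prodMk_nhds ht)).congr' ?_
    filter_upwards [hxz.norm.eventually (gt_mem_nhds (lt_add_one ‖x‖))] with n hn
    simp only [Function.comp_apply, F, indicator, hχ_one n _ hn, mul_one]
  refine (tendsto_integral_mul_heatKernel hk (fun n => (hε n).1)
    (fun n => (hε n).2.le.trans (min_le_right _ _)) x hFm hF_le hF_lim).congr fun n => ?_
  rw [← integral_indicator hΩm]
  congr 1 with y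
  simp only [F, indicator]
  split_ifs <;> ring

theorem exteriorLayerField_eq_of_tendsto (hx : x ∉ frontier Ω) (ht : 0 < t) {L : ℝ}
    (hL : Tendsto (fun p : EuclideanSpace ℝ (Fin d) × ℝ =>
      (closure Ω)ᶜ.indicator (fun z => v z p.2) p.1) (𝓝 (x, t)) (𝓝 L)) :
    exteriorLayerField k Ω v x t = L := by
  have := isFiniteMeasure_surfaceMeasure h.isOpen h.isBounded h.lipschitz
  obtain ⟨χ, q, hχ, hχ_le, hχ_one, hq, herror⟩ := h.exists_cutoffs_tendsto_error hg hx ht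
  obtain ⟨ε, -, hε, hε0⟩ := exists_seq_strictAnti_tendsto' (lt_min ht one_pos)
  have hεt n : 0 ≤ t - ε n := sub_nonneg.2 ((hε n).2.le.trans (min_le_left _ _))
  have hεlt n : t - ε n < t := sub_lt_self t (hε n).1
  have hT : Tendsto (fun n => t - ε n) atTop (𝓝 t) := by
    simpa using tendsto_const_nhds.sub hε0
  have hpotential := h.tendsto_integral_mul_cutoff_mul_heatKernel hg hL hε hε0 hχ hχ_le hχ_one
  have hlayer := tendsto_intervalIntegral_right ht.le
    (h.integrable_layerIntegrand hx t).integral_prod_left (tendsto_nhdsWithin_iff.2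
      ⟨hT, .of_forall fun n => ⟨hεt n, (hεlt n).le⟩⟩)
  have hzero := squeeze_zero_norm
    (fun n => (Real.norm_eq_abs _).trans_le (herror n (t - ε n) (hεt n) (hεlt n)))
    (by simpa using hq.mul hT)
  simp only [sub_sub_cancel] at hzero
  rw [exteriorLayerField, neg_mul]
  exact neg_eq_of_add_eq_zero_left
    (tendsto_nhds_unique (hpotential.add (hlayer.const_mul k)) hzero)

theorem exteriorLayerField_eq_zero (hx : x ∈ Ω) (ht : 0 < t) :
    exteriorLayerField k Ω v x t = 0 := by
  refine h.exteriorLayerField_eq_of_tendsto hg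
    (fun hf => frontier_subset_compl h.isOpen hf hx) ht (tendsto_const_nhds.congr' ?_)
  filter_upwards [(continuous_fst.tendsto (x, t)).eventually (h.isOpen.mem_nhds hx)] with p hp
  exact (indicator_of_notMem (not_not_intro (subset_closure hp)) _).symm

theorem exteriorLayerField_eq (hx : x ∉ closure Ω) (ht : 0 < t) :
    exteriorLayerField k Ω v x t = v x t := by
  have hΩx : (closure Ω)ᶜ ∈ 𝓝 x := isClosed_closure.isOpen_compl.mem_nhds hx
  have hcont : ContinuousAt (fun p : EuclideanSpace ℝ (Fin d) × ℝ => v p.1 p.2) (x, t) :=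
    h.continuousOn.continuousAt
      (prod_mem_nhds (mem_of_superset hΩx (compl_closure_subset_compl Ω)) (Ici_mem_nhds ht))
  refine h.exteriorLayerField_eq_of_tendsto hg (fun hf => hx (frontier_subset_closure hf)) ht
    (hcont.tendsto.congr' ?_)
  filter_upwards [(continuous_fst.tendsto (x, t)).eventually hΩx] with p hp
  exact (indicator_of_mem (s := (closure Ω)ᶜ) hp fun z => v z p.2).symm

end IsExteriorHeatSolution

theorem theorem2p1_general (d : ℕ) (k : ℝ) (hk : 0 < k)
    (Ω : Set (EuclideanSpace ℝ (Fin d))) (hΩ_open : IsOpen Ω)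
    (hΩ_bdd : Bornology.IsBounded Ω) (hΩ_lip : HasLipschitzBoundary Ω)
    (v h : EuclideanSpace ℝ (Fin d) → ℝ → ℝ)
    (hv_smooth : ContDiffOn ℝ 2 (fun p : EuclideanSpace ℝ (Fin d) × ℝ => v p.1 p.2)
      (Ωᶜ ×ˢ Ici (0 : ℝ)))
    (h_supp : ∀ t > 0, tsupport (fun x => h x t) ⊆ closure Ω)
    (hv_heat : ∀ x ∉ closure Ω, ∀ t > 0,
      deriv (fun s => v x s) t = k * Δ (fun z => v z t) x + h x t)
    (hv_init : ∀ x ∉ Ω, v x 0 = 0)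
    (hv_growth : GrowthCondition k v) :
    ∀ t > 0,
      (∀ x ∉ frontier Ω,
        Integrable (fun p : ℝ × EuclideanSpace ℝ (Fin d) => layerIntegrand k Ω v x t p.1 p.2)
          ((volume.restrict (Ioc 0 t)).prod (surfaceMeasure Ω))) ∧
      (∀ x ∈ Ω, exteriorLayerField k Ω v x t = 0) ∧
      (∀ x ∉ closure Ω, exteriorLayerField k Ω v x t = v x t) := by
  have hsource {x t} (hx : x ∉ closure Ω) (ht : 0 < t) : h x t = 0 :=
    image_eq_zero_of_notMem_tsupport (f := fun x => h x t) fun hm => hx (h_supp t ht hm)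
  have hsol : IsExteriorHeatSolution k Ω v :=
    { pos := hk
      isOpen := hΩ_open
      isBounded := hΩ_bdd
      lipschitz := hΩ_lip
      contDiffOn := hv_smooth
      heat := fun x hx t ht => by rw [hv_heat x hx t ht, hsource hx ht, add_zero]
      initial_eq_zero := hv_init }
  exact fun t ht => ⟨fun x hx => hsol.integrable_layerIntegrand hx t,
    fun x hx => hsol.exteriorLayerField_eq_zero hv_growth hx ht,
    fun x hx => hsol.exteriorLayerField_eq hv_growth hx ht⟩

theorem theorem2p1 (d : ℕ) (hd : 2 ≤ d) (k : ℝ) (hk : 0 < k)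
    (Ω : Set (EuclideanSpace ℝ (Fin d))) (hΩ_open : IsOpen Ω) (hΩ_ne : Ω.Nonempty)
    (hΩ_bdd : Bornology.IsBounded Ω) (hΩ_lip : HasLipschitzBoundary Ω)
    (v h : EuclideanSpace ℝ (Fin d) → ℝ → ℝ)
    (hv_smooth : ContDiffOn ℝ 2 (fun p : EuclideanSpace ℝ (Fin d) × ℝ => v p.1 p.2)
      (Ωᶜ ×ˢ Ici (0 : ℝ)))
    (h_supp : ∀ t > 0, tsupport (fun x => h x t) ⊆ closure Ω)
    (hv_heat : ∀ x ∉ closure Ω, ∀ t > 0,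
      deriv (fun s => v x s) t = k * Laplacian.laplacian (fun z => v z t) x + h x t)
    (hv_init : ∀ x ∉ Ω, v x 0 = 0)
    (hv_growth : GrowthCondition k v) :
    ∀ t > 0,
      (∀ x ∉ frontier Ω,
        Integrable (fun p : ℝ × EuclideanSpace ℝ (Fin d) => layerIntegrand k Ω v x t p.1 p.2)
          ((volume.restrict (Ioc 0 t)).prod (surfaceMeasure Ω))) ∧
      (∀ x ∈ Ω, exteriorLayerField k Ω v x t = 0) ∧
      (∀ x ∉ closure Ω, exteriorLayerField k Ω v x t = v x t) :=
  theorem2p1_general d k hk Ω hΩ_open hΩ_bdd hΩ_lip v h hv_smooth h_supp hv_heat hv_init hv_growth
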